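/- **Setting.** Let $d\ge 0$ and $\tau\ge1$ be integers, $T>0$, and let $\xi(t),\eta(t)$, $t\in\mathbb R$, be stochastic processes with values in $L_2(\Omega,\mathcal F,\mathsf P;\mathbb C)$ whose trajectories are square-integrable over bounded intervals. Put $\xi^{(d)}(t,s)=\sum_{l=0}^d(-1)^l\binom dl\xi(t-ls)$. Assume that the increments $\xi^{(d)}(t,\tau T)$, $\eta^{(d)}(t,\tau T)$ have mean zero, are periodically correlated with period $T$ (their second moments $\mathsf E X(t)\overline{X(s)}$ do not change under $(t,s)\mapsto(t+T,s+T)$), and that the two increment processes are uncorrelated with each other. Let $s_1,s_2,s_3,\dots=0,1,-1,2,-2,\dots$ and let $$\xi^{(d)}_{kj}=\frac1{\sqrt T}\int_0^T\xi^{(d)}(jT-u,\tau T)\,e^{-2\pi i s_ku/T}\,du,\qquad k\ge1,\ j\in\mathbb Z,$$ be the components of the generated vector stationary increment sequence $\vec\xi^{(d)}_j=(\xi^{(d)}_{kj})_{k\ge1}$; $\vec\eta^{(d)}_j$ is defined likewise. Put $$w(\lambda)=\frac{|1-e^{i\lambda\tau}|^{2d}}{\lambda^{2d}},\qquad v(\lambda)=\frac{(1-e^{-i\lambda\tau})^d}{(i\lambda)^d}.$$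 Assume that these sequences have spectral densities $f$, $g$: for a.e. $\lambda\in(-\pi,\pi]$ the matrices $f(\lambda)=(f_{kn}(\lambda))$, $g(\lambda)$ are positive operators in $\ell_2$, $\sum_k\int_{-\pi}^{\pi} w f_{kk}\,d\lambda<\infty$, and $\mathsf E\,\xi^{(d)}_{kl}\overline{\xi^{(d)}_{nj}}=\frac1{2\pi}\int_{-\pi}^{\pi}e^{i(l-j)\lambda}w(\lambda)f_{kn}(\lambda)\,d\lambda$ for all $k,n,l,j$ (and the same for $\vec\eta^{(d)}$, $g$). Assume the minimality condition $\int_{-\pi}^{\pi}w^{-1}(f+g)^{-1}d\lambda<\infty$, understood for the entries of the matrix. Here $f+g$ is an injective trace class operator, so $(f+g)^{-1}$ is unbounded; expressions $x^\top(f+g)^{-1}\bar y$ are understood as $\langle (f+g)^{-1/2}\bar x,(f+g)^{-1/2}\bar y\rangle$, that is, through the quadratic form of $(f+g)^{-1}$. Let $a\colon[0,\infty)\to\mathbb C$ be locally square-integrable, $\vec a_j=(a_{kj})_{k\ge1}$ with $a_{kj}=\frac1{\sqrt T}\int_0^Ta(u+jT)e^{2\pi is_ku/T}du$, let $\sum_kd_\tau(k)x^k=(\sum_jx^{\tau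 j})^d$, and $$\vec b_j=(D^\tau\mathbf a)_j=\sum_{m=0}^jd_\tau(j-m)\vec a_m,\qquad \vec B_\tau(e^{-i\lambda})=\sum_{j\ge0}\vec b_je^{-i\lambda j}.$$ Assume $\sum_j\|\vec b_j\|<\infty$ and $\sum_j(j+1)\|\vec b_j\|<\infty$. **Operators.** For $l,j\ge0$ let $$R_{l,j}=\frac1{2\pi}\int_{-\pi}^{\pi} e^{-i\lambda(l+j)}\big(f(f+g)^{-1}\big)^\top d\lambda,\qquad P_{l,j}=\frac1{2\pi}\int_{-\pi}^{\pi} e^{-i\lambda(l-j)}w^{-1}\big((f+g)^{-1}\big)^\top d\lambda,$$ $$Q_{l,j}=\frac1{2\pi}\int_{-\pi}^{\pi} e^{i\lambda(l-j)}w\,\big(f(f+g)^{-1}g\big)^\top d\lambda,$$ and let $\mathbf R,\mathbf P_\tau,\mathbf Q_\tau$ be the operators in $\ell_2$ with the matrices $(R_{l+1,j})$, $(P_{l,j})$, $(Q_{l,j})$, $l,j\ge0$. The (unbounded) operator $\mathbf P_\tau$ is the Toeplitz operator with this matrix: its domain consists of those $\mathbf c=(\vec c_j)\in\ell_2$ for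 which $C(\lambda)=\sum_j\vec c_je^{i\lambda(j+1)}$ (a series convergent in $L_2$) satisfies $\int_{-\pi}^{\pi} w^{-1}C^\top(f+g)^{-1}\overline C\,d\lambda<\infty$ and for which the vectors $(\mathbf P_\tau\mathbf c)_l=\frac1{2\pi}\int_{-\pi}^{\pi} e^{-i\lambda(l+1)}w^{-1}((f+g)^{-1})^\top C\,d\lambda$, $l\ge0$, form an element of $\ell_2$. Assume that $\mathbf P_\tau$ is injective, so that $\mathbf P_\tau^{-1}$ exists, and that $\mathbf RD^\tau\mathbf a\in\ell_2$ lies in the domain of $\mathbf P_\tau^{-1}$. Put $\vec C_\tau(e^{i\lambda})=\sum_{j\ge0}(\mathbf P_\tau^{-1}\mathbf RD^\tau\mathbf a)_je^{i\lambda(j+1)}$. **Theorem.** The series $B\vec\xi=\sum_{j\ge0}\vec b_j^{\,\top}\vec\xi^{(d)}_{-j}$ converges in $L_2(\Omega)$, and $A\xi=\int_0^\infty a(t)\xi(-t)\,dt$ equals $B\vec\xi$ whenever this integral converges (as $\lim_{M\to\infty}\int_0^M$ in $L_2(\Omega)$). Let $H^0$ be the closed linear span in $L_2(\Omega)$ of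 $\xi^{(d)}_{kj}+\eta^{(d)}_{kj}$, $k\ge1$, $j\le0$ (the increments of the observed process $\xi+\eta$ at $t\le0$). There is exactly one mean square optimal estimate $\widehat A\xi=\widehat B\vec\xi$ of $B\vec\xi$ by elements of $H^0$, and $$\widehat A\xi=\int_{-\pi}^{\pi}(\vec h_\tau(\lambda))^\top d\vec Z_{\xi^{(d)}+\eta^{(d)}}(\lambda)$$ with the spectral characteristic, an element of the weighted space $L_2(f+g)$, $$(\vec h_\tau)^\top=(\vec B_\tau(e^{-i\lambda}))^\top v(\lambda)\,f(f+g)^{-1}-\frac{(-i\lambda)^d}{(1-e^{i\lambda\tau})^d}(\vec C_\tau(e^{i\lambda}))^\top(f+g)^{-1}.$$ Its mean square error $\Delta=\mathsf E|B\vec\xi-\widehat B\vec\xi|^2$ is $$\Delta=\frac1{2\pi}\int_{-\pi}^{\pi} w^{-1}\big(w\vec B_\tau^\top g+\vec C_\tau^\top\big)(f+g)^{-1}f(f+g)^{-1}\big(wg\overline{\vec B_\tau}+\overline{\vec C_\tau}\big)d\lambda$$ $$\qquad+\frac1{2\pi}\int_{-\pi}^{\pi} w^{-1}\big(w\vec B_\tau^\top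 f-\vec C_\tau^\top\big)(f+g)^{-1}g(f+g)^{-1}\big(wf\overline{\vec B_\tau}-\overline{\vec C_\tau}\big)d\lambda$$ $$=\langle\mathbf RD^\tau\mathbf a,\mathbf P_\tau^{-1}\mathbf RD^\tau\mathbf a\rangle+\langle\mathbf Q_\tau D^\tau\mathbf a,D^\tau\mathbf a\rangle .$$ -/

import Mathlib

open MeasureTheory Filter Topology
open scoped ComplexConjugate

namespace PCFilter

noncomputable section

/-! ## Hilbert spaces, row vectors and the inverse of a trace class operator -/

/-- The space `ℓ²` of square-summable complex sequences, indexed by `k = 0, 1, 2, …`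
(the index `k` here is the index `k + 1` of the usual enumeration `1, 2, 3, …`). -/
abbrev Seq2 : Type := lp (fun _ : ℕ => ℂ) 2

/-- The space `ℓ²` of square-summable sequences of vectors of `ℓ²`. -/
abbrev VecSeq2 : Type := lp (fun _ : ℕ => Seq2) 2

/-- The `k`-th coordinate vector. -/
def delta (k : ℕ) : Seq2 := lp.single 2 k (1 : ℂ)

/-- The element of `ℓ²` with the given coordinates (`0` if they are not square-summable). -/
def toSeq2 (x : ℕ → ℂ) : Seq2 :=
  open Classical in if h : Memℓp x 2 then ⟨x, h⟩ else 0

/-- The row vector `xᵀ A`, where `A` is the matrix `A k n = (A δ_n)_k`. Vectors are not conjugated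
by the transposition: `xᵀ A` has the coordinates `∑ k, x k * A k n`. -/
def rowMul (x : Seq2) (A : Seq2 →L[ℂ] Seq2) : Seq2 :=
  star (ContinuousLinearMap.adjoint A (star x))

/-- The square root `F^{1/2}` of a positive operator `F` on a Hilbert space. -/
def opSqrt {H : Type*} [NormedAddCommGroup H] [InnerProductSpace ℂ H] [CompleteSpace H]
    (F : H →L[ℂ] H) : H →L[ℂ] H := CFC.sqrt F

/-- `x` lies in the range of `F^{1/2}`, the form domain of the unbounded operator `F⁻¹`. -/
def InFormDomain (F : Seq2 →L[ℂ] Seq2) (x : Seq2) : Prop :=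
  ∃ u : Seq2, opSqrt F u = x

/-- `F^{-1/2} x`: the solution `u`, orthogonal to the kernel of `F^{1/2}`, of `F^{1/2} u = x`
(and `0` if `x` is not in the range of `F^{1/2}`). -/
def invSqrt (F : Seq2 →L[ℂ] Seq2) (x : Seq2) : Seq2 :=
  open Classical in
  if h : ∃ u : Seq2, opSqrt F u = x ∧ ∀ z : Seq2, opSqrt F z = 0 → inner ℂ z u = 0
  then h.choose else 0

/-- `xᵀ F⁻¹ ȳ`, the sesquilinear form of the inverse `F⁻¹` (an unbounded operator when `F` is a
trace class operator), equal to `⟨F^{-1/2} x̄, F^{-1/2} ȳ⟩` for `x̄`, `ȳ` in the form domain. -/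
def invForm (F : Seq2 →L[ℂ] Seq2) (x y : Seq2) : ℂ :=
  inner ℂ (invSqrt F (star x)) (invSqrt F (star y))

/-- `F^{-1/2} f F^{-1/2}`: for `F` injective and `0 ≤ f ≤ F`, the unique bounded operator `K`
with `F^{1/2} K F^{1/2} = f`. -/
def whiten (F f : Seq2 →L[ℂ] Seq2) : Seq2 →L[ℂ] Seq2 :=
  open Classical in
  if h : ∃ K : Seq2 →L[ℂ] Seq2, (opSqrt F).comp (K.comp (opSqrt F)) = f
  then h.choose else 0

/-- `yᵀ F⁻¹ f F⁻¹ ȳ`, that is `⟨u, (F^{-1/2} f F^{-1/2}) u⟩` with `u = F^{-1/2} ȳ`. -/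
def sandwich (F f : Seq2 →L[ℂ] Seq2) (y : Seq2) : ℂ :=
  inner ℂ (invSqrt F (star y)) (whiten F f (invSqrt F (star y)))

/-! ## Processes with periodically correlated increments -/

section Processes

variable {Ω : Type*} [MeasurableSpace Ω] {P : Measure Ω}

/-- `E X`. -/
def expect (X : Lp ℂ 2 P) : ℂ := ∫ ω, X ω ∂P

/-- `E X Ȳ`. -/
def moment (X Y : Lp ℂ 2 P) : ℂ := ∫ ω, X ω * conj (Y ω) ∂P

/-- The increment `ξ^{(d)}(t, s) = ∑_{l ≤ d} (-1)^l (d choose l) ξ(t - l s)` of order `d` with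
step `s`. -/
def increment (d : ℕ) (ξ : ℝ → Lp ℂ 2 P) (t s : ℝ) : Lp ℂ 2 P :=
  ∑ l ∈ Finset.range (d + 1), ((-1 : ℂ) ^ l * (d.choose l : ℂ)) • ξ (t - l * s)

/-- The trajectory in `L²(Ω)` is measurable and square-integrable over bounded intervals
(a mean-square continuous process has this property). -/
def LocallySquareIntegrable (ξ : ℝ → Lp ℂ 2 P) : Prop :=
  ∀ M : ℝ, MemLp ξ 2 (volume.restrict (Set.Icc (-M) M))

/-- The `d`-th increments of `ξ` with step `τ T` are periodically correlated with period `T`. -/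
structure HasPCIncrements (d τ : ℕ) (T : ℝ) (ξ : ℝ → Lp ℂ 2 P) : Prop where
  mean : ∀ t : ℝ, expect (increment d ξ (t + T) (τ * T)) = expect (increment d ξ t (τ * T))
  corr : ∀ t s : ℝ,
    moment (increment d ξ (t + T) (τ * T)) (increment d ξ (s + T) (τ * T))
      = moment (increment d ξ t (τ * T)) (increment d ξ s (τ * T))

/-- The increment processes of `ξ` and `η` are uncorrelated. -/
def UncorrelatedIncrements (d τ : ℕ) (T : ℝ) (ξ η : ℝ → Lp ℂ 2 P) : Prop :=
  ∀ t s : ℝ, moment (increment d ξ t (τ * T)) (increment d η s (τ * T))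
    = expect (increment d ξ t (τ * T)) * conj (expect (increment d η s (τ * T)))

/-- The frequency numbers `0, 1, -1, 2, -2, …` of the orthonormal basis
`e_k(u) = T^{-1/2} exp(2 π i s_k u / T)` of `L²[0, T)`. -/
def freq (k : ℕ) : ℤ := (-1) ^ (k + 1) * (((k + 1) / 2 : ℕ) : ℤ)

/-- The components `ξ_{kj} = ⟨ξ_j, e_k⟩` of the generated stationary increment sequence
`ξ_j(u) = ξ^{(d)}(j T - u, τ T)`, `u ∈ [0, T)`. -/
def genSeq (d τ : ℕ) (T : ℝ) (ξ : ℝ → Lp ℂ 2 P) (k : ℕ) (j : ℤ) : Lp ℂ 2 P :=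
  ((1 / Real.sqrt T : ℝ) : ℂ) •
    ∫ u in (0 : ℝ)..T, Complex.exp (-(2 * Real.pi * Complex.I * (freq k : ℂ) * u / T)) •
      increment d ξ (j * T - u) (τ * T)

end Processes

/-! ## Spectral densities -/

/-- Lebesgue measure on `(-π, π]`. -/
def circ : Measure ℝ := volume.restrict (Set.Ioc (-Real.pi) Real.pi)

/-- `|1 - e^{iθτ}|^{2d} / θ^{2d}`. -/
def weight (d τ : ℕ) (θ : ℝ) : ℝ :=
  ‖1 - Complex.exp (Complex.I * θ * τ)‖ ^ (2 * d) / θ ^ (2 * d)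

/-- `(1 - e^{-iθτ})^d / (iθ)^d`. -/
def transfer (d τ : ℕ) (θ : ℝ) : ℂ :=
  (1 - Complex.exp (-(Complex.I * θ * τ))) ^ d / (Complex.I * θ) ^ d

/-- `f` is the spectral density (matrix) of the vector stationary `d`-th increment sequence `x` with
step `τ`: it is a.e. a positive operator, the matrix entries, weighted by
`|1 - e^{iθτ}|^{2d} / θ^{2d}`, are integrable with summable diagonal integrals (a trace class
operator with integrable trace norm), and
`E x_{kl} conj(x_{nj}) = (2π)⁻¹ ∫ e^{i(l-j)θ} |1 - e^{iθτ}|^{2d} θ^{-2d} f_{kn}(θ) dθ`. -/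
structure IsSpectralDensity {Ω : Type*} [MeasurableSpace Ω] {P : Measure Ω}
    (d τ : ℕ) (x : ℕ → ℤ → Lp ℂ 2 P) (f : ℝ → Seq2 →L[ℂ] Seq2) : Prop where
  pos : ∀ᵐ θ ∂circ, (f θ).IsPositive
  integrable : ∀ k n : ℕ, Integrable (fun θ => (weight d τ θ : ℂ) * (f θ (delta n)) k) circ
  trace : Summable fun k : ℕ => ∫ θ, weight d τ θ * ((f θ (delta k)) k).re ∂circ
  moments : ∀ (k n : ℕ) (l j : ℤ), moment (x k l) (x n j)
    = (1 / (2 * Real.pi) : ℂ) * ∫ θ, Complex.exp (Complex.I * ((l - j : ℤ) : ℂ) * θ)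
        * ((weight d τ θ : ℂ) * (f θ (delta n)) k) ∂circ

/-- The minimality condition `∫ θ^{2d} |1 - e^{iθτ}|^{-2d} F(θ)⁻¹ dθ < ∞`, entry by entry: the
diagonal entries of the matrix `F(θ)⁻¹` exist for almost every `θ` and are integrable with this
weight (then so are all other entries, since `F(θ)⁻¹` is positive). -/
def Minimality (d τ : ℕ) (F : ℝ → Seq2 →L[ℂ] Seq2) : Prop :=
  ∀ k : ℕ, (∀ᵐ θ ∂circ, InFormDomain (F θ) (delta k)) ∧
    ∫⁻ θ, ENNReal.ofReal ((weight d τ θ)⁻¹ * ‖invSqrt (F θ) (delta k)‖ ^ 2) ∂circ < ⊤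

/-! ## Coefficients of the functional -/

/-- The vectors `a_j`. Their `k`-th coordinate is the coefficient of `u ↦ a(u + j T)`
at the frequency `-s_k` (that is, the coefficients in the order `a_1, a_3, a_2, a_5, a_4, …`), so
that `∫_0^T x(u) y(u) du` is the sum of the products of these coordinates for `x` with the
coordinates `⟨y, e_k⟩`. -/
def aVec (T : ℝ) (a : ℝ → ℂ) (j : ℕ) : Seq2 :=
  toSeq2 fun k => ((1 / Real.sqrt T : ℝ) : ℂ) *
    ∫ u in (0 : ℝ)..T, a (u + j * T) * Complex.exp (2 * Real.pi * Complex.I * (freq k : ℂ) * u / T)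

/-- The coefficients of the power series `∑ d_τ(k) x^k = (∑ x^{τ j})^d`. -/
def dCoeff (d τ k : ℕ) : ℂ :=
  PowerSeries.coeff k ((PowerSeries.mk fun n => if τ ∣ n then (1 : ℂ) else 0) ^ d)

/-- The vectors `b_j = (D^τ a)_j = ∑_{m ≤ j} d_τ(j - m) a_m`. -/
def bVec (d τ : ℕ) (T : ℝ) (a : ℝ → ℂ) (j : ℕ) : Seq2 :=
  ∑ m ∈ Finset.range (j + 1), dCoeff d τ (j - m) • aVec T a m

/-- `B(e^{-iθ}) = ∑ b_j e^{-iθj}`. -/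
def bFun (b : ℕ → Seq2) (θ : ℝ) : Seq2 :=
  ∑' j : ℕ, Complex.exp (-(Complex.I * θ * j)) • b j

/-! ## The operators `R`, `P`, `Q` -/

/-- The entry `(k, n)` of the matrix
`R_{l,j} = (2π)⁻¹ ∫ e^{-iθ(l+j)} (f (f+g)⁻¹)ᵀ dθ`. -/
def matR (f g : ℝ → Seq2 →L[ℂ] Seq2) (l j k n : ℕ) : ℂ :=
  (1 / (2 * Real.pi) : ℂ) * ∫ θ, Complex.exp (-(Complex.I * θ * ((l : ℂ) + j)))
    * invForm (f θ + g θ) (rowMul (delta n) (f θ)) (delta k) ∂circ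

/-- The entry `(k, n)` of the matrix
`P_{l,j} = (2π)⁻¹ ∫ e^{-iθ(l-j)} θ^{2d} |1 - e^{iθτ}|^{-2d} ((f+g)⁻¹)ᵀ dθ`. -/
def matP (d τ : ℕ) (f g : ℝ → Seq2 →L[ℂ] Seq2) (l j k n : ℕ) : ℂ :=
  (1 / (2 * Real.pi) : ℂ) * ∫ θ, Complex.exp (-(Complex.I * θ * ((l : ℂ) - j)))
    * (((weight d τ θ)⁻¹ : ℝ) : ℂ) * invForm (f θ + g θ) (delta n) (delta k) ∂circ

/-- The entry `(k, n)` of the matrix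
`Q_{l,j} = (2π)⁻¹ ∫ e^{iθ(l-j)} |1 - e^{iθτ}|^{2d} θ^{-2d} (f (f+g)⁻¹ g)ᵀ dθ`
(`g` is self-adjoint, so the entry `(n, k)` of `f (f+g)⁻¹ g` is `xᵀ (f+g)⁻¹ ȳ` for the rows
`xᵀ = δ_nᵀ f` and `yᵀ = δ_kᵀ g`). -/
def matQ (d τ : ℕ) (f g : ℝ → Seq2 →L[ℂ] Seq2) (l j k n : ℕ) : ℂ :=
  (1 / (2 * Real.pi) : ℂ) * ∫ θ, Complex.exp (Complex.I * θ * ((l : ℂ) - j))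
    * (weight d τ θ : ℂ)
    * invForm (f θ + g θ) (rowMul (delta n) (f θ)) (rowMul (delta k) (g θ)) ∂circ

/-- `r = R b`, for the operator with the entries `R_{l+1,j}`, `l, j ≥ 0`. -/
def IsRImage (f g : ℝ → Seq2 →L[ℂ] Seq2) (b : ℕ → Seq2) (r : VecSeq2) : Prop :=
  ∀ l k : ℕ, HasSum (fun p : ℕ × ℕ => matR f g (l + 1) p.1 k p.2 * b p.1 p.2) (r l k)

/-- `q = Q b`, entry by entry. -/
def IsQImage (d τ : ℕ) (f g : ℝ → Seq2 →L[ℂ] Seq2) (b : ℕ → Seq2) (q : ℕ → ℕ → ℂ) : Prop :=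
  ∀ l k : ℕ, HasSum (fun p : ℕ × ℕ => matQ d τ f g l p.1 k p.2 * b p.1 p.2) (q l k)

/-- `C` is the sum in `L²((-π, π]; ℓ²)` of the series `∑ c_j e^{iθ(j+1)}`. -/
def IsSeriesSum (c : VecSeq2) (C : ℝ → Seq2) : Prop :=
  MemLp C 2 circ ∧
    Tendsto (fun N : ℕ => eLpNorm (fun θ =>
      C θ - ∑ j ∈ Finset.range N, Complex.exp (Complex.I * θ * ((j : ℂ) + 1)) • c j) 2 circ)
      atTop (𝓝 0)

/-- The form `(2π)⁻¹ ∫ θ^{2d} |1 - e^{iθτ}|^{-2d} Uᵀ (f+g)⁻¹ V̄ dθ`. -/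
def formP (d τ : ℕ) (f g : ℝ → Seq2 →L[ℂ] Seq2) (U V : ℝ → Seq2) : ℂ :=
  (1 / (2 * Real.pi) : ℂ) * ∫ θ, (((weight d τ θ)⁻¹ : ℝ) : ℂ) * invForm (f θ + g θ) (U θ) (V θ) ∂circ

/-- The function `e^{iθ(l+1)} δ_k`. -/
def expVec (l k : ℕ) (θ : ℝ) : Seq2 := Complex.exp (Complex.I * θ * ((l : ℂ) + 1)) • delta k

/-- `F^{-1/2}` is homogeneous. -/
theorem invSqrt_smul (F : Seq2 →L[ℂ] Seq2) {z : ℂ} (hz : z ≠ 0) (x : Seq2) :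
    invSqrt F (z • x) = z • invSqrt F x := by
  by_cases h : ∃ u : Seq2, opSqrt F u = x ∧ ∀ y : Seq2, opSqrt F y = 0 → inner ℂ y u = 0
  · have h' : ∃ u : Seq2, opSqrt F u = z • x ∧
        ∀ y : Seq2, opSqrt F y = 0 → inner ℂ y u = 0 := by
      obtain ⟨u, hu, hk⟩ := h
      exact ⟨z • u, by rw [map_smul, hu], fun y hy => by rw [inner_smul_right, hk y hy, mul_zero]⟩
    rw [invSqrt, dif_pos h', invSqrt, dif_pos h, ← sub_eq_zero]
    set u := h.choose with hu_def
    set u' := h'.choose with hu'_def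
    have hu := h.choose_spec
    have hu' := h'.choose_spec
    rw [← hu_def] at hu
    rw [← hu'_def] at hu'
    have h0 : opSqrt F (u' - z • u) = 0 := by
      rw [map_sub, map_smul, hu.1, hu'.1, sub_self]
    have h1 : inner ℂ (u' - z • u) (u' - z • u) = 0 := by
      rw [inner_sub_right, inner_smul_right, hu'.2 _ h0, hu.2 _ h0, mul_zero, sub_zero]
    exact inner_self_eq_zero.mp h1
  · have h' : ¬ ∃ u : Seq2, opSqrt F u = z • x ∧
        ∀ y : Seq2, opSqrt F y = 0 → inner ℂ y u = 0 := by
      rintro ⟨u, hu, hk⟩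
      refine h ⟨z⁻¹ • u, ?_, fun y hy => by rw [inner_smul_right, hk y hy, mul_zero]⟩
      rw [map_smul, hu, smul_smul, inv_mul_cancel₀ hz, one_smul]
    rw [invSqrt, dif_neg h', invSqrt, dif_neg h, smul_zero]

/-- The numbers `P_{l,j}(k, n)` are the entries of the matrix of this form. -/
theorem formP_expVec (d τ : ℕ) (f g : ℝ → Seq2 →L[ℂ] Seq2) (l j k n : ℕ) :
    formP d τ f g (expVec j n) (expVec l k) = matP d τ f g l j k n := by
  unfold formP matP
  congr 1
  refine integral_congr_ae (Eventually.of_forall fun θ => ?_)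
  simp only [expVec, invForm, star_smul]
  rw [invSqrt_smul _ (star_ne_zero.mpr (Complex.exp_ne_zero _)),
    invSqrt_smul _ (star_ne_zero.mpr (Complex.exp_ne_zero _)), inner_smul_left, inner_smul_right]
  have e : Complex.exp (-(Complex.I * θ * ((l : ℂ) - j)))
      = Complex.exp (Complex.I * θ * ((j : ℂ) + 1))
        * star (Complex.exp (Complex.I * θ * ((l : ℂ) + 1))) := by
    rw [Complex.star_def, ← Complex.exp_conj, ← Complex.exp_add]
    congr 1
    simp
    ring
  rw [e]
  simp
  ring

/-- The form of `P` is finite at `C`: `∫ θ^{2d} |1 - e^{iθτ}|^{-2d} Cᵀ (f+g)⁻¹ C̄ dθ < ∞`. -/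
def FiniteForm (d τ : ℕ) (f g : ℝ → Seq2 →L[ℂ] Seq2) (C : ℝ → Seq2) : Prop :=
  (∀ᵐ θ ∂circ, InFormDomain (f θ + g θ) (star (C θ))) ∧
    ∫⁻ θ, ENNReal.ofReal
      ((weight d τ θ)⁻¹ * ‖invSqrt (f θ + g θ) (star (C θ))‖ ^ 2) ∂circ < ⊤

/-- `c` is in the domain of the operator `P` of `ℓ²` and `P c = y`. The operator with the
matrix `P_{l,j}` is the block Toeplitz operator with the symbol
`θ^{2d} |1 - e^{iθτ}|^{-2d} ((f+g)⁻¹)ᵀ`. It is unbounded, since `f+g` is of trace class; its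
domain consists of the `c` whose symbol function `C = ∑ c_j e^{iθ(j+1)}` has a
finite form and for which the Fourier coefficients
`y_l = (2π)⁻¹ ∫ e^{-iθ(l+1)} θ^{2d} |1 - e^{iθτ}|^{-2d} ((f+g)⁻¹)ᵀ C dθ`, `l ≥ 0`, make up an
element `y` of `ℓ²`. -/
def IsPImage (d τ : ℕ) (f g : ℝ → Seq2 →L[ℂ] Seq2) (c y : VecSeq2) : Prop :=
  ∃ C : ℝ → Seq2, IsSeriesSum c C ∧ FiniteForm d τ f g C ∧
    ∀ l k : ℕ, y l k = formP d τ f g C (expVec l k)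

/-! ## Estimates and their spectral characteristics -/

section Estimates

variable {Ω : Type*} [MeasurableSpace Ω] {P : Measure Ω}

/-- The closed subspace of `L²(Ω)` spanned by the `x_{kj}` with `j ≤ 0`. -/
def pastSpace (x : ℕ → ℤ → Lp ℂ 2 P) : Submodule ℂ (Lp ℂ 2 P) :=
  (Submodule.span ℂ {X | ∃ (k : ℕ) (j : ℤ), j ≤ 0 ∧ X = x k j}).topologicalClosure

/-- `Y` is the mean square optimal estimate of `X` by elements of `K`. -/
def IsOptimalEstimate (K : Submodule ℂ (Lp ℂ 2 P)) (X Y : Lp ℂ 2 P) : Prop :=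
  Y ∈ K ∧ ∀ Z ∈ K, ‖X - Y‖ ≤ ‖X - Z‖

/-- The function `∑ α_{kj} e^{iθj} (1 - e^{-iθτ})^d (iθ)^{-d} δ_k` (a finite sum). -/
def trigFun (d τ : ℕ) (α : ℕ × ℤ →₀ ℂ) (θ : ℝ) : Seq2 :=
  α.sum fun p z => (z * Complex.exp (Complex.I * θ * (p.2 : ℂ)) * transfer d τ θ) • delta p.1

/-- `X = ∫ h(θ)ᵀ dZ(θ)` where `hᵀ = yᵀ F⁻¹`, `F` is the spectral density and `Z` the spectral
random measure of the stationary increment sequence `x`.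

The Hilbert space `L²(F)` of the functions `h` with `‖h‖² = ∫ hᵀ F h̄ dθ` consists of the
`hᵀ = yᵀ F⁻¹` with `ȳ(θ)` in the range of `F(θ)^{1/2}`, and `‖h‖² = ∫ ‖F^{-1/2} ȳ‖² dθ`. The
integral is the extension by isometry of the correspondence of
`e^{iθj} (1 - e^{-iθτ})^d (iθ)^{-d} δ_k` to `x_{kj}`: there are finite linear combinations that
tend to `h` in `L²(F)`, whose counterparts tend to `X`. -/
def IsSpectralIntegral (d τ : ℕ) (F : ℝ → Seq2 →L[ℂ] Seq2) (x : ℕ → ℤ → Lp ℂ 2 P)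
    (y : ℝ → Seq2) (X : Lp ℂ 2 P) : Prop :=
  (∀ᵐ θ ∂circ, InFormDomain (F θ) (star (y θ))) ∧
  ∃ α : ℕ → (ℕ × ℤ →₀ ℂ),
    Tendsto (fun m => ∫⁻ θ, ENNReal.ofReal
      (‖invSqrt (F θ) (star (y θ - rowMul (trigFun d τ (α m) θ) (F θ)))‖ ^ 2) ∂circ)
      atTop (𝓝 0) ∧
    Tendsto (fun m => (α m).sum fun p z => z • x p.1 p.2) atTop (𝓝 X)

end Estimates

/-- The row vector `yᵀ` for which the spectral characteristic is `hᵀ = yᵀ (f+g)⁻¹`: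
`yᵀ = Bᵀ (1 - e^{-iθτ})^d (iθ)^{-d} f - (-iθ)^d (1 - e^{iθτ})^{-d} Cᵀ`. -/
def charNumerator (d τ : ℕ) (f : ℝ → Seq2 →L[ℂ] Seq2) (B C : ℝ → Seq2) (θ : ℝ) : Seq2 :=
  transfer d τ θ • rowMul (B θ) (f θ)
    - ((-(Complex.I * θ)) ^ d / (1 - Complex.exp (Complex.I * θ * τ)) ^ d) • C θ

/-- The integrand of the part of the mean square error that is due to the signal:
`w⁻¹ (w Bᵀ g + Cᵀ) (f+g)⁻¹ f (f+g)⁻¹ (w g B̄ + C̄)`, `w = |1 - e^{iθτ}|^{2d} θ^{-2d}`. -/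
def errSignal (d τ : ℕ) (f g : ℝ → Seq2 →L[ℂ] Seq2) (B C : ℝ → Seq2) (θ : ℝ) : ℂ :=
  (((weight d τ θ)⁻¹ : ℝ) : ℂ) *
    sandwich (f θ + g θ) (f θ) ((weight d τ θ : ℂ) • rowMul (B θ) (g θ) + C θ)

/-- The integrand of the part of the mean square error that is due to the noise:
`w⁻¹ (w Bᵀ f - Cᵀ) (f+g)⁻¹ g (f+g)⁻¹ (w f B̄ - C̄)`, `w = |1 - e^{iθτ}|^{2d} θ^{-2d}`. -/
def errNoise (d τ : ℕ) (f g : ℝ → Seq2 →L[ℂ] Seq2) (B C : ℝ → Seq2) (θ : ℝ) : ℂ :=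
  (((weight d τ θ)⁻¹ : ℝ) : ℂ) *
    sandwich (f θ + g θ) (g θ) ((weight d τ θ : ℂ) • rowMul (B θ) (f θ) - C θ)

end

end PCFilter

/-!
The filtering problem is solved by projection in a whitened model. Put `A = (w (f + g))^{1/2}`
(`specRoot`) and let `K` be the contraction with `f = (f + g)^{1/2} K (f + g)^{1/2}` (`whiten`),
acting on `L²((-π, π]; ℓ²)` as `κ` (`kap`). The antilinear correspondence sending the observation
with indices `k`, `j` to `e^{-ijθ} A δ_k` is isometric up to the factor `2π`; for the signal alone
the inner products acquire the weight `κ` (`inner_signal`, `inner_observed`). The functional is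
represented by `𝐁 = A B̄` (`funcVec`), and the claimed spectral characteristic becomes `κ𝐁 - q`,
where `q` is the function `(w (f + g))^{-1/2} C̄` (`whitened`).

Let `n` represent the projection of the functional to the observed past; it is a limit of
combinations of the `e^{inθ} A δ_k`, `n ≥ 0`. The difference `κ𝐁 - q - n` is orthogonal to
* `e^{inθ} A δ_k` for `n ≥ 0`: the projection error is orthogonal to the past, and `A q = C̄` has
  only negative frequencies;
* the dual functions `e^{inθ} A⁻¹ δ_k` for `n < 0`, which exist by the minimality condition: the
  combinations approximating `n` are biorthogonal to these functions, and the remaining relations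
  are the equation `𝐏 c = 𝐑 b`.

The first property says that the difference lies in the space `negSpace` of all `u` such that `A u`
has only negative frequencies. The main point is that the dual functions with `n < 0` are complete
in that space (`negSpace_le_dualSpan`), and this must come from the injectivity of `𝐏`, which speaks
only of those `u` for which `A u` is square-integrable. It is enough to treat differences of
wandering vectors of the shift, by the Wold decomposition (`le_of_wandering_differences`). A
wandering vector `e` satisfies `⟨e^{inθ} e, e⟩ = 0` for `n ≠ 0`, so that `‖e(θ)‖` is constant almost
everywhere; it is bounded, and `A e` is square-integrable since `w tr (f + g)` is integrable. Hence
the difference above vanishes, which gives the spectral characteristic and, by Pythagoras, the two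
integrals of the error formula.

The formula for the error in terms of the operators amounts to `‖q‖² = 2π ⟨c, 𝐑 b⟩`, obtained by
approximating `q` by the dual functions in the graph norm of `A` (`graphSpace_le_graphSpan`,
`inner_self_eq_of_coefficients`); this again follows from the Wold decomposition.

The identity `Aξ = Bξ` is tested with an element of `L²(Ω)`. Parseval's identity on each period
turns the integrals up to `M = N T` into `∑_{m < N} ⟨ā_m, Φ_m⟩`, where the differences of order `d`
of `Φ` are bounded. As `a` arises from the summable sequence `b` by differences of order `d`, these
are moved to `Φ`. The boundary terms may be of size `N^d` and need not vanish, so the sum is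
identified with its Abel limit (`eq_tsum_of_tendsto_sum_inner`), for which the damped differences
are bounded uniformly (`norm_damped_difference_le`).
-/

namespace PCFilter

/-! ### Uniqueness of Fourier coefficients of integrable functions -/

/-- An integrable function on `(a, a + T]` all of whose Fourier coefficients vanish is zero:
trigonometric polynomials are uniformly dense in the continuous periodic functions. -/
theorem ae_eq_zero_of_integral_exp_mul_eq_zero {a T : ℝ} (hT : 0 < T) {t : ℝ → ℂ}
    (ht : IntegrableOn t (Set.Ioc a (a + T)))
    (h : ∀ n : ℤ, ∫ x in Set.Ioc a (a + T),
      Complex.exp (2 * Real.pi * Complex.I * n * x / T) * t x = 0) :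
    ∀ᵐ x ∂volume.restrict (Set.Ioc a (a + T)), t x = 0 := by
  have : Fact (0 < T) := ⟨hT⟩
  have hint : ∀ g : C(AddCircle T, ℂ),
      Integrable (fun x : ℝ => g x * t x) (volume.restrict (Set.Ioc a (a + T))) := fun g => by
    refine Integrable.bdd_mul (c := ‖g‖) ht ?_ (Eventually.of_forall fun x => g.norm_coe_le_norm _)
    exact (g.continuous.comp (AddCircle.continuous_mk' T)).aestronglyMeasurable
  let L₀ : C(AddCircle T, ℂ) →ₗ[ℂ] ℂ :=
    { toFun := fun g => ∫ x in Set.Ioc a (a + T), g x * t x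
      map_add' := fun g g' => by
        simp only [ContinuousMap.add_apply, add_mul]
        exact integral_add (hint g) (hint g')
      map_smul' := fun z g => by
        simp only [ContinuousMap.smul_apply, smul_eq_mul, mul_assoc, RingHom.id_apply]
        exact integral_const_mul _ _ }
  let L : C(AddCircle T, ℂ) →L[ℂ] ℂ := L₀.mkContinuous
    (∫ x in Set.Ioc a (a + T), ‖t x‖) fun g => by
      refine (norm_integral_le_integral_norm _).trans ?_
      rw [mul_comm, ← integral_const_mul]
      refine integral_mono (hint g).norm (ht.norm.const_mul _) fun x => ?_
      simp only [norm_mul]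
      gcongr
      exact g.norm_coe_le_norm _
  have hL : ∀ g, L g = 0 := by
    have hker : Submodule.span ℂ (Set.range (fourier (T := T))) ≤ LinearMap.ker L.toLinearMap := by
      rw [Submodule.span_le]
      rintro _ ⟨n, rfl⟩
      have := h n
      change ∫ x in Set.Ioc a (a + T), fourier n (x : AddCircle T) * t x = 0
      simpa only [fourier_coe_apply] using this
    have := Submodule.topologicalClosure_minimal _ hker L.isClosed_ker
    rw [span_fourier_closure_eq_top] at this
    exact fun g => this Submodule.mem_top
  have hIoo : ∀ᵐ x, x ∈ Set.Ioo a (a + T) → t x = 0 := by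
    refine isOpen_Ioo.ae_eq_zero_of_integral_contDiff_smul_eq_zero
      (ht.mono_set Set.Ioo_subset_Ioc_self).locallyIntegrableOn fun g hg _ hsupp => ?_
    have hz : ∀ x, x ∉ Set.Ioo a (a + T) → g x = 0 := fun x hx =>
      image_eq_zero_of_notMem_tsupport fun hx' => hx (hsupp hx')
    let G : C(AddCircle T, ℂ) := ⟨AddCircle.liftIoc T a fun x => (g x : ℂ),
      AddCircle.liftIoc_continuous (by rw [hz a (by simp), hz (a + T) (by simp)])
        (Complex.continuous_ofReal.comp hg.continuous).continuousOn⟩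
    have hG := hL G
    change ∫ x in Set.Ioc a (a + T), AddCircle.liftIoc T a (fun x => (g x : ℂ)) x * t x = 0 at hG
    rw [← hG, ← integral_indicator measurableSet_Ioc]
    refine integral_congr_ae (Eventually.of_forall fun x => ?_)
    by_cases hx : x ∈ Set.Ioc a (a + T)
    · simp only [Set.indicator_of_mem hx]
      rw [AddCircle.liftIoc_coe_apply hx, Complex.real_smul]
    · simp only [Set.indicator_of_notMem hx]
      rw [hz x fun h' => hx (Set.Ioo_subset_Ioc_self h'), zero_smul]
  rw [ae_restrict_iff' measurableSet_Ioc]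
  filter_upwards [hIoo, compl_mem_ae_iff.mpr (measure_singleton (a + T))] with x h1 h2 hx
  exact h1 ⟨hx.1, lt_of_le_of_ne hx.2 h2⟩

theorem integrable_circ_exp_mul {t : ℝ → ℂ} (ht : Integrable t circ) (n : ℤ) :
    Integrable (fun θ : ℝ => Complex.exp (Complex.I * n * θ) * t θ) circ := by
  refine Integrable.bdd_mul (c := 1) ht (by fun_prop) (Eventually.of_forall fun θ => ?_)
  rw [show Complex.I * n * θ = ((n * θ : ℝ) : ℂ) * Complex.I by push_cast; ring,
    Complex.norm_exp_ofReal_mul_I]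

theorem ae_circ_eq_zero_of_integral_exp {t : ℝ → ℂ} (ht : Integrable t circ)
    (h : ∀ n : ℤ, ∫ θ, Complex.exp (Complex.I * n * θ) * t θ ∂circ = 0) :
    ∀ᵐ θ ∂circ, t θ = 0 := by
  have e : circ = volume.restrict (Set.Ioc (-Real.pi) (-Real.pi + 2 * Real.pi)) := by
    rw [circ]; congr 2; ring
  rw [e] at ht h ⊢
  refine ae_eq_zero_of_integral_exp_mul_eq_zero Real.two_pi_pos ht fun n => ?_
  rw [← h n]
  congr 1
  ext x
  have : (Real.pi : ℂ) ≠ 0 := by exact_mod_cast Real.pi_ne_zero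
  congr 2
  push_cast
  field_simp

/-- An integrable function with vanishing Fourier coefficients of nonzero order is constant. -/
theorem ae_circ_eq_const_of_integral_exp {t : ℝ → ℂ} (ht : Integrable t circ)
    (h : ∀ n : ℤ, n ≠ 0 → ∫ θ, Complex.exp (Complex.I * n * θ) * t θ ∂circ = 0) :
    ∃ z : ℂ, ∀ᵐ θ ∂circ, t θ = z := by
  have : IsFiniteMeasure circ := by unfold circ; infer_instance
  have h0 : ∀ n : ℤ, n ≠ 0 → ∫ θ : ℝ, Complex.exp (Complex.I * n * θ) ∂circ = 0 := fun n hn => by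
    rw [circ, ← intervalIntegral.integral_of_le (by linarith [Real.pi_pos])]
    rw [integral_exp_mul_complex (by simp [hn])]
    rw [show Complex.I * n * ((Real.pi : ℝ) : ℂ) =
      Complex.I * n * ((-Real.pi : ℝ) : ℂ) + n * (2 * Real.pi * Complex.I) by push_cast; ring,
      Complex.exp_add, Complex.exp_int_mul_two_pi_mul_I, mul_one, sub_self, zero_div]
  refine ⟨(1 / (2 * Real.pi)) * ∫ θ, t θ ∂circ, ?_⟩
  have := ae_circ_eq_zero_of_integral_exp
    (t := fun θ => t θ - (1 / (2 * Real.pi)) * ∫ θ, t θ ∂circ) (ht.sub (integrable_const _)) ?_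
  · filter_upwards [this] with θ hθ using sub_eq_zero.mp hθ
  intro n
  simp only [mul_sub]
  rw [integral_sub (integrable_circ_exp_mul ht n)
    (integrable_circ_exp_mul (integrable_const _) n), integral_mul_const]
  by_cases hn : n = 0
  · subst hn
    have hv : (circ.real Set.univ : ℂ) = 2 * Real.pi := by
      rw [circ, Measure.real, Measure.restrict_apply_univ, Real.volume_Ioc,
        ENNReal.toReal_ofReal (by linarith [Real.pi_pos])]
      push_cast; ring
    have : (Real.pi : ℂ) ≠ 0 := by exact_mod_cast Real.pi_ne_zero
    simp [hv]
    field_simp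
    simp
  · rw [h n hn, h0 n hn, zero_mul, sub_zero]

/-! ### Square roots of positive operators and their inverses -/

theorem inner_delta_left (k : ℕ) (x : Seq2) : inner ℂ (delta k) x = x k := by
  simp [delta, lp.inner_single_left]

theorem delta_apply (k n : ℕ) : (delta k : Seq2) n = if n = k then 1 else 0 := by
  rw [delta, lp.single_apply]
  simp [Pi.single_apply]

theorem star_delta (k : ℕ) : star (delta k) = delta k := by
  ext n
  rw [lp.star_apply, delta_apply]
  split_ifs <;> simp

theorem hasSum_delta (x : Seq2) : HasSum (fun k => x k • delta k) x := by
  have h := lp.hasSum_single (E := fun _ : ℕ => ℂ) (p := 2) (by simp) x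
  convert h using 2 with k
  rw [delta, ← lp.single_smul]
  simp

theorem ext_delta {x y : Seq2} (h : ∀ k, inner ℂ (delta k) x = inner ℂ (delta k) y) : x = y := by
  ext k
  rw [← inner_delta_left, ← inner_delta_left, h]

section Pointwise

variable {F f g : Seq2 →L[ℂ] Seq2}

theorem opSqrt_nonneg {H : Type*} [NormedAddCommGroup H] [InnerProductSpace ℂ H] [CompleteSpace H]
    (F : H →L[ℂ] H) : 0 ≤ opSqrt F := CFC.sqrt_nonneg F

theorem opSqrt_mul_self {H : Type*} [NormedAddCommGroup H] [InnerProductSpace ℂ H]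
    [CompleteSpace H] {F : H →L[ℂ] H} (hF : 0 ≤ F) : opSqrt F * opSqrt F = F :=
  CFC.sqrt_mul_sqrt_self F hF

theorem isUnit_opSqrt_add {H : Type*} [NormedAddCommGroup H] [InnerProductSpace ℂ H]
    [CompleteSpace H] {ε : ℝ} (hε : 0 < ε) (F : H →L[ℂ] H) :
    IsUnit (opSqrt F + (ε : ℂ) • (1 : H →L[ℂ] H)) := by
  have h : (-ε) ∉ spectrum ℝ (opSqrt F) := fun h => by
    have := spectrum_nonneg_of_nonneg (opSqrt_nonneg F) h
    linarith
  rw [spectrum.notMem_iff] at h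
  have e : opSqrt F + (ε : ℂ) • (1 : H →L[ℂ] H)
      = -(algebraMap ℝ (H →L[ℂ] H) (-ε) - opSqrt F) := by
    rw [map_neg, Algebra.algebraMap_eq_smul_one]
    ext1 x
    simp
  rw [e]
  exact h.neg

/-- The square root is continuous on the positive operators. -/
theorem continuousOn_opSqrt {H : Type*} [NormedAddCommGroup H] [InnerProductSpace ℂ H]
    [CompleteSpace H] : ContinuousOn (opSqrt (H := H)) {F | 0 ≤ F} :=
  CFC.continuousOn_sqrt

theorem opSqrt_isPositive (F : Seq2 →L[ℂ] Seq2) : (opSqrt F).IsPositive :=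
  (ContinuousLinearMap.nonneg_iff_isPositive _).mp (opSqrt_nonneg F)

theorem inner_opSqrt (F : Seq2 →L[ℂ] Seq2) (x y : Seq2) :
    inner ℂ (opSqrt F x) y = inner ℂ x (opSqrt F y) :=
  (opSqrt_isPositive F).isSymmetric x y

theorem opSqrt_opSqrt (hF : F.IsPositive) (x : Seq2) : opSqrt F (opSqrt F x) = F x := by
  have := opSqrt_mul_self ((ContinuousLinearMap.nonneg_iff_isPositive F).mpr hF)
  exact congrArg (fun B : Seq2 →L[ℂ] Seq2 => B x) this

theorem norm_opSqrt_sq (hF : F.IsPositive) (x : Seq2) :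
    ((‖opSqrt F x‖ ^ 2 : ℝ) : ℂ) = inner ℂ x (F x) := by
  rw [← opSqrt_opSqrt hF, ← inner_opSqrt, inner_self_eq_norm_sq_to_K]
  push_cast
  rfl

theorem norm_opSqrt_sq_re (hF : F.IsPositive) (x : Seq2) :
    ‖opSqrt F x‖ ^ 2 = (inner ℂ x (F x)).re := by
  rw [← norm_opSqrt_sq hF, Complex.ofReal_re]

/-- `F^{1/2}` is injective as soon as its range contains the coordinate vectors. -/
theorem opSqrt_eq_zero (h : ∀ k, InFormDomain F (delta k)) (z : Seq2) (hz : opSqrt F z = 0) :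
    z = 0 := by
  refine ext_delta fun k => ?_
  obtain ⟨u, hu⟩ := h k
  rw [← hu, inner_opSqrt, hz, inner_zero_right, inner_zero_right]

section Inverse

variable (hinj : ∀ z, opSqrt F z = 0 → z = 0)
include hinj

theorem opSqrt_injective : Function.Injective (opSqrt F) :=
  (injective_iff_map_eq_zero _).mpr hinj

theorem denseRange_opSqrt : DenseRange (opSqrt F) := by
  have h : (LinearMap.range (opSqrt F).toLinearMap)ᗮ = ⊥ := by
    rw [Submodule.eq_bot_iff]
    intro x hx
    refine hinj x ?_
    rw [← inner_self_eq_zero (𝕜 := ℂ), ← inner_opSqrt]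
    exact (Submodule.mem_orthogonal _ _).mp hx (opSqrt F (opSqrt F x)) ⟨_, rfl⟩
  have := Submodule.topologicalClosure_eq_top_iff.mpr h
  intro x
  have hx : x ∈ (LinearMap.range (opSqrt F).toLinearMap).topologicalClosure := by
    rw [this]; trivial
  exact hx

theorem invSqrt_opSqrt (u : Seq2) : invSqrt F (opSqrt F u) = u := by
  have h : ∃ v : Seq2, opSqrt F v = opSqrt F u ∧
      ∀ z : Seq2, opSqrt F z = 0 → inner ℂ z v = 0 :=
    ⟨u, rfl, fun z hz => by rw [hinj z hz, inner_zero_left]⟩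
  rw [invSqrt, dif_pos h]
  exact opSqrt_injective hinj h.choose_spec.1

theorem opSqrt_invSqrt {x : Seq2} (hx : InFormDomain F x) : opSqrt F (invSqrt F x) = x := by
  obtain ⟨u, rfl⟩ := hx
  rw [invSqrt_opSqrt hinj]

theorem invSqrt_eq_of_opSqrt {x u : Seq2} (h : opSqrt F u = x) : invSqrt F x = u := by
  rw [← h, invSqrt_opSqrt hinj]

/-- Factorization of a positive operator dominated by `F`: there is a positive contraction `K`
with `F^{1/2} K F^{1/2} = f`. It is `L* L` for the contraction `L` with `L F^{1/2} = f^{1/2}`. -/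
theorem exists_whiten (hf : f.IsPositive) (hF : F.IsPositive)
    (hfF : ∀ x, (inner ℂ x (f x)).re ≤ (inner ℂ x (F x)).re) :
    ∃ K : Seq2 →L[ℂ] Seq2, (opSqrt F).comp (K.comp (opSqrt F)) = f ∧
      (∀ x y, inner ℂ (K x) y = inner ℂ x (K y)) ∧ ∀ x, ‖K x‖ ≤ ‖x‖ := by
  have hle : ∀ x, ‖(opSqrt f).toLinearMap x‖ ≤ 1 * ‖(opSqrt F).toLinearMap x‖ := fun x => by
    rw [one_mul]
    refine le_of_sq_le_sq ?_ (norm_nonneg _)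
    exact ((norm_opSqrt_sq_re hf x).trans_le (hfF x)).trans_eq (norm_opSqrt_sq_re hF x).symm
  have hd : DenseRange (opSqrt F).toLinearMap := denseRange_opSqrt hinj
  set L : Seq2 →L[ℂ] Seq2 := (opSqrt f).toLinearMap.extendOfNorm (opSqrt F).toLinearMap with hL
  have hLe : ∀ x, L (opSqrt F x) = opSqrt f x := fun x =>
    LinearMap.extendOfNorm_eq hd ⟨1, hle⟩ x
  have hLn : ∀ x, ‖L x‖ ≤ ‖x‖ := fun x => by
    simpa using LinearMap.norm_extendOfNorm_apply_le hd 1 hle x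
  refine ⟨(ContinuousLinearMap.adjoint L).comp L, ?_, fun x y => ?_, fun x => ?_⟩
  · ext1 x
    refine ext_inner_left ℂ fun y => ?_
    simp only [ContinuousLinearMap.comp_apply]
    rw [← inner_opSqrt, ContinuousLinearMap.adjoint_inner_right, hLe, hLe, inner_opSqrt,
      opSqrt_opSqrt hf]
  · simp only [ContinuousLinearMap.comp_apply]
    rw [ContinuousLinearMap.adjoint_inner_right, ContinuousLinearMap.adjoint_inner_left]
  · simp only [ContinuousLinearMap.comp_apply]
    calc ‖ContinuousLinearMap.adjoint L (L x)‖ ≤ ‖ContinuousLinearMap.adjoint L‖ * ‖L x‖ :=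
          ContinuousLinearMap.le_opNorm _ _
      _ ≤ 1 * ‖x‖ := by
          gcongr
          · rw [LinearIsometryEquiv.norm_map]
            exact ContinuousLinearMap.opNorm_le_bound _ zero_le_one fun x => by
              simpa using hLn x
          · exact hLn x
      _ = ‖x‖ := one_mul _

theorem whiten_unique {K K' : Seq2 →L[ℂ] Seq2}
    (h : (opSqrt F).comp (K.comp (opSqrt F)) = (opSqrt F).comp (K'.comp (opSqrt F))) : K = K' := by
  have h1 : ∀ x, K (opSqrt F x) = K' (opSqrt F x) := fun x =>
    opSqrt_injective hinj (congrArg (fun B : Seq2 →L[ℂ] Seq2 => B x) h)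
  exact DFunLike.coe_injective ((denseRange_opSqrt hinj).equalizer K.continuous K'.continuous
    (funext h1))

theorem whiten_eq {K : Seq2 →L[ℂ] Seq2}
    (h : (opSqrt F).comp (K.comp (opSqrt F)) = f) : whiten F f = K := by
  have h' : ∃ K : Seq2 →L[ℂ] Seq2, (opSqrt F).comp (K.comp (opSqrt F)) = f := ⟨K, h⟩
  rw [whiten, dif_pos h']
  exact whiten_unique hinj (h'.choose_spec.trans h.symm)

end Inverse

theorem isPositive_add_le_left (hg : g.IsPositive) (x : Seq2) :
    (inner ℂ x (f x)).re ≤ (inner ℂ x ((f + g) x)).re := by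
  have := hg.re_inner_nonneg_right x
  rw [_root_.add_apply, inner_add_right, Complex.add_re]
  exact le_add_of_nonneg_right this

section Sum

variable (hf : f.IsPositive) (hg : g.IsPositive) (hinj : ∀ z, opSqrt (f + g) z = 0 → z = 0)
include hf hg hinj

theorem opSqrt_whiten_opSqrt (x : Seq2) :
    opSqrt (f + g) (whiten (f + g) f (opSqrt (f + g) x)) = f x := by
  obtain ⟨K, hK, -⟩ := exists_whiten hinj hf (hf.add hg) (isPositive_add_le_left hg)
  rw [whiten_eq hinj hK]
  exact congrArg (fun B : Seq2 →L[ℂ] Seq2 => B x) hK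

theorem inner_whiten (x y : Seq2) :
    inner ℂ (whiten (f + g) f x) y = inner ℂ x (whiten (f + g) f y) := by
  obtain ⟨K, hK, h, -⟩ := exists_whiten hinj hf (hf.add hg) (isPositive_add_le_left hg)
  rw [whiten_eq hinj hK, h]

theorem norm_whiten_le (x : Seq2) : ‖whiten (f + g) f x‖ ≤ ‖x‖ := by
  obtain ⟨K, hK, -, h⟩ := exists_whiten hinj hf (hf.add hg) (isPositive_add_le_left hg)
  rw [whiten_eq hinj hK]
  exact h x

theorem whiten_right_apply (x : Seq2) :
    whiten (f + g) g x = x - whiten (f + g) f x := by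
  have h : whiten (f + g) g = ContinuousLinearMap.id ℂ Seq2 - whiten (f + g) f := by
    refine whiten_eq hinj ?_
    ext1 x
    simp only [ContinuousLinearMap.comp_apply, _root_.sub_apply,
      ContinuousLinearMap.id_apply, map_sub]
    rw [opSqrt_whiten_opSqrt hf hg hinj, opSqrt_opSqrt (hf.add hg), _root_.add_apply,
      add_sub_cancel_left]
  rw [h]
  rfl

theorem opSqrt_whiten_right_opSqrt (x : Seq2) :
    opSqrt (f + g) (opSqrt (f + g) x - whiten (f + g) f (opSqrt (f + g) x)) = g x := by
  rw [map_sub, opSqrt_whiten_opSqrt hf hg hinj, opSqrt_opSqrt (hf.add hg),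
    _root_.add_apply, add_sub_cancel_left]

end Sum

/-! ### Resolvents of the square root -/

/-- The resolvent `(F^{1/2} + ε)⁻¹`. -/
noncomputable def sqrtResolvent (ε : ℝ) (F : Seq2 →L[ℂ] Seq2) : Seq2 →L[ℂ] Seq2 :=
  Ring.inverse (opSqrt F + (ε : ℂ) • (1 : Seq2 →L[ℂ] Seq2))

variable {ε : ℝ}

theorem opSqrt_sqrtResolvent (hε : 0 < ε) (x : Seq2) :
    opSqrt F (sqrtResolvent ε F x) = x - (ε : ℂ) • sqrtResolvent ε F x := by
  have := Ring.mul_inverse_cancel _ (isUnit_opSqrt_add hε F)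
  have h := congrArg (fun B : Seq2 →L[ℂ] Seq2 => B x) this
  change opSqrt F (sqrtResolvent ε F x) + (ε : ℂ) • sqrtResolvent ε F x = x at h
  exact eq_sub_of_add_eq h

theorem sqrtResolvent_opSqrt (hε : 0 < ε) (x : Seq2) :
    sqrtResolvent ε F (opSqrt F x) = x - (ε : ℂ) • sqrtResolvent ε F x := by
  have := Ring.inverse_mul_cancel _ (isUnit_opSqrt_add hε F)
  have h := congrArg (fun B : Seq2 →L[ℂ] Seq2 => B x) this
  change sqrtResolvent ε F (opSqrt F x + (ε : ℂ) • x) = x at h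
  rw [map_add, map_smul] at h
  exact eq_sub_of_add_eq h

theorem norm_sqrtResolvent_le (hε : 0 < ε) (x : Seq2) : ε * ‖sqrtResolvent ε F x‖ ≤ ‖x‖ := by
  set u := sqrtResolvent ε F x with hu
  have hx : x = opSqrt F u + (ε : ℂ) • u := by
    rw [hu, opSqrt_sqrtResolvent hε]; abel
  by_cases h0 : ‖u‖ = 0
  · rw [h0, mul_zero]; exact norm_nonneg _
  have h1 : ε * ‖u‖ ^ 2 ≤ ‖u‖ * ‖x‖ := by
    have h2 : ε * ‖u‖ ^ 2 ≤ (inner ℂ u x).re := by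
      rw [hx, inner_add_right, inner_smul_right, inner_self_eq_norm_sq_to_K, Complex.add_re]
      have h3 := (opSqrt_isPositive F).re_inner_nonneg_right u
      have h4 : ((ε : ℂ) * ((‖u‖ : ℝ) : ℂ) ^ 2).re = ε * ‖u‖ ^ 2 := by
        rw [← Complex.ofReal_pow, ← Complex.ofReal_mul, Complex.ofReal_re]
      erw [h4]
      exact le_add_of_nonneg_left h3
    exact h2.trans ((Complex.re_le_norm _).trans (norm_inner_le_norm _ _))
  have hpos : 0 < ‖u‖ := lt_of_le_of_ne (norm_nonneg _) (Ne.symm h0)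
  nlinarith

theorem tendsto_smul_sqrtResolvent (hinj : ∀ z, opSqrt F z = 0 → z = 0) (x : Seq2) :
    Tendsto (fun n : ℕ => ((1 / ((n : ℝ) + 1) : ℝ) : ℂ) • sqrtResolvent (1 / ((n : ℝ) + 1)) F x)
      atTop (𝓝 0) := by
  rw [Metric.tendsto_atTop]
  intro δ hδ
  obtain ⟨z, hy⟩ := Metric.mem_closure_range_iff.mp (denseRange_opSqrt hinj x) (δ / 2)
    (half_pos hδ)
  have hlim := (tendsto_one_div_add_atTop_nhds_zero_nat (𝕜 := ℝ)).mul_const (2 * ‖z‖)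
  rw [zero_mul] at hlim
  obtain ⟨N, hN⟩ := (hlim.eventually_lt_const (half_pos hδ)).exists_forall_of_atTop
  refine ⟨N, fun n hn => ?_⟩
  have hε : (0 : ℝ) < 1 / ((n : ℝ) + 1) := Nat.one_div_pos_of_nat
  set ε : ℝ := 1 / ((n : ℝ) + 1)
  rw [dist_zero_right, norm_smul, Complex.norm_real, Real.norm_of_nonneg hε.le]
  have e : sqrtResolvent ε F x
      = sqrtResolvent ε F (x - opSqrt F z) + (z - (ε : ℂ) • sqrtResolvent ε F z) := by
    rw [map_sub, ← sqrtResolvent_opSqrt hε]; abel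
  have h1 := norm_sqrtResolvent_le (F := F) hε (x - opSqrt F z)
  have h2 := norm_sqrtResolvent_le (F := F) hε z
  have h3 : ‖z - (ε : ℂ) • sqrtResolvent ε F z‖ ≤ 2 * ‖z‖ := by
    refine (norm_sub_le _ _).trans ?_
    rw [norm_smul, Complex.norm_real, Real.norm_of_nonneg hε.le]
    linarith
  have h4 : ε * (2 * ‖z‖) < δ / 2 := hN n hn
  rw [dist_eq_norm] at hy
  calc ε * ‖sqrtResolvent ε F x‖
      ≤ ε * (‖sqrtResolvent ε F (x - opSqrt F z)‖ + ‖z - (ε : ℂ) • sqrtResolvent ε F z‖) := by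
        rw [e]; gcongr; exact norm_add_le _ _
    _ < δ := by
        have := mul_le_mul_of_nonneg_left h3 hε.le
        linarith

theorem tendsto_sqrtResolvent_opSqrt (hinj : ∀ z, opSqrt F z = 0 → z = 0) (x : Seq2) :
    Tendsto (fun n : ℕ => sqrtResolvent (1 / ((n : ℝ) + 1)) F (opSqrt F x)) atTop (𝓝 x) := by
  have := (tendsto_smul_sqrtResolvent hinj x).const_sub x
  rw [sub_zero] at this
  exact this.congr fun n => (sqrtResolvent_opSqrt Nat.one_div_pos_of_nat x).symm

end Pointwise

/-! ### Trace class densities and measurability -/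

theorem weight_nonneg (d τ : ℕ) (θ : ℝ) : 0 ≤ weight d τ θ := by
  unfold weight
  rw [pow_mul θ]
  positivity

theorem ae_circ_exp_ne_one {τ : ℕ} (hτ : 0 < τ) :
    ∀ᵐ θ : ℝ ∂circ, θ ≠ 0 ∧ Complex.exp (Complex.I * θ * τ) ≠ 1 := by
  have hc : {θ : ℝ | θ = 0 ∨ Complex.exp (Complex.I * θ * τ) = 1}.Countable := by
    refine ((Set.countable_singleton (0 : ℝ)).union
      (Set.countable_range fun n : ℤ => n * (2 * Real.pi) / τ)).mono ?_
    rintro θ (h | h)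
    · exact Or.inl h
    · obtain ⟨n, hn⟩ := Complex.exp_eq_one_iff.mp h
      refine Or.inr ⟨n, ?_⟩
      have h1 : Complex.I * (θ * τ : ℝ) = Complex.I * (n * (2 * Real.pi) : ℝ) := by
        push_cast; rw [← mul_assoc, hn]; ring
      have h2 : θ * τ = n * (2 * Real.pi) := by
        exact_mod_cast mul_left_cancel₀ Complex.I_ne_zero h1
      have : (τ : ℝ) ≠ 0 := by exact_mod_cast hτ.ne'
      simp only
      rw [← h2, mul_div_cancel_right₀ _ this]
  have := (hc.measure_zero volume)
  refine ae_restrict_of_ae ?_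
  rw [ae_iff]
  convert this using 2
  ext θ
  simp only [Set.mem_ofPred_eq]
  tauto

theorem ae_weight_pos {τ : ℕ} (hτ : 0 < τ) (d : ℕ) : ∀ᵐ θ ∂circ, 0 < weight d τ θ := by
  filter_upwards [ae_circ_exp_ne_one hτ] with θ ⟨h0, h1⟩
  have h2 : 0 < ‖1 - Complex.exp (Complex.I * θ * τ)‖ := norm_pos_iff.mpr (sub_ne_zero.mpr h1.symm)
  unfold weight
  rw [pow_mul θ]
  positivity

theorem measurable_weight (d τ : ℕ) : Measurable (weight d τ) := by
  unfold weight
  fun_prop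

section HilbertSchmidt

theorem sum_norm_sq_apply_le (x : Seq2) (s : Finset ℕ) : ∑ k ∈ s, ‖x k‖ ^ 2 ≤ ‖x‖ ^ 2 := by
  have := lp.sum_rpow_le_norm_rpow (p := 2) (by simp) x s
  simpa using this

/-- The Hilbert-Schmidt norm bounds the operator norm. -/
theorem norm_apply_le_of_sum_le {E : Type*} [NormedAddCommGroup E] [NormedSpace ℂ E]
    (B : Seq2 →L[ℂ] E) {M : ℝ} (hM : 0 ≤ M)
    (h : ∀ s : Finset ℕ, ∑ k ∈ s, ‖B (delta k)‖ ^ 2 ≤ M ^ 2) (x : Seq2) : ‖B x‖ ≤ M * ‖x‖ := by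
  have hs : HasSum (fun k => x k • B (delta k)) (B x) := by
    simpa using (hasSum_delta x).mapL B
  refine le_of_tendsto hs.norm (Eventually.of_forall fun s => ?_)
  have h1 : ‖∑ k ∈ s, x k • B (delta k)‖ ≤ ∑ k ∈ s, ‖x k‖ * ‖B (delta k)‖ :=
    (norm_sum_le _ _).trans (Finset.sum_le_sum fun k _ => (norm_smul _ _).le)
  refine h1.trans (le_of_sq_le_sq ?_ (by positivity))
  refine (Finset.sum_mul_sq_le_sq_mul_sq s _ _).trans ?_
  rw [mul_pow, mul_comm]
  exact mul_le_mul (h s) (sum_norm_sq_apply_le x s) (by positivity) (by positivity)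

/-- The projection to the first `n` coordinates. -/
noncomputable def coordProj (n : ℕ) : Seq2 →L[ℂ] Seq2 :=
  ∑ k ∈ Finset.range n, (innerSL ℂ (delta k)).smulRight (delta k)

theorem coordProj_apply (n : ℕ) (x : Seq2) :
    coordProj n x = ∑ k ∈ Finset.range n, x k • delta k := by
  simp [coordProj, inner_delta_left]

theorem tendsto_coordProj (x : Seq2) : Tendsto (fun n => coordProj n x) atTop (𝓝 x) := by
  simp only [coordProj_apply]
  exact (hasSum_delta x).tendsto_sum_nat

theorem coordProj_delta (n k : ℕ) : coordProj n (delta k) = if k < n then delta k else 0 := by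
  rw [coordProj_apply]
  simp only [delta_apply, ite_smul, one_smul, zero_smul]
  simp

variable {F : Seq2 →L[ℂ] Seq2}

theorem norm_opSqrt_delta_sq (hF : F.IsPositive) (k : ℕ) :
    ‖opSqrt F (delta k)‖ ^ 2 = ((F (delta k)) k).re := by
  rw [norm_opSqrt_sq_re hF, inner_delta_left]

theorem diag_nonneg (hF : F.IsPositive) (k : ℕ) : 0 ≤ ((F (delta k)) k).re := by
  rw [← norm_opSqrt_delta_sq hF]; positivity

theorem norm_opSqrt_sq_le_trace (hF : F.IsPositive)
    (hs : Summable fun k => ((F (delta k)) k).re) :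
    ‖opSqrt F‖ ^ 2 ≤ ∑' k, ((F (delta k)) k).re := by
  have h0 : 0 ≤ ∑' k, ((F (delta k)) k).re := tsum_nonneg fun k => diag_nonneg hF k
  have : ‖opSqrt F‖ ≤ √(∑' k, ((F (delta k)) k).re) := by
    refine ContinuousLinearMap.opNorm_le_bound _ (Real.sqrt_nonneg _)
      (norm_apply_le_of_sum_le _ (Real.sqrt_nonneg _) fun s => ?_)
    rw [Real.sq_sqrt h0]
    simp only [norm_opSqrt_delta_sq hF]
    exact hs.sum_le_tsum s fun k _ => diag_nonneg hF k
  calc ‖opSqrt F‖ ^ 2 ≤ √(∑' k, ((F (delta k)) k).re) ^ 2 := by gcongr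
    _ = _ := Real.sq_sqrt h0

/-- A positive operator with summable diagonal is the norm limit of its truncations: `F^{1/2}` is a
Hilbert-Schmidt operator. -/
theorem tendsto_comp_coordProj (hF : F.IsPositive) (hs : Summable fun k => ((F (delta k)) k).re) :
    Tendsto (fun n => F.comp (coordProj n)) atTop (𝓝 F) := by
  set t := fun k => ((F (delta k)) k).re with ht
  have hδ : ∀ n, ∀ x, ‖opSqrt F (x - coordProj n x)‖
      ≤ √(∑' k, t k - ∑ k ∈ Finset.range n, t k) * ‖x‖ := by
    intro n
    have h0 : 0 ≤ ∑' k, t k - ∑ k ∈ Finset.range n, t k :=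
      sub_nonneg.mpr (hs.sum_le_tsum _ fun k _ => diag_nonneg hF k)
    refine norm_apply_le_of_sum_le
      ((opSqrt F).comp (ContinuousLinearMap.id ℂ Seq2 - coordProj n)) (Real.sqrt_nonneg _)
      fun s => ?_
    rw [Real.sq_sqrt h0, le_sub_iff_add_le]
    have h1 : ∀ k ∈ s, ‖((opSqrt F).comp (ContinuousLinearMap.id ℂ Seq2 - coordProj n)) (delta k)‖ ^ 2
        = if k < n then 0 else t k := fun k _ => by
      change ‖opSqrt F (delta k - coordProj n (delta k))‖ ^ 2 = _
      rw [coordProj_delta]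
      split_ifs
      · simp
      · rw [sub_zero, norm_opSqrt_delta_sq hF]
    rw [Finset.sum_congr rfl h1, Finset.sum_ite, Finset.sum_const_zero, zero_add,
      ← Finset.sum_union]
    · exact hs.sum_le_tsum _ fun k _ => diag_nonneg hF k
    · refine Finset.disjoint_left.mpr fun k hk hk' => ?_
      exact (Finset.mem_filter.mp hk).2 (Finset.mem_range.mp hk')
  rw [tendsto_iff_norm_sub_tendsto_zero]
  have hlim : Tendsto (fun n => ‖opSqrt F‖ * √(∑' k, t k - ∑ k ∈ Finset.range n, t k))
      atTop (𝓝 0) := by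
    have h1 := (hs.hasSum.tendsto_sum_nat).const_sub (∑' k, t k)
    rw [sub_self] at h1
    have h2 := (h1.sqrt).const_mul ‖opSqrt F‖
    simpa using h2
  refine squeeze_zero (fun n => norm_nonneg _) (fun n => ?_) hlim
  refine ContinuousLinearMap.opNorm_le_bound _ (by positivity) fun x => ?_
  have e : (F.comp (coordProj n) - F) x = - opSqrt F (opSqrt F (x - coordProj n x)) := by
    rw [opSqrt_opSqrt hF, map_sub]
    change F (coordProj n x) - F x = _
    abel
  rw [e, norm_neg, mul_assoc]
  exact ((opSqrt F).le_opNorm _).trans (by gcongr; exact hδ n x)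

end HilbertSchmidt

section Measurability

variable {α : Type*} [MeasurableSpace α] {μ : Measure α}

theorem aestronglyMeasurable_of_apply {v : α → Seq2}
    (h : ∀ k, AEStronglyMeasurable (fun θ => v θ k) μ) : AEStronglyMeasurable v μ := by
  refine aestronglyMeasurable_of_tendsto_ae atTop (f := fun n θ => coordProj n (v θ))
    (fun n => ?_) (Eventually.of_forall fun θ => tendsto_coordProj (v θ))
  simp only [coordProj_apply]
  exact Finset.aestronglyMeasurable_fun_sum _ fun k _ => (h k).smul_const _

theorem aestronglyMeasurable_clm_apply {T : α → Seq2 →L[ℂ] Seq2} {v : α → Seq2}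
    (hT : AEStronglyMeasurable T μ) (hv : AEStronglyMeasurable v μ) :
    AEStronglyMeasurable (fun θ => T θ (v θ)) μ :=
  isBoundedBilinearMap_apply.continuous.comp_aestronglyMeasurable (hT.prodMk hv)

/-- A positive operator valued function with measurable entries and summable diagonals is strongly
measurable for the operator norm. -/
theorem aestronglyMeasurable_of_entries {F : α → Seq2 →L[ℂ] Seq2}
    (hpos : ∀ᵐ θ ∂μ, (F θ).IsPositive)
    (hs : ∀ᵐ θ ∂μ, Summable fun k => ((F θ (delta k)) k).re)
    (h : ∀ k n, AEStronglyMeasurable (fun θ => (F θ (delta n)) k) μ) :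
    AEStronglyMeasurable F μ := by
  refine aestronglyMeasurable_of_tendsto_ae atTop (f := fun n θ => (F θ).comp (coordProj n))
    (fun n => ?_) ?_
  · have e : (fun θ => (F θ).comp (coordProj n)) = fun θ => ∑ k ∈ Finset.range n,
        ContinuousLinearMap.smulRightL ℂ Seq2 Seq2 (innerSL ℂ (delta k)) (F θ (delta k)) := by
      ext1 θ
      ext1 x
      simp [coordProj_apply, inner_delta_left]
    rw [e]
    refine Finset.aestronglyMeasurable_fun_sum _ fun k _ => ?_
    exact (ContinuousLinearMap.continuous _).comp_aestronglyMeasurable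
      (aestronglyMeasurable_of_apply fun i => h i k)
  · filter_upwards [hpos, hs] with θ h1 h2 using tendsto_comp_coordProj h1 h2

/-- A function continuous on the positive operators preserves strong measurability. -/
theorem aestronglyMeasurable_comp_of_continuousOn {β : Type*} [TopologicalSpace β]
    {F : α → Seq2 →L[ℂ] Seq2} (hF : AEStronglyMeasurable F μ) (hpos : ∀ᵐ θ ∂μ, (F θ).IsPositive)
    {G : (Seq2 →L[ℂ] Seq2) → β} (hG : ContinuousOn G {F | 0 ≤ F}) :
    AEStronglyMeasurable (fun θ => G (F θ)) μ := by
  classical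
  let F' : α → {F : Seq2 →L[ℂ] Seq2 | 0 ≤ F} := fun θ =>
    if h : 0 ≤ F θ then ⟨F θ, h⟩ else ⟨0, le_refl (0 : Seq2 →L[ℂ] Seq2)⟩
  have hF' : (fun θ => (F' θ : Seq2 →L[ℂ] Seq2)) =ᵐ[μ] F := by
    filter_upwards [hpos] with θ hθ
    simp only [F', dif_pos ((ContinuousLinearMap.nonneg_iff_isPositive _).mpr hθ)]
  have h1 : AEStronglyMeasurable F' μ :=
    Topology.IsEmbedding.subtypeVal.aestronglyMeasurable_comp_iff.mp (hF.congr hF'.symm)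
  refine ((continuousOn_iff_continuous_domRestrict.mp hG).comp_aestronglyMeasurable h1).congr ?_
  filter_upwards [hF'] with θ hθ
  simp only [Set.domRestrict_apply, hθ]

section Derived

variable {F f : α → Seq2 →L[ℂ] Seq2} (hF : AEStronglyMeasurable F μ)
  (hpos : ∀ᵐ θ ∂μ, (F θ).IsPositive)
include hF hpos

theorem aestronglyMeasurable_opSqrt : AEStronglyMeasurable (fun θ => opSqrt (F θ)) μ :=
  aestronglyMeasurable_comp_of_continuousOn hF hpos continuousOn_opSqrt

theorem aestronglyMeasurable_sqrtResolvent {ε : ℝ} (hε : 0 < ε) :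
    AEStronglyMeasurable (fun θ => sqrtResolvent ε (F θ)) μ := by
  refine aestronglyMeasurable_comp_of_continuousOn hF hpos (G := sqrtResolvent ε) fun T hT => ?_
  obtain ⟨u, hu⟩ := isUnit_opSqrt_add hε T
  have h1 := NormedRing.inverse_continuousAt u
  rw [hu] at h1
  have h2 : ContinuousWithinAt (fun T : Seq2 →L[ℂ] Seq2 =>
      opSqrt T + (ε : ℂ) • (1 : Seq2 →L[ℂ] Seq2)) {F | 0 ≤ F} T :=
    (continuousOn_opSqrt T hT).add continuousWithinAt_const
  exact ContinuousAt.comp_continuousWithinAt (g := Ring.inverse) h1 h2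

variable (hinj : ∀ᵐ θ ∂μ, ∀ z, opSqrt (F θ) z = 0 → z = 0)
include hinj

theorem aestronglyMeasurable_invSqrt {v : α → Seq2} (hv : AEStronglyMeasurable v μ)
    (hd : ∀ᵐ θ ∂μ, InFormDomain (F θ) (v θ)) :
    AEStronglyMeasurable (fun θ => invSqrt (F θ) (v θ)) μ := by
  refine aestronglyMeasurable_of_tendsto_ae atTop
    (f := fun (n : ℕ) θ => sqrtResolvent (1 / ((n : ℝ) + 1)) (F θ) (v θ)) (fun n => ?_) ?_
  · exact aestronglyMeasurable_clm_apply
      (aestronglyMeasurable_sqrtResolvent hF hpos Nat.one_div_pos_of_nat) hv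
  · filter_upwards [hinj, hd] with θ h1 h2
    obtain ⟨u, hu⟩ := h2
    rw [← hu, invSqrt_opSqrt h1]
    exact tendsto_sqrtResolvent_opSqrt h1 u

end Derived

theorem aestronglyMeasurable_whiten {f g : α → Seq2 →L[ℂ] Seq2}
    (hfm : AEStronglyMeasurable f μ) (hgm : AEStronglyMeasurable g μ)
    (hf : ∀ᵐ θ ∂μ, (f θ).IsPositive) (hg : ∀ᵐ θ ∂μ, (g θ).IsPositive)
    (hinj : ∀ᵐ θ ∂μ, ∀ z, opSqrt (f θ + g θ) z = 0 → z = 0)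
    {v : α → Seq2} (hv : AEStronglyMeasurable v μ) :
    AEStronglyMeasurable (fun θ => whiten (f θ + g θ) (f θ) (v θ)) μ := by
  have hF : AEStronglyMeasurable (fun θ => f θ + g θ) μ := hfm.add hgm
  have hpos : ∀ᵐ θ ∂μ, (f θ + g θ).IsPositive := by
    filter_upwards [hf, hg] with θ h1 h2 using h1.add h2
  set R : ℕ → α → Seq2 →L[ℂ] Seq2 := fun n θ => sqrtResolvent (1 / ((n : ℝ) + 1)) (f θ + g θ)
  have hR : ∀ n, AEStronglyMeasurable (R n) μ := fun n =>
    aestronglyMeasurable_sqrtResolvent hF hpos Nat.one_div_pos_of_nat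
  -- `F^{-1/2} f F^{-1/2} v` is the iterated limit of `R_n f R_m v`.
  refine aestronglyMeasurable_of_tendsto_ae atTop
    (f := fun m θ => whiten (f θ + g θ) (f θ) (opSqrt (f θ + g θ) (R m θ (v θ)))) (fun m => ?_) ?_
  · refine aestronglyMeasurable_of_tendsto_ae atTop
      (f := fun n θ => R n θ (f θ (R m θ (v θ)))) (fun n => ?_) ?_
    · exact aestronglyMeasurable_clm_apply (hR n) (aestronglyMeasurable_clm_apply hfm
        (aestronglyMeasurable_clm_apply (hR m) hv))
    · filter_upwards [hf, hg, hinj] with θ h1 h2 h3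
      rw [← opSqrt_whiten_opSqrt h1 h2 h3]
      exact tendsto_sqrtResolvent_opSqrt h3 _
  · filter_upwards [hinj] with θ h3
    have h4 := (tendsto_smul_sqrtResolvent h3 (v θ)).const_sub (v θ)
    rw [sub_zero] at h4
    refine ((whiten (f θ + g θ) (f θ)).continuous.tendsto _).comp (h4.congr fun n => ?_)
    exact (opSqrt_sqrtResolvent Nat.one_div_pos_of_nat _).symm

end Measurability

section Density

variable {Ω : Type*} [MeasurableSpace Ω] {P : Measure Ω} {d τ : ℕ} {x : ℕ → ℤ → Lp ℂ 2 P}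
  {f : ℝ → Seq2 →L[ℂ] Seq2}

theorem IsSpectralDensity.entry_aestronglyMeasurable (hτ : 0 < τ)
    (hf : IsSpectralDensity d τ x f) (k n : ℕ) :
    AEStronglyMeasurable (fun θ => (f θ (delta n)) k) circ := by
  have h1 : AEStronglyMeasurable (fun θ => ((weight d τ θ : ℂ))⁻¹) circ :=
    ((Complex.measurable_ofReal.comp (measurable_weight d τ)).inv).aestronglyMeasurable
  refine (h1.mul (hf.integrable k n).1).congr ?_
  filter_upwards [ae_weight_pos hτ d] with θ hθ
  simp only [Pi.mul_apply]
  rw [inv_mul_cancel_left₀]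
  exact_mod_cast hθ.ne'

theorem IsSpectralDensity.diag_integrable (hf : IsSpectralDensity d τ x f) (k : ℕ) :
    Integrable (fun θ => weight d τ θ * ((f θ (delta k)) k).re) circ := by
  refine (hf.integrable k k).re.congr (Eventually.of_forall fun θ => ?_)
  simp

/-- The trace of `w f` is finite almost everywhere and integrable, by monotone convergence. -/
theorem IsSpectralDensity.ae_weighted_summable (hf : IsSpectralDensity d τ x f) :
    (∀ᵐ θ ∂circ, Summable fun k => weight d τ θ * ((f θ (delta k)) k).re) ∧
      Integrable (fun θ => ∑' k, weight d τ θ * ((f θ (delta k)) k).re) circ := by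
  have hnn : ∀ᵐ θ ∂circ, ∀ k, 0 ≤ weight d τ θ * ((f θ (delta k)) k).re := by
    filter_upwards [hf.pos] with θ h k using mul_nonneg (weight_nonneg _ _ _) (diag_nonneg h k)
  have hm : ∀ k, AEMeasurable (fun θ => ENNReal.ofReal (weight d τ θ * ((f θ (delta k)) k).re))
      circ := fun k => (hf.diag_integrable k).1.aemeasurable.ennreal_ofReal
  have hlt : ∫⁻ θ, ∑' k, ENNReal.ofReal (weight d τ θ * ((f θ (delta k)) k).re) ∂circ < ⊤ := by
    rw [lintegral_tsum hm]
    have : ∀ k, ∫⁻ θ, ENNReal.ofReal (weight d τ θ * ((f θ (delta k)) k).re) ∂circ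
        = ENNReal.ofReal (∫ θ, weight d τ θ * ((f θ (delta k)) k).re ∂circ) := fun k => by
      rw [ofReal_integral_eq_lintegral_ofReal (hf.diag_integrable k)]
      filter_upwards [hnn] with θ h using h k
    simp only [this]
    rw [← ENNReal.ofReal_tsum_of_nonneg _ hf.trace]
    · exact ENNReal.ofReal_lt_top
    · intro k
      refine integral_nonneg_of_ae ?_
      filter_upwards [hnn] with θ h using h k
  have hs : ∀ᵐ θ ∂circ, Summable fun k => weight d τ θ * ((f θ (delta k)) k).re := by
    filter_upwards [hnn, ae_lt_top' (AEMeasurable.tsum hm) hlt.ne] with θ h1 h2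
    have := ENNReal.summable_toReal h2.ne
    refine this.congr fun k => ?_
    rw [ENNReal.toReal_ofReal (h1 k)]
  refine ⟨hs, ?_⟩
  have hmeas : AEStronglyMeasurable (fun θ => ∑' k, weight d τ θ * ((f θ (delta k)) k).re)
      circ := by
    refine aestronglyMeasurable_of_tendsto_ae atTop
      (f := fun n θ => ∑ k ∈ Finset.range n, weight d τ θ * ((f θ (delta k)) k).re)
      (fun n => Finset.aestronglyMeasurable_fun_sum _ fun k _ => (hf.diag_integrable k).1) ?_
    filter_upwards [hs] with θ h using h.hasSum.tendsto_sum_nat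
  refine ⟨hmeas, ?_⟩
  rw [hasFiniteIntegral_iff_ofReal]
  · refine lt_of_le_of_lt (lintegral_mono_ae ?_) hlt
    filter_upwards [hnn, hs] with θ h1 h2
    rw [ENNReal.ofReal_tsum_of_nonneg h1 h2]
  · filter_upwards [hnn] with θ h using tsum_nonneg h

theorem IsSpectralDensity.ae_summable (hτ : 0 < τ) (hf : IsSpectralDensity d τ x f) :
    ∀ᵐ θ ∂circ, Summable fun k => ((f θ (delta k)) k).re := by
  filter_upwards [hf.ae_weighted_summable.1, ae_weight_pos hτ d] with θ h1 h2
  exact (summable_mul_left_iff h2.ne').mp h1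

theorem IsSpectralDensity.aestronglyMeasurable (hτ : 0 < τ) (hf : IsSpectralDensity d τ x f) :
    AEStronglyMeasurable f circ :=
  aestronglyMeasurable_of_entries hf.pos (hf.ae_summable hτ)
    (hf.entry_aestronglyMeasurable hτ)

end Density

/-! ### Shift-invariant subspaces -/

section Shift

variable {H : Type*} [NormedAddCommGroup H] [InnerProductSpace ℂ H]

theorem mem_span_orthogonal_iff {G : Set H} {x : H} :
    x ∈ (Submodule.span ℂ G)ᗮ ↔ ∀ u ∈ G, inner ℂ u x = 0 := by
  rw [Submodule.mem_orthogonal]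
  refine ⟨fun h u hu => h u (Submodule.subset_span hu), fun h u hu => ?_⟩
  induction hu using Submodule.span_induction with
  | mem u hu => exact h u hu
  | zero => exact inner_zero_left _
  | add u v _ _ hu hv => rw [inner_add_left, hu, hv, add_zero]
  | smul z u _ hu => rw [inner_smul_left, hu, mul_zero]

theorem map_mem_closure_span {G : Set H} (S : H →ₗᵢ[ℂ] H)
    (hG : ∀ u ∈ G, S u ∈ (Submodule.span ℂ G).topologicalClosure) :
    ∀ x ∈ (Submodule.span ℂ G).topologicalClosure,
      S x ∈ (Submodule.span ℂ G).topologicalClosure := by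
  have : (Submodule.span ℂ G).topologicalClosure
      ≤ (Submodule.span ℂ G).topologicalClosure.comap S.toLinearMap :=
    Submodule.topologicalClosure_minimal _ (Submodule.span_le.mpr hG)
      ((Submodule.isClosed_topologicalClosure _).preimage S.continuous)
  exact fun x hx => this hx

/-- The diagonal action of an isometry on pairs. -/
noncomputable def pairMap (S : H →ₗᵢ[ℂ] H) : WithLp 2 (H × H) →ₗᵢ[ℂ] WithLp 2 (H × H) where
  toFun z := WithLp.toLp 2 (S z.fst, S z.snd)
  map_add' z z' := WithLp.ofLp_injective 2 (Prod.ext (map_add S _ _) (map_add S _ _))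
  map_smul' c z := WithLp.ofLp_injective 2 (Prod.ext (map_smul S _ _) (map_smul S _ _))
  norm_map' z := by
    refine (sq_eq_sq₀ (norm_nonneg _) (norm_nonneg _)).mp ?_
    rw [WithLp.prod_norm_sq_eq_of_L2 z]
    refine (WithLp.prod_norm_sq_eq_of_L2 _).trans ?_
    change ‖S z.fst‖ ^ 2 + ‖S z.snd‖ ^ 2 = _
    rw [S.norm_map, S.norm_map]

theorem pairMap_toLp (S : H →ₗᵢ[ℂ] H) (x y : H) :
    pairMap S (WithLp.toLp 2 (x, y)) = WithLp.toLp 2 (S x, S y) := rfl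

theorem pairMap_fst (S : H →ₗᵢ[ℂ] H) (z : WithLp 2 (H × H)) : (pairMap S z).fst = S z.fst := rfl

theorem pairMap_snd (S : H →ₗᵢ[ℂ] H) (z : WithLp 2 (H × H)) : (pairMap S z).snd = S z.snd := rfl

theorem iterate_pairMap_fst (S : H →ₗᵢ[ℂ] H) (j : ℕ) (z : WithLp 2 (H × H)) :
    ((pairMap S)^[j] z).fst = S^[j] z.fst := by
  induction j with
  | zero => rfl
  | succ j ih => rw [Function.iterate_succ_apply', Function.iterate_succ_apply', pairMap_fst, ih]

theorem iterate_pairMap_snd (S : H →ₗᵢ[ℂ] H) (j : ℕ) (z : WithLp 2 (H × H)) :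
    ((pairMap S)^[j] z).snd = S^[j] z.snd := by
  induction j with
  | zero => rfl
  | succ j ih => rw [Function.iterate_succ_apply', Function.iterate_succ_apply', pairMap_snd, ih]

theorem inner_toLp_left (x y : H) (z : WithLp 2 (H × H)) :
    inner ℂ (WithLp.toLp 2 (x, y)) z = inner ℂ x z.fst + inner ℂ y z.snd :=
  WithLp.prod_inner_apply _ _

theorem inner_pair (z z' : WithLp 2 (H × H)) :
    inner ℂ z z' = inner ℂ z.fst z'.fst + inner ℂ z.snd z'.snd :=
  WithLp.prod_inner_apply _ _

variable [CompleteSpace H]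

/-- Let `Y ⊆ X` be closed subspaces invariant under an isometry `S` and suppose that `⋂ Sʲ X = 0`.
By the Wold decomposition `X` is generated by its wandering vectors `e ∈ X ⊖ S X`. The projection
of `e` to `Y` is wandering too. Hence `X = Y` as soon as there is no nonzero element of `X ⊖ Y` that
is a difference of two wandering vectors. -/
theorem le_of_wandering_differences (S : H →ₗᵢ[ℂ] H) {X Y : Submodule ℂ H}
    (hX : IsClosed (X : Set H)) (hY : IsClosed (Y : Set H)) (hSX : ∀ x ∈ X, S x ∈ X)
    (hSY : ∀ x ∈ Y, S x ∈ Y) (hYX : Y ≤ X)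
    (hpure : ∀ x, (∀ j : ℕ, ∃ y ∈ X, S^[j] y = x) → x = 0)
    (hdiff : ∀ e ∈ X, ∀ p ∈ Y, (∀ j : ℕ, inner ℂ (S^[j + 1] e) e = 0) →
      (∀ j : ℕ, inner ℂ (S^[j + 1] p) p = 0) → (∀ y ∈ Y, inner ℂ y (e - p) = 0) → e = p) :
    X ≤ Y := by
  have : CompleteSpace X := hX.completeSpace_coe
  have : CompleteSpace Y := hY.completeSpace_coe
  have hiter : ∀ (Z : Submodule ℂ H), (∀ x ∈ Z, S x ∈ Z) → ∀ (j : ℕ) x, x ∈ Z → S^[j] x ∈ Z := by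
    intro Z hZ j
    induction j with
    | zero => exact fun x hx => hx
    | succ j ih => exact fun x hx => ih _ (hZ x hx)
  set SX : Submodule ℂ H := X.map S.toLinearMap with hSXdef
  have : CompleteSpace SX := by
    have hc : IsComplete (X : Set H) := hX.isComplete
    have : IsComplete ((fun x => S x) '' (X : Set H)) :=
      (isComplete_image_iff S.isometry.isUniformInducing).mpr hc
    exact IsComplete.completeSpace_coe this
  have hmemSX : ∀ j : ℕ, ∀ x ∈ X, S^[j + 1] x ∈ SX := fun j x hx => by
    rw [Function.iterate_succ_apply']
    exact ⟨_, hiter X hSX j x hx, rfl⟩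
  -- Wandering vectors of `X` belong to `Y`.
  have hwand : ∀ e ∈ X, (∀ y ∈ SX, inner ℂ y e = 0) → e ∈ Y := by
    intro e he hw
    have hp : Y.starProjection e ∈ Y := Y.starProjection_apply_mem e
    have horth : ∀ y ∈ Y, inner ℂ y (e - Y.starProjection e) = 0 := fun y hy =>
      (Submodule.mem_orthogonal _ _).mp (Y.sub_starProjection_mem_orthogonal e) y hy
    have h := hdiff e he _ hp (fun j => hw _ (hmemSX j e he)) (fun j => ?_) horth
    · rw [h]; exact hp
    · have h1 := horth _ (hiter Y hSY (j + 1) _ hp)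
      rw [inner_sub_right, hw _ (hmemSX j _ (hYX hp)), zero_sub, neg_eq_zero] at h1
      exact h1
  -- An element of `X` orthogonal to `Y` belongs to all `Sʲ X`.
  have hzero : ∀ x ∈ X, (∀ y ∈ Y, inner ℂ y x = 0) → x = 0 := by
    intro x hx hxY
    have key : ∀ j : ℕ, ∃ y ∈ X, S^[j] y = x := by
      intro j
      induction j with
      | zero => exact ⟨x, hx, rfl⟩
      | succ j ih =>
        obtain ⟨y, hy, hyx⟩ := ih
        set p := SX.starProjection y with hp
        have hpm : p ∈ SX := SX.starProjection_apply_mem y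
        have hpX : p ∈ X := by
          obtain ⟨u, hu, hup⟩ := hpm
          rw [← hup]
          exact hSX u hu
        have he : ∀ z ∈ SX, inner ℂ z (y - p) = 0 := fun z hz =>
          (Submodule.mem_orthogonal _ _).mp (SX.sub_starProjection_mem_orthogonal y) z hz
        have heY : y - p ∈ Y := hwand _ (X.sub_mem hy hpX) he
        have h0 : inner ℂ (y - p) y = 0 := by
          have h1 := hxY _ (hiter Y hSY j _ heY)
          rw [← hyx] at h1
          have h2 : inner ℂ ((S^[j]) (y - p)) ((S^[j]) y) = inner ℂ (y - p) y := by
            clear h1 hyx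
            induction j with
            | zero => rfl
            | succ j ih =>
              rw [Function.iterate_succ_apply', Function.iterate_succ_apply', S.inner_map_map]
              exact ih
          rwa [h2] at h1
        have h3 : inner ℂ (y - p) p = 0 := by
          rw [← inner_conj_symm, he p hpm, map_zero]
        have h4 : inner ℂ (y - p) (y - p) = 0 := by rw [inner_sub_right, h0, h3, sub_zero]
        have h5 : y = p := sub_eq_zero.mp (inner_self_eq_zero.mp h4)
        obtain ⟨u, hu, hup⟩ := hpm
        refine ⟨u, hu, ?_⟩
        rw [Function.iterate_succ_apply]
        have : S u = y := by rw [h5]; exact hup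
        rw [this, hyx]
    exact hpure x key
  intro x hx
  have hp : Y.starProjection x ∈ Y := Y.starProjection_apply_mem x
  have h := hzero (x - Y.starProjection x) (X.sub_mem hx (hYX hp)) fun y hy =>
    (Submodule.mem_orthogonal _ _).mp (Y.sub_starProjection_mem_orthogonal x) y hy
  rw [sub_eq_zero.mp h]
  exact hp

end Shift

/-! ### The space `L²((-π, π]; ℓ²)` -/

/-- The Hilbert space `L²((-π, π]; ℓ²)`. -/
abbrev CircL2 : Type := Lp Seq2 2 circ

instance : IsFiniteMeasure circ := by unfold circ; infer_instance

theorem norm_exp_I_mul (n : ℤ) (θ : ℝ) : ‖Complex.exp (Complex.I * n * θ)‖ = 1 := by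
  rw [show Complex.I * n * θ = ((n * θ : ℝ) : ℂ) * Complex.I by push_cast; ring,
    Complex.norm_exp_ofReal_mul_I]

theorem conj_exp_I_mul (n : ℤ) (θ : ℝ) :
    conj (Complex.exp (Complex.I * n * θ)) = Complex.exp (Complex.I * (-n : ℤ) * θ) := by
  rw [← Complex.exp_conj]
  simp

theorem memLp_exp_smul {v : ℝ → Seq2} (hv : MemLp v 2 circ) (n : ℤ) :
    MemLp (fun θ : ℝ => Complex.exp (Complex.I * n * θ) • v θ) 2 circ := by
  have hc : Continuous fun θ : ℝ => Complex.exp (Complex.I * n * θ) := by fun_prop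
  refine hv.of_le (hc.aestronglyMeasurable.smul hv.1) (Eventually.of_forall fun θ => ?_)
  rw [norm_smul, norm_exp_I_mul, one_mul]

/-- Multiplication by `e^{inθ}` on `L²((-π, π]; ℓ²)`. -/
noncomputable def expMul (n : ℤ) : CircL2 →ₗᵢ[ℂ] CircL2 where
  toFun U := (memLp_exp_smul (Lp.memLp U) n).toLp _
  map_add' U V := by
    ext1
    filter_upwards [(memLp_exp_smul (Lp.memLp (U + V)) n).coeFn_toLp,
      Lp.coeFn_add ((memLp_exp_smul (Lp.memLp U) n).toLp _)
        ((memLp_exp_smul (Lp.memLp V) n).toLp _),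
      (memLp_exp_smul (Lp.memLp U) n).coeFn_toLp, (memLp_exp_smul (Lp.memLp V) n).coeFn_toLp,
      Lp.coeFn_add U V] with θ h1 h2 h3 h4 h5
    rw [h1, h2, Pi.add_apply, h3, h4, h5, Pi.add_apply, smul_add]
  map_smul' z U := by
    ext1
    filter_upwards [(memLp_exp_smul (Lp.memLp (z • U)) n).coeFn_toLp,
      Lp.coeFn_smul z ((memLp_exp_smul (Lp.memLp U) n).toLp _),
      (memLp_exp_smul (Lp.memLp U) n).coeFn_toLp, Lp.coeFn_smul z U] with θ h1 h2 h3 h5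
    rw [h1, RingHom.id_apply, h2, Pi.smul_apply, h3, h5, Pi.smul_apply, smul_comm]
  norm_map' U := by
    change ‖(memLp_exp_smul (Lp.memLp U) n).toLp _‖ = _
    rw [Lp.norm_toLp, Lp.norm_def]
    congr 1
    refine eLpNorm_congr_norm_ae (Eventually.of_forall fun θ => ?_)
    rw [norm_smul, norm_exp_I_mul, one_mul]

theorem coeFn_expMul (n : ℤ) (U : CircL2) :
    expMul n U =ᵐ[circ] fun θ => Complex.exp (Complex.I * n * θ) • U θ :=
  (memLp_exp_smul (Lp.memLp U) n).coeFn_toLp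

theorem expMul_expMul (n m : ℤ) (U : CircL2) : expMul n (expMul m U) = expMul (n + m) U := by
  ext1
  filter_upwards [coeFn_expMul n (expMul m U), coeFn_expMul m U, coeFn_expMul (n + m) U]
    with θ h1 h2 h3
  rw [h1, h2, h3, smul_smul, ← Complex.exp_add]
  congr 2
  push_cast; ring

theorem expMul_zero (U : CircL2) : expMul 0 U = U := by
  ext1
  filter_upwards [coeFn_expMul 0 U] with θ h
  rw [h]; simp

theorem iterate_expMul (j : ℕ) (U : CircL2) : (expMul (-1))^[j] U = expMul (-j) U := by
  induction j with
  | zero => simp [expMul_zero]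
  | succ j ih =>
    rw [Function.iterate_succ_apply', ih, expMul_expMul,
      show (-1 : ℤ) + -(j : ℤ) = -((j + 1 : ℕ) : ℤ) by push_cast; ring]

theorem inner_expMul_left (n : ℤ) (U V : CircL2) :
    inner ℂ (expMul n U) V
      = ∫ θ : ℝ, Complex.exp (Complex.I * (-n : ℤ) * θ) * inner ℂ (U θ) (V θ) ∂circ := by
  rw [L2.inner_def]
  refine integral_congr_ae ?_
  filter_upwards [coeFn_expMul n U] with θ h
  rw [h, inner_smul_left, conj_exp_I_mul]

theorem inner_expMul_comm (n : ℤ) (U V : CircL2) :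
    inner ℂ (expMul n U) V = inner ℂ U (expMul (-n) V) := by
  rw [← (expMul n).inner_map_map U (expMul (-n) V), expMul_expMul, add_neg_cancel, expMul_zero]

theorem ae_inner_eq_zero {U V : CircL2} (h : ∀ n : ℤ, inner ℂ (expMul n U) V = 0) :
    ∀ᵐ θ ∂circ, inner ℂ (U θ) (V θ) = 0 := by
  refine ae_circ_eq_zero_of_integral_exp (L2.integrable_inner U V) fun n => ?_
  have := h (-n)
  rwa [inner_expMul_left, neg_neg] at this

/-- A nonnegative integrable function whose Fourier coefficients of positive order vanish is
essentially bounded (in fact constant). -/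
theorem exists_ae_le_of_integral_exp {h : ℝ → ℝ} (hi : Integrable h circ)
    (h0 : ∀ j : ℕ, ∫ θ : ℝ, Complex.exp (Complex.I * ((j : ℤ) + 1 : ℤ) * θ) * (h θ : ℂ) ∂circ = 0) :
    ∃ M : ℝ, ∀ᵐ θ ∂circ, h θ ≤ M := by
  obtain ⟨z, hz⟩ := ae_circ_eq_const_of_integral_exp (t := fun θ => (h θ : ℂ)) hi.ofReal
    fun n hn => by
      rcases lt_or_gt_of_ne hn with hn' | hn'
      · obtain ⟨j, rfl⟩ : ∃ j : ℕ, n = -((j : ℤ) + 1) := ⟨(-n - 1).toNat, by omega⟩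
        have := congrArg conj (h0 j)
        rw [map_zero, ← integral_conj] at this
        rw [← this]
        refine integral_congr_ae (Eventually.of_forall fun θ => ?_)
        simp only [map_mul, Complex.conj_ofReal, conj_exp_I_mul]
      · obtain ⟨j, rfl⟩ : ∃ j : ℕ, n = (j : ℤ) + 1 := ⟨(n - 1).toNat, by omega⟩
        exact h0 j
  refine ⟨z.re, ?_⟩
  filter_upwards [hz] with θ hθ
  rw [← hθ, Complex.ofReal_re]

theorem integrable_norm_sq (U : CircL2) : Integrable (fun θ => ‖U θ‖ ^ 2) circ :=
  (memLp_two_iff_integrable_sq_norm (Lp.memLp U).1).mp (Lp.memLp U)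

theorem inner_iterate_expMul_self (j : ℕ) (U : CircL2) :
    inner ℂ ((expMul (-1))^[j + 1] U) U
      = ∫ θ : ℝ, Complex.exp (Complex.I * ((j : ℤ) + 1 : ℤ) * θ) * ((‖U θ‖ ^ 2 : ℝ) : ℂ) ∂circ := by
  rw [iterate_expMul, inner_expMul_left]
  refine integral_congr_ae (Eventually.of_forall fun θ => ?_)
  simp only
  rw [inner_self_eq_norm_sq_to_K, neg_neg]
  push_cast
  rfl

/-- Wandering vectors of the shift are essentially bounded. -/
theorem exists_ae_norm_le_of_wandering {U : CircL2}
    (h : ∀ j : ℕ, inner ℂ ((expMul (-1))^[j + 1] U) U = 0) : ∃ M : ℝ, ∀ᵐ θ ∂circ, ‖U θ‖ ≤ M := by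
  obtain ⟨M, hM⟩ := exists_ae_le_of_integral_exp (integrable_norm_sq U) fun j => by
    rw [← inner_iterate_expMul_self, h]
  refine ⟨√M, ?_⟩
  filter_upwards [hM] with θ hθ using Real.le_sqrt_of_sq_le hθ

/-! ### Completeness of the dual system -/

/-- A square-integrable field of self-adjoint operators `A(θ)` and square-integrable vector
functions `D k` with `A(θ) (D k θ) = δ_k`. For `A = (w (f + g))^{1/2}` their existence is the
minimality condition. -/
structure IsDualPair (A : ℝ → Seq2 →L[ℂ] Seq2) (D : ℕ → ℝ → Seq2) : Prop where
  memLp : MemLp A 2 circ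
  symm : ∀ᵐ θ ∂circ, ∀ x y, inner ℂ (A θ x) y = inner ℂ x (A θ y)
  memLp_dual : ∀ k, MemLp (D k) 2 circ
  apply_dual : ∀ᵐ θ ∂circ, ∀ k, A θ (D k θ) = delta k

/-- The coordinate vector `δ_k` as a constant function. -/
noncomputable def unitVec (k : ℕ) : CircL2 := (memLp_const (delta k)).toLp _

theorem coeFn_unitVec (k : ℕ) : unitVec k =ᵐ[circ] fun _ => delta k := MemLp.coeFn_toLp _

theorem inner_unitVec (k : ℕ) (n : ℤ) (q : CircL2) : inner ℂ (expMul n (unitVec k)) q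
    = ∫ θ : ℝ, Complex.exp (Complex.I * (-n : ℤ) * θ) * inner ℂ (delta k) (q θ) ∂circ := by
  rw [inner_expMul_left]
  refine integral_congr_ae ?_
  filter_upwards [coeFn_unitVec k] with θ h1
  rw [h1]

namespace IsDualPair

variable {A : ℝ → Seq2 →L[ℂ] Seq2} {D : ℕ → ℝ → Seq2} (h : IsDualPair A D)
include h

theorem memLp_apply (x : Seq2) : MemLp (fun θ => A θ x) 2 circ := by
  refine MemLp.of_le_mul (c := ‖x‖) h.memLp (h.memLp.1.apply_continuousLinearMap x)
    (Eventually.of_forall fun θ => ?_)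
  rw [mul_comm]
  exact (A θ).le_opNorm x

/-- The function `A δ_k`. -/
noncomputable def col (k : ℕ) : CircL2 := (h.memLp_apply (delta k)).toLp _

/-- The function `D k`. -/
noncomputable def dual (k : ℕ) : CircL2 := (h.memLp_dual k).toLp _

theorem coeFn_col (k : ℕ) : h.col k =ᵐ[circ] fun θ => A θ (delta k) := MemLp.coeFn_toLp _

theorem coeFn_dual (k : ℕ) : h.dual k =ᵐ[circ] D k := MemLp.coeFn_toLp _

theorem ae_injective : ∀ᵐ θ ∂circ, ∀ x, A θ x = 0 → x = 0 := by
  filter_upwards [h.symm, h.apply_dual] with θ h1 h2 x hx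
  refine ext_delta fun k => ?_
  rw [← h2 k, h1, hx, inner_zero_right, inner_zero_right]

theorem inner_col (k : ℕ) (n : ℤ) (q : CircL2) : inner ℂ (expMul n (h.col k)) q
    = ∫ θ : ℝ, Complex.exp (Complex.I * (-n : ℤ) * θ) * inner ℂ (delta k) (A θ (q θ)) ∂circ := by
  rw [inner_expMul_left]
  refine integral_congr_ae ?_
  filter_upwards [h.coeFn_col k, h.symm] with θ h1 h2
  rw [h1, h2]

/-- The systems `e^{inθ} A δ_k` and `e^{imθ} D l` are biorthogonal. -/
theorem inner_col_dual (k l : ℕ) {n m : ℤ} (hnm : n ≠ m) :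
    inner ℂ (expMul n (h.col k)) (expMul m (h.dual l)) = 0 := by
  rw [inner_col]
  have h1 : ∫ θ : ℝ, Complex.exp (Complex.I * (-n : ℤ) * θ) *
      inner ℂ (delta k) (A θ (expMul m (h.dual l) θ)) ∂circ
      = ∫ θ : ℝ, Complex.exp (Complex.I * (m - n : ℤ) * θ) * inner ℂ (delta k) (delta l) ∂circ := by
    refine integral_congr_ae ?_
    filter_upwards [coeFn_expMul m (h.dual l), h.coeFn_dual l, h.apply_dual] with θ h1 h2 h3
    rw [h1, h2, map_smul, h3, inner_smul_right, ← mul_assoc, ← Complex.exp_add]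
    congr 2
    push_cast; ring
  rw [h1, integral_mul_const, circ, ← intervalIntegral.integral_of_le (by linarith [Real.pi_pos])]
  rw [integral_exp_mul_complex (by simp [sub_eq_zero, Int.cast_inj, hnm.symm])]
  rw [show Complex.I * (m - n : ℤ) * ((Real.pi : ℝ) : ℂ) =
      Complex.I * (m - n : ℤ) * ((-Real.pi : ℝ) : ℂ) + (m - n : ℤ) * (2 * Real.pi * Complex.I) by
    push_cast; ring,
    Complex.exp_add, Complex.exp_int_mul_two_pi_mul_I, mul_one, sub_self, zero_div, zero_mul]

theorem eq_zero_of_inner_col {q : CircL2}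
    (hq : ∀ k n, inner ℂ (expMul n (h.col k)) q = 0) : q = 0 := by
  have h1 : ∀ᵐ θ ∂circ, ∀ k, inner ℂ (h.col k θ) (q θ) = 0 :=
    ae_all_iff.mpr fun k => ae_inner_eq_zero fun n => hq k n
  have h2 : ∀ᵐ θ ∂circ, ∀ k, h.col k θ = A θ (delta k) := ae_all_iff.mpr h.coeFn_col
  ext1
  filter_upwards [h1, h2, h.symm, h.ae_injective, Lp.coeFn_zero Seq2 2 circ] with θ h1 h2 h3 h4 h5
  rw [h5]
  refine h4 _ (ext_delta fun k => ?_)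
  rw [← h3, ← h2, h1, inner_zero_right]

theorem memLp_apply_of_bounded {q : CircL2} {M : ℝ} (hq : ∀ᵐ θ ∂circ, ‖q θ‖ ≤ M) :
    MemLp (fun θ => A θ (q θ)) 2 circ := by
  refine MemLp.of_le_mul (c := M) h.memLp
    (aestronglyMeasurable_clm_apply h.memLp.1 (Lp.memLp q).1) ?_
  filter_upwards [hq] with θ hθ
  refine ((A θ).le_opNorm _).trans ?_
  rw [mul_comm]
  gcongr

/-- The functions in `L²` with `A q` of negative frequencies. -/
noncomputable def negSpace : Submodule ℂ CircL2 :=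
  (Submodule.span ℂ {u | ∃ (k : ℕ) (n : ℤ), 0 ≤ n ∧ u = expMul n (h.col k)})ᗮ

theorem mem_negSpace {q : CircL2} :
    q ∈ h.negSpace ↔ ∀ k (n : ℤ), 0 ≤ n → inner ℂ (expMul n (h.col k)) q = 0 := by
  rw [negSpace, mem_span_orthogonal_iff]
  exact ⟨fun hq k n hn => hq _ ⟨k, n, hn, rfl⟩, by rintro hq _ ⟨k, n, hn, rfl⟩; exact hq k n hn⟩

/-- The closed span of the functions `e^{inθ} D k`, `n < 0`. -/
noncomputable def dualSpan : Submodule ℂ CircL2 :=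
  (Submodule.span ℂ
    {u | ∃ (k : ℕ) (n : ℤ), n < 0 ∧ u = expMul n (h.dual k)}).topologicalClosure

theorem mem_dualSpan_of_neg (k : ℕ) {n : ℤ} (hn : n < 0) : expMul n (h.dual k) ∈ h.dualSpan :=
  Submodule.le_topologicalClosure _ (Submodule.subset_span ⟨k, n, hn, rfl⟩)

theorem dualSpan_le {Z : Submodule ℂ CircL2} (hZ : IsClosed (Z : Set CircL2))
    (hd : ∀ k (n : ℤ), n < 0 → expMul n (h.dual k) ∈ Z) : h.dualSpan ≤ Z := by
  refine Submodule.topologicalClosure_minimal _ (Submodule.span_le.mpr ?_) hZ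
  rintro _ ⟨k, n, hn, rfl⟩
  exact hd k n hn

/-- If the only `q` with `A q ∈ L²` of negative frequencies that is orthogonal to all `e^{inθ} D k`,
`n < 0`, is `0`, then the `e^{inθ} D k` generate all `q` with `A q` of negative frequencies.

The condition `A q ∈ L²` may be dropped since wandering vectors are bounded. -/
theorem negSpace_le_dualSpan
    (hinj : ∀ q : CircL2, MemLp (fun θ => A θ (q θ)) 2 circ → q ∈ h.negSpace →
      (∀ k (n : ℤ), n < 0 → inner ℂ (expMul n (h.dual k)) q = 0) → q = 0) :
    h.negSpace ≤ h.dualSpan := by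
  have hshift : ∀ x ∈ h.dualSpan, expMul (-1) x ∈ h.dualSpan := by
    refine map_mem_closure_span _ ?_
    rintro _ ⟨k, n, hn, rfl⟩
    rw [expMul_expMul]
    exact h.mem_dualSpan_of_neg k (by omega)
  have hle : h.dualSpan ≤ h.negSpace := by
    refine h.dualSpan_le (Submodule.isClosed_orthogonal _) fun k n hn => ?_
    exact h.mem_negSpace.mpr fun l m hm => h.inner_col_dual l k (by omega)
  refine le_of_wandering_differences (expMul (-1)) (Submodule.isClosed_orthogonal _)
    (Submodule.isClosed_topologicalClosure _) ?_ hshift hle ?_ ?_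
  · intro x hx
    refine h.mem_negSpace.mpr fun k n hn => ?_
    rw [← neg_neg (-1 : ℤ), ← inner_expMul_comm, expMul_expMul]
    exact h.mem_negSpace.mp hx k _ (by omega)
  · intro x hx
    refine h.eq_zero_of_inner_col fun k n => ?_
    obtain ⟨y, hy, rfl⟩ := hx n.natAbs
    rw [iterate_expMul, ← inner_expMul_comm, expMul_expMul]
    exact h.mem_negSpace.mp hy k _ (by omega)
  · intro e he p hp hwe hwp horth
    obtain ⟨M₁, hM₁⟩ := exists_ae_norm_le_of_wandering hwe
    obtain ⟨M₂, hM₂⟩ := exists_ae_norm_le_of_wandering hwp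
    refine sub_eq_zero.mp (hinj (e - p) ?_ (Submodule.sub_mem _ he (hle hp)) fun k n hn =>
      horth _ (h.mem_dualSpan_of_neg k hn))
    refine h.memLp_apply_of_bounded (M := M₁ + M₂) ?_
    filter_upwards [hM₁, hM₂, Lp.coeFn_sub e p] with θ h1 h2 h3
    rw [h3, Pi.sub_apply]
    exact (norm_sub_le _ _).trans (add_le_add h1 h2)

end IsDualPair

/-- Wandering pairs are essentially bounded. -/
theorem exists_ae_norm_le_of_pair_wandering {z : WithLp 2 (CircL2 × CircL2)}
    (h : ∀ j : ℕ, inner ℂ ((pairMap (expMul (-1)))^[j + 1] z) z = 0) :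
    ∃ M : ℝ, ∀ᵐ θ ∂circ, ‖z.fst θ‖ ≤ M ∧ ‖z.snd θ‖ ≤ M := by
  obtain ⟨M, hM⟩ := exists_ae_le_of_integral_exp
    (h := fun θ => ‖z.fst θ‖ ^ 2 + ‖z.snd θ‖ ^ 2)
    ((integrable_norm_sq _).add (integrable_norm_sq _)) fun j => by
      have h1 := h j
      rw [inner_pair, iterate_pairMap_fst, iterate_pairMap_snd, inner_iterate_expMul_self,
        inner_iterate_expMul_self, ← integral_add] at h1
      · rw [← h1]
        refine integral_congr_ae (Eventually.of_forall fun θ => ?_)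
        simp only
        push_cast
        ring
      · exact integrable_circ_exp_mul (integrable_norm_sq z.fst).ofReal _
      · exact integrable_circ_exp_mul (integrable_norm_sq z.snd).ofReal _
  refine ⟨√M, ?_⟩
  filter_upwards [hM] with θ hθ
  exact ⟨Real.le_sqrt_of_sq_le (le_trans (le_add_of_nonneg_right (by positivity)) hθ),
    Real.le_sqrt_of_sq_le (le_trans (le_add_of_nonneg_left (by positivity)) hθ)⟩

namespace IsDualPair

variable {A : ℝ → Seq2 →L[ℂ] Seq2} {D : ℕ → ℝ → Seq2} (h : IsDualPair A D)
include h

/-- The pairs `(q, A q)` with `A q ∈ L²` of negative frequencies. -/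
noncomputable def graphSpace : Submodule ℂ (WithLp 2 (CircL2 × CircL2)) :=
  (Submodule.span ℂ {u | (∃ (k : ℕ) (n : ℤ),
      u = WithLp.toLp 2 (-expMul n (h.col k), expMul n (unitVec k))) ∨
    ∃ (k : ℕ) (n : ℤ), 0 ≤ n ∧ u = WithLp.toLp 2 (0, expMul n (unitVec k))})ᗮ

theorem mem_graphSpace {z : WithLp 2 (CircL2 × CircL2)} :
    z ∈ h.graphSpace ↔ (∀ k n, inner ℂ (expMul n (unitVec k)) z.snd
        = inner ℂ (expMul n (h.col k)) z.fst) ∧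
      ∀ k (n : ℤ), 0 ≤ n → inner ℂ (expMul n (unitVec k)) z.snd = 0 := by
  have e1 : ∀ k n, inner ℂ
      (WithLp.toLp 2 (-expMul n (h.col k), expMul n (unitVec k)) : WithLp 2 (CircL2 × CircL2)) z
      = -inner ℂ (expMul n (h.col k)) z.fst + inner ℂ (expMul n (unitVec k)) z.snd :=
    fun k n => by rw [inner_toLp_left, inner_neg_left]
  have e2 : ∀ k n, inner ℂ
      (WithLp.toLp 2 (0, expMul n (unitVec k)) : WithLp 2 (CircL2 × CircL2)) z
      = inner ℂ (expMul n (unitVec k)) z.snd :=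
    fun k n => by rw [inner_toLp_left, inner_zero_left, zero_add]
  rw [graphSpace, mem_span_orthogonal_iff]
  constructor
  · intro hz
    refine ⟨fun k n => ?_, fun k n hn => ?_⟩
    · have := hz _ (Or.inl ⟨k, n, rfl⟩)
      rw [e1] at this
      exact (neg_add_eq_zero.mp this).symm
    · have := hz _ (Or.inr ⟨k, n, hn, rfl⟩)
      rwa [e2] at this
  · rintro ⟨h1, h2⟩ _ (⟨k, n, rfl⟩ | ⟨k, n, hn, rfl⟩)
    · rw [e1, h1, neg_add_cancel]
    · rw [e2, h2 k n hn]

theorem ae_eq_of_mem_graphSpace {z : WithLp 2 (CircL2 × CircL2)} (hz : z ∈ h.graphSpace) :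
    ∀ᵐ θ ∂circ, z.snd θ = A θ (z.fst θ) := by
  have h0 : ∀ k, ∀ᵐ θ ∂circ, inner ℂ (delta k) (z.snd θ) - inner ℂ (A θ (delta k)) (z.fst θ) = 0 := by
    intro k
    have hi1 : Integrable (fun θ => inner ℂ (delta k) (z.snd θ)) circ := by
      refine (L2.integrable_inner (𝕜 := ℂ) (unitVec k) z.snd).congr ?_
      filter_upwards [coeFn_unitVec k] with θ h1
      rw [h1]
    have hi2 : Integrable (fun θ => inner ℂ (A θ (delta k)) (z.fst θ)) circ := by
      refine (L2.integrable_inner (𝕜 := ℂ) (h.col k) z.fst).congr ?_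
      filter_upwards [h.coeFn_col k] with θ h1
      rw [h1]
    refine ae_circ_eq_zero_of_integral_exp (hi1.sub hi2) fun n => ?_
    have h1 := (h.mem_graphSpace.mp hz).1 k (-n)
    rw [inner_unitVec, h.inner_col, neg_neg] at h1
    simp only [mul_sub]
    rw [integral_sub (integrable_circ_exp_mul hi1 n) (integrable_circ_exp_mul hi2 n), h1,
      sub_eq_zero]
    refine integral_congr_ae ?_
    filter_upwards [h.symm] with θ h2
    rw [h2]
  filter_upwards [ae_all_iff.mpr h0, h.symm] with θ h1 h2
  refine ext_delta fun k => ?_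
  rw [← h2, sub_eq_zero.mp (h1 k)]

theorem mem_graphSpace_of_ae_eq {q c : CircL2} (hc : ∀ᵐ θ ∂circ, c θ = A θ (q θ))
    (hq : q ∈ h.negSpace) :
    (WithLp.toLp 2 (q, c) : WithLp 2 (CircL2 × CircL2)) ∈ h.graphSpace := by
  have e : ∀ k n, inner ℂ (expMul n (unitVec k)) c = inner ℂ (expMul n (h.col k)) q := by
    intro k n
    rw [inner_unitVec, h.inner_col]
    refine integral_congr_ae ?_
    filter_upwards [hc] with θ h1
    rw [h1]
  exact h.mem_graphSpace.mpr ⟨e, fun k n hn => (e k n).trans (h.mem_negSpace.mp hq k n hn)⟩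

/-- The closed span of the pairs `(e^{inθ} D k, e^{inθ} δ_k)`, `n < 0`. -/
noncomputable def graphSpan : Submodule ℂ (WithLp 2 (CircL2 × CircL2)) :=
  (Submodule.span ℂ {u | ∃ (k : ℕ) (n : ℤ), n < 0 ∧
    u = WithLp.toLp 2 (expMul n (h.dual k), expMul n (unitVec k))}).topologicalClosure

theorem mem_graphSpan_of_neg (k : ℕ) {n : ℤ} (hn : n < 0) :
    (WithLp.toLp 2 (expMul n (h.dual k), expMul n (unitVec k)) : WithLp 2 (CircL2 × CircL2))
      ∈ h.graphSpan :=
  Submodule.le_topologicalClosure _ (Submodule.subset_span ⟨k, n, hn, rfl⟩)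

theorem graphSpan_le {Z : Submodule ℂ (WithLp 2 (CircL2 × CircL2))}
    (hZ : IsClosed (Z : Set (WithLp 2 (CircL2 × CircL2))))
    (hd : ∀ k (n : ℤ), n < 0 → WithLp.toLp 2 (expMul n (h.dual k), expMul n (unitVec k)) ∈ Z) :
    h.graphSpan ≤ Z := by
  refine Submodule.topologicalClosure_minimal _ (Submodule.span_le.mpr ?_) hZ
  rintro _ ⟨k, n, hn, rfl⟩
  exact hd k n hn

/-- Approximation in the graph norm: if the `e^{inθ} D k`, `n < 0`, generate all `q` with `A q` of
negative frequencies, then their finite combinations approximate `q` and `A q` simultaneously. A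
bounded pair `(q, A q)` orthogonal to `graphSpan` satisfies `‖q‖² + ‖A q‖² = 0`. -/
theorem graphSpace_le_graphSpan (hle : h.negSpace ≤ h.dualSpan) :
    h.graphSpace ≤ h.graphSpan := by
  have hshift : ∀ x ∈ h.graphSpan, pairMap (expMul (-1)) x ∈ h.graphSpan := by
    refine map_mem_closure_span _ ?_
    rintro _ ⟨k, n, hn, rfl⟩
    rw [pairMap_toLp, expMul_expMul, expMul_expMul]
    exact h.mem_graphSpan_of_neg k (by omega)
  have hinv : ∀ (U V : CircL2) (n : ℤ), inner ℂ (expMul n U) (expMul (-1) V)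
      = inner ℂ (expMul (n + 1) U) V := fun U V n => by
    rw [inner_expMul_comm, expMul_expMul, inner_expMul_comm,
      show -n + -1 = -(n + 1) by ring]
  have hsub : h.graphSpan ≤ h.graphSpace := by
    refine h.graphSpan_le (Submodule.isClosed_orthogonal _) fun k n hn => ?_
    refine h.mem_graphSpace_of_ae_eq ?_ (h.mem_negSpace.mpr fun l m hm =>
      h.inner_col_dual l k (by omega))
    filter_upwards [coeFn_expMul n (unitVec k), coeFn_unitVec k, coeFn_expMul n (h.dual k),
      h.coeFn_dual k, h.apply_dual] with θ h1 h2 h3 h4 h5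
    rw [h1, h2, h3, h4, map_smul, h5]
  refine le_of_wandering_differences (pairMap (expMul (-1))) (Submodule.isClosed_orthogonal _)
    (Submodule.isClosed_topologicalClosure _) ?_ hshift hsub ?_ ?_
  · intro z hz
    obtain ⟨h1, h2⟩ := h.mem_graphSpace.mp hz
    refine h.mem_graphSpace.mpr ⟨fun k n => ?_, fun k n hn => ?_⟩
    · rw [pairMap_fst, pairMap_snd, hinv, hinv, h1]
    · rw [pairMap_snd, hinv, h2 k _ (by omega)]
  · intro z hz
    have hinv' : ∀ (U V : CircL2) (n : ℤ) (j : ℕ), inner ℂ (expMul n U) ((expMul (-1))^[j] V)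
        = inner ℂ (expMul (n + j) U) V := fun U V n j => by
      rw [iterate_expMul, ← inner_expMul_comm, expMul_expMul, add_comm]
    have h1 : z.fst = 0 := h.eq_zero_of_inner_col fun k n => by
      obtain ⟨y, hy, rfl⟩ := hz n.natAbs
      obtain ⟨h1, h2⟩ := h.mem_graphSpace.mp hy
      rw [iterate_pairMap_fst, hinv', ← h1, h2 k _ (by omega)]
    obtain ⟨y, hy, rfl⟩ := hz 0
    have h2 : ((pairMap (expMul (-1)))^[0] y).snd = 0 := by
      have h3 := h.ae_eq_of_mem_graphSpace hy
      change y.fst = 0 at h1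
      change y.snd = 0
      ext1
      filter_upwards [h3, Lp.coeFn_zero Seq2 2 circ] with θ h4 h5
      rw [h4, h1, h5]
      simp
    rw [← inner_self_eq_zero (𝕜 := ℂ), inner_pair, h1, h2, inner_zero_left, add_zero]
  · intro e he p hp hwe hwp horth
    obtain ⟨M₁, hM₁⟩ := exists_ae_norm_le_of_pair_wandering hwe
    obtain ⟨M₂, hM₂⟩ := exists_ae_norm_le_of_pair_wandering hwp
    set z := e - p with hz
    have hzX : z ∈ h.graphSpace := Submodule.sub_mem _ he (hsub hp)
    have hAz := h.ae_eq_of_mem_graphSpace hzX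
    have hbdd : ∀ᵐ θ ∂circ, ‖z.snd θ‖ ≤ M₁ + M₂ := by
      filter_upwards [hM₁, hM₂, Lp.coeFn_sub e.snd p.snd] with θ h1 h2 h3
      change ‖(e.snd - p.snd) θ‖ ≤ _
      rw [h3, Pi.sub_apply]
      exact (norm_sub_le _ _).trans (add_le_add h1.2 h2.2)
    -- The functional `u ↦ ⟨q + A (A q), u⟩` vanishes on `dualSpan`, which contains `q`.
    set y : CircL2 := (h.memLp_apply_of_bounded hbdd).toLp _ with hy
    have hyc : y =ᵐ[circ] fun θ => A θ (z.snd θ) := MemLp.coeFn_toLp _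
    have hq : z.fst ∈ h.negSpace := h.mem_negSpace.mpr fun k n hn => by
      rw [← (h.mem_graphSpace.mp hzX).1, (h.mem_graphSpace.mp hzX).2 k n hn]
    have hker : h.dualSpan ≤ (Submodule.span ℂ {z.fst + y})ᗮ := by
      refine h.dualSpan_le (Submodule.isClosed_orthogonal _) fun k n hn => ?_
      rw [mem_span_orthogonal_iff]
      rintro _ rfl
      rw [← inner_conj_symm, inner_add_right]
      have h1 := horth _ (h.mem_graphSpan_of_neg k hn)
      rw [inner_toLp_left] at h1
      have h2 : inner ℂ (expMul n (unitVec k)) z.snd = inner ℂ (expMul n (h.dual k)) y := by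
        rw [inner_expMul_left, inner_expMul_left]
        refine integral_congr_ae ?_
        filter_upwards [coeFn_unitVec k, h.coeFn_dual k, hyc, h.symm, h.apply_dual]
          with θ h1 h2 h3 h4 h5
        rw [h1, h2, h3, ← h4, h5]
      rw [← h2, h1, map_zero]
    have h0 := mem_span_orthogonal_iff.mp (hker (hle hq)) _ rfl
    have hyq : inner ℂ y z.fst = inner ℂ z.snd z.snd := by
      rw [L2.inner_def, L2.inner_def]
      refine integral_congr_ae ?_
      filter_upwards [hyc, hAz, h.symm] with θ h1 h2 h3
      rw [h1, h3, ← h2]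
    rw [inner_add_left, hyq] at h0
    have h3 : z = 0 := by
      rw [← inner_self_eq_zero (𝕜 := ℂ), inner_pair]
      exact h0
    exact sub_eq_zero.mp h3

/-- The pairing of `q` with itself through a function `ρ` with the same coefficients against the
dual system. For finite combinations of the dual functions this is immediate; the general case
needs `q` and `A q` to be approximated simultaneously, that is, in the graph norm of `A`. -/
theorem inner_self_eq_of_coefficients (hle : h.negSpace ≤ h.dualSpan) {q c ρ : CircL2}
    (hc : ∀ᵐ θ ∂circ, c θ = A θ (q θ)) (hq : q ∈ h.negSpace)
    (hρ : ∀ k (n : ℤ), n < 0 →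
      inner ℂ (expMul n (h.dual k)) q = inner ℂ (expMul n (unitVec k)) ρ) :
    inner ℂ q q = inner ℂ c ρ := by
  have h1 : h.graphSpan ≤
      (Submodule.span ℂ {(WithLp.toLp 2 (q, -ρ) : WithLp 2 (CircL2 × CircL2))})ᗮ := by
    refine h.graphSpan_le (Submodule.isClosed_orthogonal _) fun k n hn => ?_
    rw [mem_span_orthogonal_iff]
    rintro _ rfl
    rw [← inner_conj_symm, inner_toLp_left]
    change conj (inner ℂ (expMul n (h.dual k)) q + inner ℂ (expMul n (unitVec k)) (-ρ)) = 0
    rw [hρ k n hn, inner_neg_right, add_neg_cancel, map_zero]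
  have h2 := mem_span_orthogonal_iff.mp
    (h1 (h.graphSpace_le_graphSpan hle (h.mem_graphSpace_of_ae_eq hc hq))) _ rfl
  rw [← inner_conj_symm, inner_toLp_left] at h2
  change conj (inner ℂ q q + inner ℂ c (-ρ)) = 0 at h2
  rw [map_eq_zero, inner_neg_right, ← sub_eq_add_neg] at h2
  exact sub_eq_zero.mp h2

end IsDualPair

/-! ### Fourier series with coefficients in `ℓ²` -/

/-- The constant functions in `L²((-π, π]; ℓ²)`. -/
noncomputable def constVec : Seq2 →ₗ[ℂ] CircL2 where
  toFun x := (memLp_const x).toLp _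
  map_add' x y := MemLp.toLp_add (memLp_const x) (memLp_const y)
  map_smul' z x := MemLp.toLp_const_smul z (memLp_const x)

theorem coeFn_constVec (x : Seq2) : constVec x =ᵐ[circ] fun _ => x :=
  (memLp_const x).coeFn_toLp

theorem unitVec_eq (k : ℕ) : unitVec k = constVec (delta k) := rfl

theorem integral_circ_exp (n : ℤ) : ∫ θ : ℝ, Complex.exp (Complex.I * n * θ) ∂circ
    = if n = 0 then (2 * Real.pi : ℂ) else 0 := by
  rw [circ, ← intervalIntegral.integral_of_le (by linarith [Real.pi_pos])]
  split_ifs with hn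
  · subst hn
    simp
    ring
  · rw [integral_exp_mul_complex (by simp [hn])]
    rw [show Complex.I * n * ((Real.pi : ℝ) : ℂ) =
      Complex.I * n * ((-Real.pi : ℝ) : ℂ) + n * (2 * Real.pi * Complex.I) by push_cast; ring,
      Complex.exp_add, Complex.exp_int_mul_two_pi_mul_I, mul_one, sub_self, zero_div]

theorem inner_constVec (n m : ℤ) (x y : Seq2) :
    inner ℂ (expMul n (constVec x)) (expMul m (constVec y))
      = if n = m then 2 * Real.pi * inner ℂ x y else 0 := by
  have h : inner ℂ (expMul n (constVec x)) (expMul m (constVec y))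
      = ∫ θ : ℝ, Complex.exp (Complex.I * (m - n : ℤ) * θ) * inner ℂ x y ∂circ := by
    rw [inner_expMul_left]
    refine integral_congr_ae ?_
    filter_upwards [coeFn_constVec x, coeFn_expMul m (constVec y), coeFn_constVec y]
      with θ h1 h2 h3
    rw [h1, h2, h3, inner_smul_right, ← mul_assoc, ← Complex.exp_add]
    congr 2
    push_cast; ring
  rw [h, integral_mul_const, integral_circ_exp]
  by_cases hnm : n = m
  · simp [hnm]
  · rw [if_neg (sub_ne_zero.mpr (Ne.symm hnm)), if_neg hnm, zero_mul]

theorem inner_self_eq_ofReal {H : Type*} [NormedAddCommGroup H] [InnerProductSpace ℂ H] (x : H) :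
    inner ℂ x x = ((‖x‖ ^ 2 : ℝ) : ℂ) := by
  rw [inner_self_eq_norm_sq_to_K]
  push_cast
  rfl

/-- The isometry `x ↦ (2π)^{-1/2} e^{-i(l+1)θ} x`. -/
noncomputable def negFreq (l : ℕ) : Seq2 →ₗᵢ[ℂ] CircL2 where
  toLinearMap := (((√(2 * Real.pi))⁻¹ : ℝ) : ℂ) •
    ((expMul (-((l : ℤ) + 1))).toLinearMap.comp constVec)
  norm_map' x := by
    refine (sq_eq_sq₀ (norm_nonneg _) (norm_nonneg _)).mp ?_
    change ‖(((√(2 * Real.pi))⁻¹ : ℝ) : ℂ) • expMul (-((l : ℤ) + 1)) (constVec x)‖ ^ 2 = _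
    have h := inner_constVec (-((l : ℤ) + 1)) (-((l : ℤ) + 1)) x x
    rw [if_pos rfl, inner_self_eq_ofReal, inner_self_eq_ofReal] at h
    have h' : ‖expMul (-((l : ℤ) + 1)) (constVec x)‖ ^ 2 = 2 * Real.pi * ‖x‖ ^ 2 :=
      Complex.ofReal_injective (by rw [h]; push_cast; rfl)
    rw [norm_smul, mul_pow, h', Complex.norm_real, Real.norm_of_nonneg (by positivity), inv_pow,
      Real.sq_sqrt (by positivity)]
    have : (2 * Real.pi) ≠ 0 := by positivity
    field_simp

theorem negFreq_apply (l : ℕ) (x : Seq2) : negFreq l x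
    = (((√(2 * Real.pi))⁻¹ : ℝ) : ℂ) • expMul (-((l : ℤ) + 1)) (constVec x) := rfl

theorem sqrt_two_pi_smul_negFreq (l : ℕ) (x : Seq2) :
    ((√(2 * Real.pi) : ℝ) : ℂ) • negFreq l x = expMul (-((l : ℤ) + 1)) (constVec x) := by
  rw [negFreq_apply, smul_smul, ← Complex.ofReal_mul, mul_inv_cancel₀ (by positivity),
    Complex.ofReal_one, one_smul]

theorem orthogonalFamily_negFreq : OrthogonalFamily ℂ (fun _ : ℕ => Seq2) negFreq := by
  intro l m hlm x y
  rw [negFreq_apply, negFreq_apply, inner_smul_left, inner_smul_right, inner_constVec,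
    if_neg (by omega), mul_zero, mul_zero]

/-- The sum of the Fourier series `∑ e^{-i(l+1)θ} c_l`. -/
noncomputable def negSeries (c : VecSeq2) : CircL2 :=
  ((√(2 * Real.pi) : ℝ) : ℂ) • orthogonalFamily_negFreq.linearIsometry c

theorem hasSum_negSeries (c : VecSeq2) :
    HasSum (fun l : ℕ => expMul (-((l : ℤ) + 1)) (constVec (c l))) (negSeries c) := by
  have := (orthogonalFamily_negFreq.hasSum_linearIsometry c).const_smul ((√(2 * Real.pi) : ℝ) : ℂ)
  exact this.congr_fun (fun l => (sqrt_two_pi_smul_negFreq l (c l)).symm)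

theorem inner_negSeries (c c' : VecSeq2) :
    inner ℂ (negSeries c) (negSeries c') = 2 * Real.pi * inner ℂ c c' := by
  rw [negSeries, negSeries, inner_smul_left, inner_smul_right, LinearIsometry.inner_map_map,
    Complex.conj_ofReal, ← mul_assoc, ← Complex.ofReal_mul, Real.mul_self_sqrt (by positivity)]
  push_cast
  rfl

theorem inner_constVec_negSeries (n : ℤ) (x : Seq2) (c : VecSeq2) :
    HasSum (fun l : ℕ => if n = -((l : ℤ) + 1) then 2 * Real.pi * inner ℂ x (c l) else 0)
      (inner ℂ (expMul n (constVec x)) (negSeries c)) := by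
  have := (hasSum_negSeries c).mapL (innerSL ℂ (expMul n (constVec x)))
  simpa only [innerSL_apply_apply, inner_constVec] using this

theorem inner_constVec_negSeries_of_nonneg {n : ℤ} (hn : 0 ≤ n) (x : Seq2) (c : VecSeq2) :
    inner ℂ (expMul n (constVec x)) (negSeries c) = 0 := by
  refine (inner_constVec_negSeries n x c).unique ?_
  convert (hasSum_zero : HasSum (fun _ : ℕ => (0 : ℂ)) 0) using 2 with l
  rw [if_neg (by omega)]

theorem inner_constVec_negSeries_neg (l : ℕ) (x : Seq2) (c : VecSeq2) :
    inner ℂ (expMul (-((l : ℤ) + 1)) (constVec x)) (negSeries c)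
      = 2 * Real.pi * inner ℂ x (c l) := by
  refine (inner_constVec_negSeries _ x c).unique ?_
  convert hasSum_ite_eq l (2 * Real.pi * inner ℂ x (c l)) using 2 with m
  by_cases h : m = l
  · subst h; simp
  · rw [if_neg h, if_neg (by omega)]

/-- A function without nonnegative frequencies is the sum of its Fourier series. -/
theorem exists_negSeries_eq {U : CircL2}
    (h : ∀ k (n : ℤ), 0 ≤ n → inner ℂ (expMul n (unitVec k)) U = 0) :
    ∃ c : VecSeq2, negSeries c = U := by
  set V := orthogonalFamily_negFreq.linearIsometry with hV
  set R : Submodule ℂ CircL2 := LinearMap.range V.toLinearMap with hR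
  have : CompleteSpace R := by
    have hc : IsComplete (Set.range V) := V.isometry.isUniformInducing.isComplete_range
    exact IsComplete.completeSpace_coe (s := (R : Set CircL2)) hc
  obtain ⟨c, hc⟩ : R.starProjection U ∈ R := R.starProjection_apply_mem U
  set s : ℂ := ((√(2 * Real.pi) : ℝ) : ℂ) with hs
  have hs0 : s ≠ 0 := by
    rw [hs]; exact_mod_cast (Real.sqrt_pos.mpr Real.two_pi_pos).ne'
  have hneg : negSeries (s⁻¹ • c) = R.starProjection U := by
    rw [negSeries, map_smul, smul_smul, mul_inv_cancel₀ hs0, one_smul]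
    exact hc
  have horth := R.sub_starProjection_mem_orthogonal U
  have hz : ∀ k n, inner ℂ (expMul n (unitVec k)) (U - R.starProjection U) = 0 := by
    intro k n
    rcases le_or_gt 0 n with hn | hn
    · rw [inner_sub_right, h k n hn, ← hneg, unitVec_eq, inner_constVec_negSeries_of_nonneg hn,
        sub_zero]
    · obtain ⟨l, rfl⟩ : ∃ l : ℕ, n = -((l : ℤ) + 1) := ⟨(-n - 1).toNat, by omega⟩
      refine (Submodule.mem_orthogonal _ _).mp horth _ ?_
      rw [unitVec_eq, ← sqrt_two_pi_smul_negFreq]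
      refine R.smul_mem _ ⟨lp.single 2 l (delta k), ?_⟩
      exact orthogonalFamily_negFreq.linearIsometry_apply_single _
  have h0 : U - R.starProjection U = 0 := by
    have h1 : ∀ᵐ θ ∂circ, ∀ k, inner ℂ (unitVec k θ) ((U - R.starProjection U) θ) = 0 :=
      ae_all_iff.mpr fun k => ae_inner_eq_zero fun n => hz k n
    have h2 : ∀ᵐ θ ∂circ, ∀ k, unitVec k θ = delta k := ae_all_iff.mpr coeFn_unitVec
    ext1
    filter_upwards [h1, h2, Lp.coeFn_zero Seq2 2 circ] with θ h1 h2 h3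
    rw [h3]
    refine ext_delta fun k => ?_
    rw [← h2, h1]
    exact (inner_zero_right _).symm
  exact ⟨_, hneg.trans (sub_eq_zero.mp h0).symm⟩

theorem memLp_star {C : ℝ → Seq2} (hC : MemLp C 2 circ) : MemLp (fun θ => star (C θ)) 2 circ :=
  hC.star

/-- `C` is the sum of `∑ c_j e^{iθ(j+1)}` if and only if `C̄` is the sum of
`∑ e^{-iθ(j+1)} c̄_j`. -/
theorem isSeriesSum_iff {c : VecSeq2} {C : ℝ → Seq2} (hC : MemLp C 2 circ) :
    IsSeriesSum c C ↔ (memLp_star hC).toLp _ = negSeries (star c) := by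
  set U : CircL2 := (memLp_star hC).toLp _ with hU
  have hpart : ∀ N : ℕ, eLpNorm (fun θ =>
      C θ - ∑ j ∈ Finset.range N, Complex.exp (Complex.I * θ * ((j : ℂ) + 1)) • c j) 2 circ
      = ‖U - ∑ j ∈ Finset.range N, expMul (-((j : ℤ) + 1)) (constVec ((star c) j))‖ₑ := by
    intro N
    rw [Lp.enorm_def]
    refine eLpNorm_congr_enorm_ae ?_
    have h1 : ∀ᵐ θ ∂circ, ∀ j : ℕ, expMul (-((j : ℤ) + 1)) (constVec ((star c) j)) θ
        = star (Complex.exp (Complex.I * θ * ((j : ℂ) + 1)) • c j) := by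
      refine ae_all_iff.mpr fun j => ?_
      filter_upwards [coeFn_expMul (-((j : ℤ) + 1)) (constVec ((star c) j)),
        coeFn_constVec ((star c) j)] with θ h1 h2
      rw [h1, h2, star_smul, Complex.star_def, ← Complex.exp_conj]
      congr 2
      simp
      ring
    have h3 : ∀ᵐ θ ∂circ, (∑ j ∈ Finset.range N, expMul (-((j : ℤ) + 1))
        (constVec ((star c) j)) : CircL2) θ
        = ∑ j ∈ Finset.range N, expMul (-((j : ℤ) + 1)) (constVec ((star c) j)) θ := by
      filter_upwards [Lp.coeFn_finsetSum (Finset.range N)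
        fun j : ℕ => expMul (-((j : ℤ) + 1)) (constVec ((star c) j))] with θ h
      rw [h, Finset.sum_apply]
    filter_upwards [h1, h3, Lp.coeFn_sub U (∑ j ∈ Finset.range N, expMul (-((j : ℤ) + 1))
      (constVec ((star c) j))), (memLp_star hC).coeFn_toLp] with θ h1 h3 h4 h5
    rw [h4, Pi.sub_apply, h3, hU, h5, Finset.sum_congr rfl fun j _ => h1 j, ← star_sum,
      ← star_sub, enorm_eq_nnnorm, enorm_eq_nnnorm, nnnorm_star]
  have hsum := (hasSum_negSeries (star c)).tendsto_sum_nat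
  rw [IsSeriesSum, and_iff_right hC]
  simp only [hpart]
  have key : Tendsto (fun N => ‖U - ∑ j ∈ Finset.range N, expMul (-((j : ℤ) + 1))
      (constVec ((star c) j))‖ₑ) atTop (𝓝 0) ↔ Tendsto (fun N : ℕ => ∑ j ∈ Finset.range N,
        expMul (-((j : ℤ) + 1)) (constVec ((star c) j))) atTop (𝓝 U) := by
    rw [tendsto_iff_edist_tendsto_0]
    simp only [edist_comm _ U, edist_eq_enorm_sub]
  rw [key]
  exact ⟨fun h => tendsto_nhds_unique h hsum, fun h => h ▸ hsum⟩

/-! ### The whitened model -/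

section ContractionMul

variable {M : ℝ → Seq2 →L[ℂ] Seq2}
  (hm : ∀ v : ℝ → Seq2, AEStronglyMeasurable v circ →
    AEStronglyMeasurable (fun θ => M θ (v θ)) circ)
  (hb : ∀ᵐ θ ∂circ, ∀ x, ‖M θ x‖ ≤ ‖x‖)
include hm hb

theorem memLp_contraction_apply (U : CircL2) : MemLp (fun θ => M θ (U θ)) 2 circ := by
  refine (Lp.memLp U).of_le (hm _ (Lp.memLp U).1) ?_
  filter_upwards [hb] with θ h using h _

/-- Multiplication by a field of contractions. -/
noncomputable def contractionMul : CircL2 →L[ℂ] CircL2 :=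
  LinearMap.mkContinuous
    { toFun := fun U => (memLp_contraction_apply hm hb U).toLp _
      map_add' := fun U V => by
        ext1
        filter_upwards [(memLp_contraction_apply hm hb (U + V)).coeFn_toLp,
          Lp.coeFn_add ((memLp_contraction_apply hm hb U).toLp _)
            ((memLp_contraction_apply hm hb V).toLp _),
          (memLp_contraction_apply hm hb U).coeFn_toLp,
          (memLp_contraction_apply hm hb V).coeFn_toLp, Lp.coeFn_add U V] with θ h1 h2 h3 h4 h5
        rw [h1, h2, Pi.add_apply, h3, h4, h5, Pi.add_apply, map_add]
      map_smul' := fun z U => by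
        ext1
        filter_upwards [(memLp_contraction_apply hm hb (z • U)).coeFn_toLp,
          Lp.coeFn_smul z ((memLp_contraction_apply hm hb U).toLp _),
          (memLp_contraction_apply hm hb U).coeFn_toLp, Lp.coeFn_smul z U] with θ h1 h2 h3 h5
        rw [h1, RingHom.id_apply, h2, Pi.smul_apply, h3, h5, Pi.smul_apply, map_smul] } 1
    fun U => by
      rw [one_mul]
      change ‖(memLp_contraction_apply hm hb U).toLp _‖ ≤ ‖U‖
      refine Lp.norm_le_norm_of_ae_le ?_
      filter_upwards [(memLp_contraction_apply hm hb U).coeFn_toLp, hb] with θ h1 h2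
      rw [h1]
      exact h2 _

theorem coeFn_contractionMul (U : CircL2) :
    contractionMul hm hb U =ᵐ[circ] fun θ => M θ (U θ) :=
  (memLp_contraction_apply hm hb U).coeFn_toLp

end ContractionMul

/-- The operator `(w (f + g))^{1/2}`. -/
noncomputable def specRoot (d τ : ℕ) (f g : ℝ → Seq2 →L[ℂ] Seq2) (θ : ℝ) : Seq2 →L[ℂ] Seq2 :=
  ((√(weight d τ θ) : ℝ) : ℂ) • opSqrt (f θ + g θ)

/-- The vector `(w (f + g))^{-1/2} ȳ`. -/
noncomputable def whitened (d τ : ℕ) (f g : ℝ → Seq2 →L[ℂ] Seq2) (y : ℝ → Seq2) (θ : ℝ) : Seq2 :=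
  (((√(weight d τ θ))⁻¹ : ℝ) : ℂ) • invSqrt (f θ + g θ) (star (y θ))

/-- The analytic content of the hypotheses on a pair of spectral densities `f`, `g`: strong
measurability, integrability of the trace of `w (f + g)` and the minimality condition. -/
structure IsMinimalPair (d τ : ℕ) (f g : ℝ → Seq2 →L[ℂ] Seq2) : Prop where
  weight_pos : ∀ᵐ θ ∂circ, 0 < weight d τ θ
  pos_left : ∀ᵐ θ ∂circ, (f θ).IsPositive
  pos_right : ∀ᵐ θ ∂circ, (g θ).IsPositive
  meas_left : AEStronglyMeasurable f circ
  meas_right : AEStronglyMeasurable g circ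
  dom : ∀ᵐ θ ∂circ, ∀ k, InFormDomain (f θ + g θ) (delta k)
  summable : Summable fun k => ∫ θ, ‖specRoot d τ f g θ (delta k)‖ ^ 2 ∂circ
  memLp_root : MemLp (specRoot d τ f g) 2 circ
  memLp_dual : ∀ k, MemLp (whitened d τ f g fun _ => delta k) 2 circ

section Construct

variable {d τ : ℕ} {f g : ℝ → Seq2 →L[ℂ] Seq2}

theorem specRoot_apply (θ : ℝ) (x : Seq2) : specRoot d τ f g θ x
    = ((√(weight d τ θ) : ℝ) : ℂ) • opSqrt (f θ + g θ) x := rfl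

theorem norm_specRoot_apply_sq (θ : ℝ) (x : Seq2) : ‖specRoot d τ f g θ x‖ ^ 2
    = weight d τ θ * ‖opSqrt (f θ + g θ) x‖ ^ 2 := by
  rw [specRoot_apply, norm_smul, mul_pow, Complex.norm_real,
    Real.norm_of_nonneg (Real.sqrt_nonneg _), Real.sq_sqrt (weight_nonneg _ _ _)]

theorem norm_whitened_sq (y : ℝ → Seq2) (θ : ℝ) : ‖whitened d τ f g y θ‖ ^ 2
    = (weight d τ θ)⁻¹ * ‖invSqrt (f θ + g θ) (star (y θ))‖ ^ 2 := by
  rw [whitened, norm_smul, mul_pow, Complex.norm_real, Real.norm_of_nonneg (by positivity), inv_pow,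
    Real.sq_sqrt (weight_nonneg _ _ _)]

theorem ae_injective_of_dom (h : ∀ᵐ θ ∂circ, ∀ k, InFormDomain (f θ + g θ) (delta k)) :
    ∀ᵐ θ ∂circ, ∀ z, opSqrt (f θ + g θ) z = 0 → z = 0 := by
  filter_upwards [h] with θ h1 using opSqrt_eq_zero h1

theorem aestronglyMeasurable_whitened (hf : ∀ᵐ θ ∂circ, (f θ).IsPositive)
    (hg : ∀ᵐ θ ∂circ, (g θ).IsPositive) (hfm : AEStronglyMeasurable f circ)
    (hgm : AEStronglyMeasurable g circ)
    (hdom : ∀ᵐ θ ∂circ, ∀ k, InFormDomain (f θ + g θ) (delta k)) {y : ℝ → Seq2}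
    (hy : AEStronglyMeasurable y circ) (hd : ∀ᵐ θ ∂circ, InFormDomain (f θ + g θ) (star (y θ))) :
    AEStronglyMeasurable (whitened d τ f g y) circ := by
  have h1 : AEStronglyMeasurable (fun θ => (((√(weight d τ θ))⁻¹ : ℝ) : ℂ)) circ :=
    (Complex.measurable_ofReal.comp (measurable_weight d τ).sqrt.inv).aestronglyMeasurable
  refine h1.smul ?_
  refine aestronglyMeasurable_invSqrt (F := fun θ => f θ + g θ) (hfm.add hgm) ?_
    (ae_injective_of_dom hdom) (continuous_star.comp_aestronglyMeasurable hy) hd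
  filter_upwards [hf, hg] with θ h1 h2 using h1.add h2

theorem memLp_two_of_lintegral {v : ℝ → Seq2} (hv : AEStronglyMeasurable v circ)
    (h : ∫⁻ θ, ENNReal.ofReal (‖v θ‖ ^ 2) ∂circ < ⊤) : MemLp v 2 circ := by
  rw [memLp_two_iff_integrable_sq_norm hv]
  refine ⟨(hv.norm.pow 2), ?_⟩
  rw [hasFiniteIntegral_iff_ofReal]
  · exact h
  · exact Eventually.of_forall fun θ => by positivity

theorem formP_eq (U V : ℝ → Seq2) : formP d τ f g U V = (1 / (2 * Real.pi) : ℂ) *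
    ∫ θ, inner ℂ (whitened d τ f g U θ) (whitened d τ f g V θ) ∂circ := by
  rw [formP]
  congr 2
  ext θ
  rw [whitened, whitened, inner_smul_left, inner_smul_right, Complex.conj_ofReal, invForm,
    ← mul_assoc, ← Complex.ofReal_mul, ← mul_inv, Real.mul_self_sqrt (weight_nonneg _ _ _)]

theorem whitened_expVec (l k : ℕ) (θ : ℝ) : whitened d τ f g (expVec l k) θ
    = Complex.exp (Complex.I * (-((l : ℤ) + 1) : ℤ) * θ)
      • whitened d τ f g (fun _ => delta k) θ := by
  rw [whitened, whitened, expVec, star_smul, invSqrt_smul _ (star_ne_zero.mpr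
    (Complex.exp_ne_zero _)), smul_comm, star_delta, Complex.star_def, ← Complex.exp_conj]
  congr 2
  simp
  ring

theorem star_rowMul {F : Seq2 →L[ℂ] Seq2} (hF : F.IsPositive) (x : Seq2) :
    star (rowMul x F) = F (star x) := by
  rw [rowMul, star_star, hF.isSelfAdjoint.adjoint_eq]

theorem isMinimalPair {Ω : Type*} [MeasurableSpace Ω] {P : Measure Ω} (hτ : 0 < τ)
    {X Y : ℕ → ℤ → Lp ℂ 2 P} (hf : IsSpectralDensity d τ X f) (hg : IsSpectralDensity d τ Y g)
    (hmin : Minimality d τ fun θ => f θ + g θ) : IsMinimalPair d τ f g := by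
  have hdom : ∀ᵐ θ ∂circ, ∀ k, InFormDomain (f θ + g θ) (delta k) :=
    ae_all_iff.mpr fun k => (hmin k).1
  have hw := ae_weight_pos hτ d
  have hFpos : ∀ᵐ θ ∂circ, (f θ + g θ).IsPositive := by
    filter_upwards [hf.pos, hg.pos] with θ h1 h2 using h1.add h2
  have hroot : AEStronglyMeasurable (specRoot d τ f g) circ := by
    have h1 : AEStronglyMeasurable (fun θ => ((√(weight d τ θ) : ℝ) : ℂ)) circ :=
      (Complex.measurable_ofReal.comp (measurable_weight d τ).sqrt).aestronglyMeasurable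
    exact h1.smul (aestronglyMeasurable_opSqrt (F := fun θ => f θ + g θ)
      ((hf.aestronglyMeasurable hτ).add (hg.aestronglyMeasurable hτ)) hFpos)
  refine ⟨hw, hf.pos, hg.pos, hf.aestronglyMeasurable hτ, hg.aestronglyMeasurable hτ, hdom, ?_, ?_,
    fun k => ?_⟩
  · refine (hf.trace.add hg.trace).congr fun k => ?_
    rw [← integral_add (hf.diag_integrable k) (hg.diag_integrable k)]
    refine integral_congr_ae ?_
    filter_upwards [hFpos] with θ h
    rw [norm_specRoot_apply_sq, norm_opSqrt_delta_sq h, _root_.add_apply, lp.coeFn_add,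
      Pi.add_apply, Complex.add_re, mul_add]
  · have h1 : Integrable (fun θ => ‖specRoot d τ f g θ‖ ^ 2) circ := by
      refine (hf.ae_weighted_summable.2.add hg.ae_weighted_summable.2).mono'
        (hroot.norm.pow 2) ?_
      filter_upwards [hFpos, hf.ae_summable hτ, hg.ae_summable hτ] with θ h1 h2 h3
      rw [Real.norm_of_nonneg (by positivity), Pi.add_apply, tsum_mul_left, tsum_mul_left, ← mul_add,
        ← h2.tsum_add h3]
      have h4 : ∀ k, ((f θ (delta k)) k).re + ((g θ (delta k)) k).re
          = (((f θ + g θ) (delta k)) k).re := fun k => by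
        rw [_root_.add_apply, lp.coeFn_add, Pi.add_apply, Complex.add_re]
      simp only [h4]
      have h5 : Summable fun k => (((f θ + g θ) (delta k)) k).re := by
        simpa only [h4] using h2.add h3
      rw [specRoot, norm_smul, mul_pow, Complex.norm_real,
        Real.norm_of_nonneg (Real.sqrt_nonneg _), Real.sq_sqrt (weight_nonneg _ _ _)]
      exact mul_le_mul_of_nonneg_left (norm_opSqrt_sq_le_trace h1 h5) (weight_nonneg _ _ _)
    exact (memLp_two_iff_integrable_sq_norm hroot).mpr h1
  · refine memLp_two_of_lintegral (aestronglyMeasurable_whitened hf.pos hg.pos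
      (hf.aestronglyMeasurable hτ) (hg.aestronglyMeasurable hτ) hdom
      aestronglyMeasurable_const ?_) ?_
    · filter_upwards [hdom] with θ h
      rw [star_delta]
      exact h k
    · simp only [norm_whitened_sq, star_delta]
      exact (hmin k).2

end Construct

namespace IsMinimalPair

variable {d τ : ℕ} {f g : ℝ → Seq2 →L[ℂ] Seq2} (hm : IsMinimalPair d τ f g)
include hm

theorem ae_inj : ∀ᵐ θ ∂circ, ∀ z, opSqrt (f θ + g θ) z = 0 → z = 0 := ae_injective_of_dom hm.dom

theorem specRoot_whitened {y : ℝ → Seq2}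
    (hd : ∀ᵐ θ ∂circ, InFormDomain (f θ + g θ) (star (y θ))) :
    ∀ᵐ θ ∂circ, specRoot d τ f g θ (whitened d τ f g y θ) = star (y θ) := by
  filter_upwards [hd, hm.ae_inj, hm.weight_pos] with θ h1 h2 h3
  rw [specRoot_apply, whitened, map_smul, opSqrt_invSqrt h2 h1, smul_smul, ← Complex.ofReal_mul,
    mul_inv_cancel₀ (Real.sqrt_pos.mpr h3).ne', Complex.ofReal_one, one_smul]

/-- `(w (f + g))^{1/2}` and the vectors `(w (f + g))^{-1/2} δ_k` form a dual pair. -/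
theorem isDualPair : IsDualPair (specRoot d τ f g) fun k => whitened d τ f g fun _ => delta k where
  memLp := hm.memLp_root
  symm := by
    refine Eventually.of_forall fun θ x y => ?_
    rw [specRoot_apply, specRoot_apply, inner_smul_left, inner_smul_right, inner_opSqrt,
      Complex.conj_ofReal]
  memLp_dual := hm.memLp_dual
  apply_dual := by
    refine ae_all_iff.mpr fun k => ?_
    have := hm.specRoot_whitened (y := fun _ => delta k) (by
      filter_upwards [hm.dom] with θ h
      rw [star_delta]
      exact h k)
    filter_upwards [this] with θ h
    rw [h, star_delta]

/-- Multiplication by `(f + g)^{-1/2} f (f + g)^{-1/2}`. -/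
noncomputable def kap : CircL2 →L[ℂ] CircL2 :=
  contractionMul (M := fun θ => whiten (f θ + g θ) (f θ))
    (fun _ hv => aestronglyMeasurable_whiten hm.meas_left hm.meas_right hm.pos_left hm.pos_right
      hm.ae_inj hv)
    (by
      filter_upwards [hm.pos_left, hm.pos_right, hm.ae_inj] with θ h1 h2 h3 x
      exact norm_whiten_le h1 h2 h3 x)

theorem coeFn_kap (U : CircL2) :
    hm.kap U =ᵐ[circ] fun θ => whiten (f θ + g θ) (f θ) (U θ) :=
  coeFn_contractionMul _ _ U

theorem inner_kap (U V : CircL2) : inner ℂ (hm.kap U) V = inner ℂ U (hm.kap V) := by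
  rw [L2.inner_def, L2.inner_def]
  refine integral_congr_ae ?_
  filter_upwards [hm.coeFn_kap U, hm.coeFn_kap V, hm.pos_left, hm.pos_right, hm.ae_inj]
    with θ h1 h2 h3 h4 h5
  rw [h1, h2, inner_whiten h3 h4 h5]

/-- The functions `e^{inθ} (w (f + g))^{1/2} δ_k`. -/
noncomputable def colExp (k : ℕ) (n : ℤ) : CircL2 := expMul n (hm.isDualPair.col k)

/-- The functions `e^{inθ} (w (f + g))^{-1/2} δ_k`. -/
noncomputable def dualExp (k : ℕ) (n : ℤ) : CircL2 := expMul n (hm.isDualPair.dual k)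

theorem coeFn_colExp (k : ℕ) (n : ℤ) : hm.colExp k n =ᵐ[circ]
    fun θ => Complex.exp (Complex.I * n * θ) • specRoot d τ f g θ (delta k) := by
  filter_upwards [coeFn_expMul n (hm.isDualPair.col k), hm.isDualPair.coeFn_col k] with θ h1 h2
  rw [colExp, h1, h2]

theorem coeFn_dualExp (k : ℕ) (n : ℤ) : hm.dualExp k n =ᵐ[circ]
    fun θ => Complex.exp (Complex.I * n * θ) • whitened d τ f g (fun _ => delta k) θ := by
  filter_upwards [coeFn_expMul n (hm.isDualPair.dual k), hm.isDualPair.coeFn_dual k] with θ h1 h2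
  rw [dualExp, h1, h2]

theorem norm_colExp_sq (k : ℕ) (n : ℤ) :
    ‖hm.colExp k n‖ ^ 2 = ∫ θ, ‖specRoot d τ f g θ (delta k)‖ ^ 2 ∂circ := by
  refine Complex.ofReal_injective ?_
  rw [← inner_self_eq_ofReal, colExp, LinearIsometry.inner_map_map, L2.inner_def, ← integral_complex_ofReal]
  refine integral_congr_ae ?_
  filter_upwards [hm.isDualPair.coeFn_col k] with θ h1
  rw [h1, inner_self_eq_ofReal]

theorem summable_norm_colExp_sq : Summable fun k => ‖hm.colExp k 0‖ ^ 2 :=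
  hm.summable.congr fun k => (hm.norm_colExp_sq k 0).symm

theorem norm_colExp (k : ℕ) (n : ℤ) : ‖hm.colExp k n‖ = ‖hm.colExp k 0‖ := by
  rw [colExp, colExp, LinearIsometry.norm_map, LinearIsometry.norm_map]

theorem inner_colExp_kap (k n : ℕ) (l j : ℤ) :
    inner ℂ (hm.colExp k (-l)) (hm.kap (hm.colExp n (-j)))
      = ∫ θ, Complex.exp (Complex.I * ((l - j : ℤ) : ℂ) * θ)
        * ((weight d τ θ : ℂ) * (f θ (delta n)) k) ∂circ := by
  rw [L2.inner_def]
  refine integral_congr_ae ?_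
  filter_upwards [hm.coeFn_colExp k (-l), hm.coeFn_colExp n (-j),
    hm.coeFn_kap (hm.colExp n (-j)), hm.pos_left, hm.pos_right, hm.ae_inj]
    with θ h1 h2 h3 h4 h5 h6
  rw [h3, h1, h2, map_smul, inner_smul_left, inner_smul_right, specRoot_apply, specRoot_apply,
    map_smul, inner_smul_left, inner_smul_right, inner_opSqrt, opSqrt_whiten_opSqrt h4 h5 h6,
    inner_delta_left, conj_exp_I_mul, Complex.conj_ofReal]
  have e1 : Complex.exp (Complex.I * ((l - j : ℤ) : ℂ) * θ)
      = Complex.exp (Complex.I * ((-(-l) : ℤ) : ℂ) * θ)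
        * Complex.exp (Complex.I * ((-j : ℤ) : ℂ) * θ) := by
    rw [← Complex.exp_add]; congr 1; push_cast; ring
  have e2 : (weight d τ θ : ℂ) = ((√(weight d τ θ) : ℝ) : ℂ) * ((√(weight d τ θ) : ℝ) : ℂ) := by
    rw [← Complex.ofReal_mul, Real.mul_self_sqrt (weight_nonneg _ _ _)]
  rw [e1, e2]
  ring

theorem inner_colExp (k n : ℕ) (l j : ℤ) :
    inner ℂ (hm.colExp k (-l)) (hm.colExp n (-j))
      = ∫ θ, Complex.exp (Complex.I * ((l - j : ℤ) : ℂ) * θ)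
        * ((weight d τ θ : ℂ) * ((f θ + g θ) (delta n)) k) ∂circ := by
  rw [L2.inner_def]
  refine integral_congr_ae ?_
  filter_upwards [hm.coeFn_colExp k (-l), hm.coeFn_colExp n (-j), hm.pos_left, hm.pos_right]
    with θ h1 h2 h4 h5
  rw [h1, h2, inner_smul_left, inner_smul_right, specRoot_apply, specRoot_apply,
    inner_smul_left, inner_smul_right, inner_opSqrt, opSqrt_opSqrt (h4.add h5),
    inner_delta_left, conj_exp_I_mul, Complex.conj_ofReal]
  have e1 : Complex.exp (Complex.I * ((l - j : ℤ) : ℂ) * θ)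
      = Complex.exp (Complex.I * ((-(-l) : ℤ) : ℂ) * θ)
        * Complex.exp (Complex.I * ((-j : ℤ) : ℂ) * θ) := by
    rw [← Complex.exp_add]; congr 1; push_cast; ring
  have e2 : (weight d τ θ : ℂ) = ((√(weight d τ θ) : ℝ) : ℂ) * ((√(weight d τ θ) : ℝ) : ℂ) := by
    rw [← Complex.ofReal_mul, Real.mul_self_sqrt (weight_nonneg _ _ _)]
  rw [e1, e2]
  ring

/-! ### The operators `R`, `P`, `Q` in the whitened model -/

theorem memLp_whitened {U : ℝ → Seq2} (hU : AEStronglyMeasurable U circ)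
    (hfin : FiniteForm d τ f g U) : MemLp (whitened d τ f g U) 2 circ := by
  refine memLp_two_of_lintegral (aestronglyMeasurable_whitened hm.pos_left hm.pos_right
      hm.meas_left hm.meas_right hm.dom hU hfin.1) ?_
  simp only [norm_whitened_sq]
  exact hfin.2

theorem formP_expVec_right {U : ℝ → Seq2} {q : CircL2} (hq : q =ᵐ[circ] whitened d τ f g U)
    (l k : ℕ) : formP d τ f g U (expVec l k)
      = (1 / (2 * Real.pi) : ℂ) * inner ℂ q (hm.dualExp k (-((l : ℤ) + 1))) := by
  rw [formP_eq, L2.inner_def]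
  congr 1
  refine integral_congr_ae ?_
  filter_upwards [hq, hm.coeFn_dualExp k (-((l : ℤ) + 1))] with θ h1 h2
  rw [h1, h2, whitened_expVec]

theorem ae_invSqrt_rowMul_left : ∀ᵐ θ ∂circ, ∀ x, invSqrt (f θ + g θ) (star (rowMul x (f θ)))
    = whiten (f θ + g θ) (f θ) (opSqrt (f θ + g θ) (star x)) := by
  filter_upwards [hm.pos_left, hm.pos_right, hm.ae_inj] with θ h1 h2 h3 x
  rw [star_rowMul h1]
  exact invSqrt_eq_of_opSqrt h3 (opSqrt_whiten_opSqrt h1 h2 h3 _)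

theorem ae_invSqrt_rowMul_right : ∀ᵐ θ ∂circ, ∀ x, invSqrt (f θ + g θ) (star (rowMul x (g θ)))
    = opSqrt (f θ + g θ) (star x)
      - whiten (f θ + g θ) (f θ) (opSqrt (f θ + g θ) (star x)) := by
  filter_upwards [hm.pos_left, hm.pos_right, hm.ae_inj] with θ h1 h2 h3 x
  rw [star_rowMul h2]
  exact invSqrt_eq_of_opSqrt h3 (opSqrt_whiten_right_opSqrt h1 h2 h3 _)

theorem matR_eq (l j k n : ℕ) : matR f g l j k n = (1 / (2 * Real.pi) : ℂ) *
    inner ℂ (hm.kap (hm.colExp n j)) (hm.dualExp k (-(l : ℤ))) := by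
  rw [matR, L2.inner_def]
  congr 1
  refine integral_congr_ae ?_
  filter_upwards [hm.coeFn_kap (hm.colExp n j), hm.coeFn_colExp n j, hm.coeFn_dualExp k (-(l : ℤ)),
    hm.ae_invSqrt_rowMul_left, hm.weight_pos] with θ h1 h2 h3 h4 h5
  rw [h1, h2, h3, invForm, h4, star_delta, specRoot_apply, whitened, star_delta]
  simp only [map_smul, inner_smul_left, inner_smul_right, Complex.conj_ofReal, conj_exp_I_mul]
  have e1 : Complex.exp (-(Complex.I * θ * ((l : ℂ) + j)))
      = Complex.exp (Complex.I * ((-(j : ℤ) : ℤ) : ℂ) * θ)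
        * Complex.exp (Complex.I * ((-(l : ℤ) : ℤ) : ℂ) * θ) := by
    rw [← Complex.exp_add]; congr 1; push_cast; ring
  have e2 : ((√(weight d τ θ) : ℝ) : ℂ) * (((√(weight d τ θ))⁻¹ : ℝ) : ℂ) = 1 := by
    rw [← Complex.ofReal_mul, mul_inv_cancel₀ (Real.sqrt_pos.mpr h5).ne', Complex.ofReal_one]
  rw [e1]
  linear_combination (-(Complex.exp (Complex.I * ((-(j : ℤ) : ℤ) : ℂ) * θ)
        * Complex.exp (Complex.I * ((-(l : ℤ) : ℤ) : ℂ) * θ)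
        * inner ℂ (whiten (f θ + g θ) (f θ) (opSqrt (f θ + g θ) (delta n)))
          (invSqrt (f θ + g θ) (delta k)))) * e2

theorem matQ_eq (l j k n : ℕ) : matQ d τ f g l j k n = (1 / (2 * Real.pi) : ℂ) *
    inner ℂ (hm.kap (hm.colExp n j)) (hm.colExp k l - hm.kap (hm.colExp k l)) := by
  rw [matQ, L2.inner_def]
  congr 1
  refine integral_congr_ae ?_
  filter_upwards [hm.coeFn_kap (hm.colExp n j), hm.coeFn_colExp n j, hm.coeFn_colExp k l,
    hm.coeFn_kap (hm.colExp k l), Lp.coeFn_sub (hm.colExp k l) (hm.kap (hm.colExp k l)),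
    hm.ae_invSqrt_rowMul_left, hm.ae_invSqrt_rowMul_right] with θ h1 h2 h3 h6 h7 h4 h5
  rw [h1, h2, h7, Pi.sub_apply, h6, h3, invForm, h4, h5, star_delta, star_delta, specRoot_apply,
    specRoot_apply]
  simp only [map_smul, ← smul_sub, inner_smul_left, inner_smul_right, Complex.conj_ofReal,
    conj_exp_I_mul]
  have e1 : Complex.exp (Complex.I * θ * ((l : ℂ) - j))
      = Complex.exp (Complex.I * ((-(j : ℤ) : ℤ) : ℂ) * θ)
        * Complex.exp (Complex.I * ((l : ℤ) : ℂ) * θ) := by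
    rw [← Complex.exp_add]; congr 1; push_cast; ring
  have e2 : (weight d τ θ : ℂ) = ((√(weight d τ θ) : ℝ) : ℂ) * ((√(weight d τ θ) : ℝ) : ℂ) := by
    rw [← Complex.ofReal_mul, Real.mul_self_sqrt (weight_nonneg _ _ _)]
  rw [e1, e2]
  ring

end IsMinimalPair

/-! ### Summation of the functional -/

/-- Absolute summability of a double series `∑ b_j(n) x_{jn}` with `‖x_{jn}‖ ≤ s_n`, `s ∈ ℓ²`. -/
theorem summable_prod_norm_mul {b : ℕ → Seq2} (hb : Summable fun j => ‖b j‖) {s : ℕ → ℝ}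
    (hs : Summable fun n => s n ^ 2) (hs0 : ∀ n, 0 ≤ s n) :
    Summable fun p : ℕ × ℕ => ‖b p.1 p.2‖ * s p.2 := by
  have hfin : ∀ j (t : Finset ℕ), ∑ n ∈ t, ‖b j n‖ * s n ≤ ‖b j‖ * √(∑' n, s n ^ 2) := by
    intro j t
    refine le_of_sq_le_sq ?_ (by positivity)
    refine (Finset.sum_mul_sq_le_sq_mul_sq t _ _).trans ?_
    rw [mul_pow, Real.sq_sqrt (tsum_nonneg fun n => sq_nonneg _)]
    exact mul_le_mul (sum_norm_sq_apply_le _ t) (hs.sum_le_tsum t fun n _ => sq_nonneg _)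
      (Finset.sum_nonneg fun n _ => sq_nonneg _) (sq_nonneg _)
  have hsum : ∀ j, Summable fun n => ‖b j n‖ * s n := fun j =>
    summable_of_sum_le (fun n => mul_nonneg (norm_nonneg _) (hs0 n)) (hfin j)
  refine (summable_prod_of_nonneg fun p => mul_nonneg (norm_nonneg _) (hs0 _)).mpr ⟨hsum, ?_⟩
  refine Summable.of_nonneg_of_le (fun j => tsum_nonneg fun n =>
    mul_nonneg (norm_nonneg _) (hs0 n)) (fun j => ?_) (hb.mul_right (√(∑' n, s n ^ 2)))
  exact (hsum j).tsum_le_of_sum_le (hfin j)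

theorem hasSum_inner_left {ι H : Type*} [NormedAddCommGroup H] [InnerProductSpace ℂ H] {u : ι → H}
    {a : H} (h : HasSum u a) (y : H) : HasSum (fun i => inner ℂ (u i) y) (inner ℂ a y) := by
  have h1 := (h.mapL (innerSL ℂ y)).star
  simpa only [innerSL_apply_apply, RCLike.star_def, inner_conj_symm] using h1

namespace IsMinimalPair

variable {d τ : ℕ} {f g : ℝ → Seq2 →L[ℂ] Seq2} (hm : IsMinimalPair d τ f g)
include hm

/-- The operator `x ↦ (w (f + g))^{1/2} x` from `ℓ²` to `L²((-π, π]; ℓ²)`. -/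
noncomputable def colMap : Seq2 →L[ℂ] CircL2 :=
  LinearMap.mkContinuous
    { toFun := fun x => (hm.isDualPair.memLp_apply x).toLp _
      map_add' := fun x y => by
        rw [← MemLp.toLp_add]
        congr 1
        ext1 θ
        exact map_add _ _ _
      map_smul' := fun z x => by
        rw [RingHom.id_apply, ← MemLp.toLp_const_smul]
        congr 1
        ext1 θ
        exact map_smul _ _ _ } ‖hm.memLp_root.toLp _‖ fun x => by
    rw [mul_comm]
    refine Lp.norm_le_mul_norm_of_ae_le_mul ?_
    filter_upwards [(hm.isDualPair.memLp_apply x).coeFn_toLp, hm.memLp_root.coeFn_toLp]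
      with θ h1 h2
    rw [h2, mul_comm]
    erw [h1]
    exact ContinuousLinearMap.le_opNorm _ _

theorem coeFn_colMap (x : Seq2) : hm.colMap x =ᵐ[circ] fun θ => specRoot d τ f g θ x :=
  (hm.isDualPair.memLp_apply x).coeFn_toLp

theorem colMap_delta (k : ℕ) : hm.colMap (delta k) = hm.isDualPair.col k := rfl

/-- The function `(w (f + g))^{1/2} B̄`. -/
noncomputable def funcVec (b : ℕ → Seq2) : CircL2 :=
  ∑' j : ℕ, expMul (j : ℤ) (hm.colMap (star (b j)))

variable {b : ℕ → Seq2} (hb : Summable fun j => ‖b j‖)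
include hb

theorem summable_norm_funcVec :
    Summable fun j : ℕ => ‖expMul (j : ℤ) (hm.colMap (star (b j)))‖ := by
  refine Summable.of_nonneg_of_le (fun j => norm_nonneg _) (fun j => ?_)
    (hb.mul_left ‖hm.colMap‖)
  rw [LinearIsometry.norm_map]
  refine (hm.colMap.le_opNorm _).trans ?_
  rw [norm_star]

theorem coeFn_funcVec :
    hm.funcVec b =ᵐ[circ] fun θ => specRoot d τ f g θ (star (bFun b θ)) := by
  have h1 : ∀ᵐ θ ∂circ, HasSum (fun j : ℕ => expMul (j : ℤ) (hm.colMap (star (b j))) θ)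
      (hm.funcVec b θ) := by
    refine Lp.hasSum_coeFn_tsum ?_
    exact tsum_enorm_ne_top_iff_summable_norm.mpr (hm.summable_norm_funcVec hb)
  have h2 : ∀ᵐ θ ∂circ, ∀ j : ℕ, expMul (j : ℤ) (hm.colMap (star (b j))) θ
      = specRoot d τ f g θ (star (Complex.exp (-(Complex.I * θ * j)) • b j)) := by
    refine ae_all_iff.mpr fun j => ?_
    filter_upwards [coeFn_expMul (j : ℤ) (hm.colMap (star (b j))), hm.coeFn_colMap (star (b j))]
      with θ h1 h2
    rw [h1, h2, star_smul, map_smul, Complex.star_def, ← Complex.exp_conj]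
    congr 2
    simp
    ring
  filter_upwards [h1, h2] with θ h1 h2
  have h3 : Summable fun j : ℕ => Complex.exp (-(Complex.I * θ * j)) • b j := by
    refine Summable.of_norm (hb.congr fun j => ?_)
    rw [norm_smul, show -(Complex.I * θ * j) = ((-(θ * j) : ℝ) : ℂ) * Complex.I by push_cast; ring,
      Complex.norm_exp_ofReal_mul_I, one_mul]
  have h4 := h3.hasSum.star.mapL (specRoot d τ f g θ)
  refine h1.unique ?_
  unfold bFun
  simpa only [h2] using h4

/-- The coordinate expansion of `(w (f + g))^{1/2} B̄`. -/
theorem hasSum_funcVec : HasSum (fun p : ℕ × ℕ => conj (b p.1 p.2) • hm.colExp p.2 (p.1 : ℤ))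
    (hm.funcVec b) := by
  have hs : Summable fun p : ℕ × ℕ => conj (b p.1 p.2) • hm.colExp p.2 (p.1 : ℤ) := by
    refine Summable.of_norm ((summable_prod_norm_mul hb hm.summable_norm_colExp_sq
      fun n => norm_nonneg _).congr fun p => ?_)
    rw [norm_smul, hm.norm_colExp p.2 (p.1 : ℤ), RCLike.norm_conj]
  have hfib : ∀ j : ℕ, HasSum (fun n => conj (b j n) • hm.colExp n (j : ℤ))
      (expMul (j : ℤ) (hm.colMap (star (b j)))) := fun j => by
    have := ((hasSum_delta (star (b j))).mapL hm.colMap).mapL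
      (expMul (j : ℤ)).toContinuousLinearMap
    refine this.congr_fun fun n => ?_
    rw [map_smul, map_smul, hm.colMap_delta]
    rfl
  have h1 := hs.hasSum.prod_fiberwise hfib
  rw [funcVec, h1.tsum_eq]
  exact hs.hasSum

theorem hasSum_inner_kap_funcVec (y : CircL2) :
    HasSum (fun p : ℕ × ℕ => inner ℂ (hm.kap (hm.colExp p.2 (p.1 : ℤ))) y * b p.1 p.2)
      (inner ℂ (hm.kap (hm.funcVec b)) y) := by
  have := hasSum_inner_left ((hm.hasSum_funcVec hb).mapL hm.kap) y
  refine this.congr_fun fun p => ?_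
  rw [map_smul, inner_smul_left, RCLike.conj_conj, mul_comm]

theorem isRImage_eq {r : VecSeq2} (hr : IsRImage f g b r) (l k : ℕ) :
    r l k = (1 / (2 * Real.pi) : ℂ) *
      inner ℂ (hm.kap (hm.funcVec b)) (hm.dualExp k (-((l : ℤ) + 1))) := by
  refine (hr l k).unique (((hm.hasSum_inner_kap_funcVec hb _).mul_left _).congr_fun fun p => ?_)
  rw [hm.matR_eq, mul_assoc]
  push_cast
  rfl

theorem isQImage_funcVec : IsQImage d τ f g b fun l k => (1 / (2 * Real.pi) : ℂ) *
    inner ℂ (hm.kap (hm.funcVec b)) (hm.colExp k l - hm.kap (hm.colExp k l)) := by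
  intro l k
  refine ((hm.hasSum_inner_kap_funcVec hb _).mul_left _).congr_fun fun p => ?_
  rw [hm.matQ_eq, mul_assoc]

theorem hasSum_Q_pairing : HasSum (fun p : ℕ × ℕ => ((1 / (2 * Real.pi) : ℂ) *
      inner ℂ (hm.kap (hm.funcVec b)) (hm.colExp p.2 p.1 - hm.kap (hm.colExp p.2 p.1)))
        * star (b p.1 p.2))
    ((1 / (2 * Real.pi) : ℂ) *
      inner ℂ (hm.kap (hm.funcVec b)) (hm.funcVec b - hm.kap (hm.funcVec b))) := by
  have h1 := hm.hasSum_funcVec hb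
  have h2 := (h1.sub (h1.mapL hm.kap)).mapL (innerSL ℂ (hm.kap (hm.funcVec b)))
  refine (h2.mul_left (1 / (2 * Real.pi) : ℂ)).congr_fun fun p => ?_
  rw [map_smul, ← smul_sub, map_smul, innerSL_apply_apply, smul_eq_mul, RCLike.star_def]
  ring

end IsMinimalPair

/-! ### The spectral characteristic and the error densities -/

theorem norm_sq_eq_integral (U : CircL2) : ‖U‖ ^ 2 = ∫ θ, ‖U θ‖ ^ 2 ∂circ := by
  refine Complex.ofReal_injective ?_
  rw [← inner_self_eq_ofReal, L2.inner_def, ← integral_complex_ofReal]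
  exact integral_congr_ae (Eventually.of_forall fun θ => inner_self_eq_ofReal _)

theorem IsSeriesSum.ae_eq {c : VecSeq2} {C C' : ℝ → Seq2} (hC : IsSeriesSum c C)
    (hC' : IsSeriesSum c C') : C =ᵐ[circ] C' := by
  have h := ((isSeriesSum_iff hC.1).mp hC).trans ((isSeriesSum_iff hC'.1).mp hC').symm
  rw [MemLp.toLp_eq_toLp_iff] at h
  filter_upwards [h] with θ h1 using star_injective h1

theorem FiniteForm.congr {d τ : ℕ} {f g : ℝ → Seq2 →L[ℂ] Seq2} {C C' : ℝ → Seq2}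
    (hC : FiniteForm d τ f g C) (h : C =ᵐ[circ] C') : FiniteForm d τ f g C' := by
  refine ⟨?_, ?_⟩
  · filter_upwards [hC.1, h] with θ h1 h2
    rwa [← h2]
  · refine lt_of_eq_of_lt (lintegral_congr_ae ?_) hC.2
    filter_upwards [h] with θ h1
    rw [h1]

theorem norm_transfer_sq (d τ : ℕ) (θ : ℝ) : ‖transfer d τ θ‖ ^ 2 = weight d τ θ := by
  have h1 : ‖1 - Complex.exp (-(Complex.I * θ * τ))‖ = ‖1 - Complex.exp (Complex.I * θ * τ)‖ := by
    rw [← Complex.norm_conj (1 - Complex.exp (Complex.I * θ * τ)), map_sub, map_one,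
      ← Complex.exp_conj]
    congr 3
    simp
  rw [transfer, weight, norm_div, norm_pow, norm_pow, div_pow, h1, norm_mul, Complex.norm_I,
    one_mul, Complex.norm_real, ← pow_mul, ← pow_mul, mul_comm d 2]
  congr 1
  rw [Real.norm_eq_abs, pow_mul, sq_abs, ← pow_mul]

theorem conj_transfer_mul (d τ : ℕ) (θ : ℝ) :
    conj (transfer d τ θ) * transfer d τ θ = (weight d τ θ : ℂ) := by
  rw [mul_comm, Complex.mul_conj, Complex.normSq_eq_norm_sq, norm_transfer_sq]

/-- The coefficient `(-iθ)^d / (1 - e^{iθτ})^d` is the inverse of the conjugate of `transfer`. -/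
theorem conj_coefficient (d τ : ℕ) (θ : ℝ) :
    conj ((-(Complex.I * θ)) ^ d / (1 - Complex.exp (Complex.I * θ * τ)) ^ d)
      = (transfer d τ θ)⁻¹ := by
  rw [transfer, inv_div, map_div₀, map_pow, map_pow, map_sub, map_one, ← Complex.exp_conj]
  simp

namespace IsMinimalPair

variable {d τ : ℕ} {f g : ℝ → Seq2 →L[ℂ] Seq2} (hm : IsMinimalPair d τ f g)
include hm

/-- The function `∑ conj α_{kj} e^{-ijθ} (w (f + g))^{1/2} δ_k`, for a finite family `α`. -/
noncomputable def colSum (α : ℕ × ℤ →₀ ℂ) : CircL2 :=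
  α.sum fun p z => conj z • hm.colExp p.1 (-p.2)

theorem coeFn_colSum (α : ℕ × ℤ →₀ ℂ) : ∀ᵐ θ : ℝ ∂circ, hm.colSum α θ
    = α.sum fun p z => conj z • Complex.exp (Complex.I * (-p.2 : ℤ) * θ) •
        specRoot d τ f g θ (delta p.1) := by
  have h1 : ∀ᵐ θ : ℝ ∂circ, ∀ p : ℕ × ℤ, (conj (α p) • hm.colExp p.1 (-p.2) : CircL2) θ
      = conj (α p) • Complex.exp (Complex.I * (-p.2 : ℤ) * θ) •
        specRoot d τ f g θ (delta p.1) := by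
    refine ae_all_iff.mpr fun p => ?_
    filter_upwards [Lp.coeFn_smul (conj (α p)) (hm.colExp p.1 (-p.2)), hm.coeFn_colExp p.1 (-p.2)]
      with θ h1 h2
    rw [h1, Pi.smul_apply, h2]
  have h2 := Lp.coeFn_finsetSum α.support
    fun p => (conj (α p) • hm.colExp p.1 (-p.2) : CircL2)
  filter_upwards [h1, h2] with θ h1 h2
  rw [colSum, Finsupp.sum, h2, Finsupp.sum]
  simp only [Finset.sum_apply, h1]

theorem opSqrt_star_trigFun (α : ℕ × ℤ →₀ ℂ) : ∀ᵐ θ ∂circ,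
    opSqrt (f θ + g θ) (star (trigFun d τ α θ))
      = (conj (transfer d τ θ) * (((√(weight d τ θ))⁻¹ : ℝ) : ℂ)) • hm.colSum α θ := by
  filter_upwards [hm.coeFn_colSum α, hm.weight_pos] with θ h1 h2
  have e2 : (((√(weight d τ θ))⁻¹ : ℝ) : ℂ) * ((√(weight d τ θ) : ℝ) : ℂ) = 1 := by
    rw [← Complex.ofReal_mul, inv_mul_cancel₀ (Real.sqrt_pos.mpr h2).ne', Complex.ofReal_one]
  rw [h1, trigFun, Finsupp.sum, Finsupp.sum, star_sum, map_sum, Finset.smul_sum]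
  refine Finset.sum_congr rfl fun p _ => ?_
  rw [star_smul, map_smul, star_delta, specRoot_apply, smul_smul, smul_smul, smul_smul]
  congr 1
  rw [star_mul', star_mul', Complex.star_def,
    show Complex.I * θ * (p.2 : ℂ) = Complex.I * (p.2 : ℤ) * θ by ring, conj_exp_I_mul]
  linear_combination (-(conj (α p) * Complex.exp (Complex.I * (-p.2 : ℤ) * θ)
    * conj (transfer d τ θ))) * e2

section Target

variable {b : ℕ → Seq2} (hb : Summable fun j => ‖b j‖) {C : ℝ → Seq2} {q : CircL2}
  (hd : ∀ᵐ θ ∂circ, InFormDomain (f θ + g θ) (star (C θ))) (hq : q =ᵐ[circ] whitened d τ f g C)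
include hb hd hq

theorem ae_opSqrt_target : ∀ᵐ θ ∂circ, opSqrt (f θ + g θ)
    ((conj (transfer d τ θ) * (((√(weight d τ θ))⁻¹ : ℝ) : ℂ)) •
      (hm.kap (hm.funcVec b) - q : CircL2) θ)
      = star (charNumerator d τ f (bFun b) C θ) := by
  filter_upwards [hm.specRoot_whitened hd, hm.pos_left, hm.pos_right, hm.ae_inj, hm.weight_pos,
    hm.coeFn_kap (hm.funcVec b), hm.coeFn_funcVec hb, hq,
    Lp.coeFn_sub (hm.kap (hm.funcVec b)) q] with θ h1 h2 h3 h4 h5 h6 h7 h8 h9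
  have e2 : (((√(weight d τ θ))⁻¹ : ℝ) : ℂ) * ((√(weight d τ θ) : ℝ) : ℂ) = 1 := by
    rw [← Complex.ofReal_mul, inv_mul_cancel₀ (Real.sqrt_pos.mpr h5).ne', Complex.ofReal_one]
  have hw : (weight d τ θ : ℂ) = ((√(weight d τ θ) : ℝ) : ℂ) * ((√(weight d τ θ) : ℝ) : ℂ) := by
    rw [← Complex.ofReal_mul, Real.mul_self_sqrt (weight_nonneg _ _ _)]
  have hv : transfer d τ θ ≠ 0 := by
    intro h0
    have := norm_transfer_sq d τ θ
    rw [h0, norm_zero] at this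
    simp at this
    exact h5.ne this
  have e3 : opSqrt (f θ + g θ) (whitened d τ f g C θ)
      = (((√(weight d τ θ))⁻¹ : ℝ) : ℂ) • star (C θ) := by
    rw [← h1, specRoot_apply, smul_smul, e2, one_smul]
  rw [h9, Pi.sub_apply, h6, h7, h8, map_smul, map_sub, e3, specRoot_apply, map_smul, map_smul,
    opSqrt_whiten_opSqrt h2 h3 h4, charNumerator, star_sub, star_smul, star_smul, star_rowMul h2,
    Complex.star_def, conj_coefficient, smul_sub, smul_smul, smul_smul]
  congr 2
  · rw [mul_assoc, e2, mul_one]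
  · have := conj_transfer_mul d τ θ
    refine eq_inv_of_mul_eq_one_left ?_
    linear_combination (((√(weight d τ θ))⁻¹ : ℝ) : ℂ) * (((√(weight d τ θ))⁻¹ : ℝ) : ℂ) * this
      + (((√(weight d τ θ))⁻¹ : ℝ) : ℂ) * (((√(weight d τ θ))⁻¹ : ℝ) : ℂ) * hw
      + ((((√(weight d τ θ))⁻¹ : ℝ) : ℂ) * ((√(weight d τ θ) : ℝ) : ℂ) + 1) * e2

/-- The whitened model is isometric to `L²(f + g)`. -/
theorem lintegral_charNumerator_sub (α : ℕ × ℤ →₀ ℂ) : ∫⁻ θ, ENNReal.ofReal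
    (‖invSqrt (f θ + g θ) (star (charNumerator d τ f (bFun b) C θ
      - rowMul (trigFun d τ α θ) (f θ + g θ)))‖ ^ 2) ∂circ
      = ENNReal.ofReal (‖hm.kap (hm.funcVec b) - q - hm.colSum α‖ ^ 2) := by
  rw [norm_sq_eq_integral, ofReal_integral_eq_lintegral_ofReal (integrable_norm_sq _)
    (Eventually.of_forall fun θ => by positivity)]
  refine lintegral_congr_ae ?_
  filter_upwards [hm.ae_opSqrt_target hb hd hq, hm.opSqrt_star_trigFun α, hm.pos_left,
    hm.pos_right, hm.ae_inj, Lp.coeFn_sub (hm.kap (hm.funcVec b) - q) (hm.colSum α),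
    hm.weight_pos] with θ h1 h2 h3 h4 h5 h6 h7
  have h8 : invSqrt (f θ + g θ) (star (charNumerator d τ f (bFun b) C θ
      - rowMul (trigFun d τ α θ) (f θ + g θ)))
      = (conj (transfer d τ θ) * (((√(weight d τ θ))⁻¹ : ℝ) : ℂ)) •
        (hm.kap (hm.funcVec b) - q - hm.colSum α : CircL2) θ := by
    refine invSqrt_eq_of_opSqrt h5 ?_
    rw [star_sub, star_rowMul (h3.add h4), ← h1, ← opSqrt_opSqrt (h3.add h4), h2, ← map_sub,
      ← smul_sub, h6, Pi.sub_apply]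
  have h9 : ‖conj (transfer d τ θ) * (((√(weight d τ θ))⁻¹ : ℝ) : ℂ)‖ ^ 2 = 1 := by
    rw [norm_mul, mul_pow, RCLike.norm_conj, norm_transfer_sq, Complex.norm_real,
      Real.norm_of_nonneg (by positivity), inv_pow, Real.sq_sqrt (weight_nonneg _ _ _),
      mul_inv_cancel₀ h7.ne']
  rw [h8, norm_smul, mul_pow, h9, one_mul]

/-- The spectral integral in the whitened model. -/
theorem isSpectralIntegral_of_tendsto {Ω : Type*} [MeasurableSpace Ω] {P : Measure Ω}
    {x : ℕ → ℤ → Lp ℂ 2 P} {X : Lp ℂ 2 P} {α : ℕ → (ℕ × ℤ →₀ ℂ)}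
    (h1 : Tendsto (fun m => hm.colSum (α m)) atTop (𝓝 (hm.kap (hm.funcVec b) - q)))
    (h2 : Tendsto (fun m => (α m).sum fun p z => z • x p.1 p.2) atTop (𝓝 X)) :
    IsSpectralIntegral d τ (fun θ => f θ + g θ) x (charNumerator d τ f (bFun b) C) X := by
  refine ⟨?_, α, ?_, h2⟩
  · filter_upwards [hm.ae_opSqrt_target hb hd hq] with θ h
    exact ⟨_, h⟩
  · simp only [hm.lintegral_charNumerator_sub hb hd hq]
    have h3 := ((tendsto_const_nhds (x := hm.kap (hm.funcVec b) - q)).sub h1).norm.pow 2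
    rw [sub_self, norm_zero] at h3
    have := ENNReal.tendsto_ofReal h3
    simpa using this

theorem errSignal_ae_eq : errSignal d τ f g (bFun b) C =ᵐ[circ] fun θ =>
    inner ℂ ((hm.funcVec b - hm.kap (hm.funcVec b) + q : CircL2) θ)
      (hm.kap (hm.funcVec b - hm.kap (hm.funcVec b) + q) θ) := by
  filter_upwards [hm.specRoot_whitened hd, hm.pos_left, hm.pos_right, hm.ae_inj, hm.weight_pos,
    hm.coeFn_kap (hm.funcVec b), hm.coeFn_funcVec hb, hq,
    Lp.coeFn_sub (hm.funcVec b) (hm.kap (hm.funcVec b)),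
    Lp.coeFn_add (hm.funcVec b - hm.kap (hm.funcVec b)) q,
    hm.coeFn_kap (hm.funcVec b - hm.kap (hm.funcVec b) + q)]
    with θ h1 h2 h3 h4 h5 h6 h7 h8 h9 h10 h11
  have hw : (weight d τ θ : ℂ) = ((√(weight d τ θ) : ℝ) : ℂ) * ((√(weight d τ θ) : ℝ) : ℂ) := by
    rw [← Complex.ofReal_mul, Real.mul_self_sqrt (weight_nonneg _ _ _)]
  have h12 : invSqrt (f θ + g θ)
      (star ((weight d τ θ : ℂ) • rowMul (bFun b θ) (g θ) + C θ))
      = ((√(weight d τ θ) : ℝ) : ℂ) • (hm.funcVec b - hm.kap (hm.funcVec b) + q : CircL2) θ := by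
    refine invSqrt_eq_of_opSqrt h4 ?_
    rw [h10, Pi.add_apply, h9, Pi.sub_apply, h6, h7, h8, smul_add, map_add, map_smul, map_smul,
      ← specRoot_apply (d := d) (τ := τ) θ (whitened d τ f g C θ), h1, specRoot_apply, map_smul, ← smul_sub, map_smul,
      opSqrt_whiten_right_opSqrt h2 h3 h4, star_add, star_smul, star_rowMul h3, smul_smul, ← hw,
      Complex.star_def, Complex.conj_ofReal]
  rw [errSignal, sandwich, h12, h11, map_smul, inner_smul_left, inner_smul_right,
    Complex.conj_ofReal, ← mul_assoc ((√(weight d τ θ) : ℝ) : ℂ), ← hw, ← mul_assoc,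
    ← Complex.ofReal_mul, inv_mul_cancel₀ h5.ne', Complex.ofReal_one, one_mul]

theorem errNoise_ae_eq : errNoise d τ f g (bFun b) C =ᵐ[circ] fun θ =>
    inner ℂ ((hm.kap (hm.funcVec b) - q : CircL2) θ)
      ((hm.kap (hm.funcVec b) - q - hm.kap (hm.kap (hm.funcVec b) - q) : CircL2) θ) := by
  filter_upwards [hm.specRoot_whitened hd, hm.pos_left, hm.pos_right, hm.ae_inj, hm.weight_pos,
    hm.coeFn_kap (hm.funcVec b), hm.coeFn_funcVec hb, hq,
    Lp.coeFn_sub (hm.kap (hm.funcVec b)) q,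
    Lp.coeFn_sub (hm.kap (hm.funcVec b) - q) (hm.kap (hm.kap (hm.funcVec b) - q)),
    hm.coeFn_kap (hm.kap (hm.funcVec b) - q)]
    with θ h1 h2 h3 h4 h5 h6 h7 h8 h9 h10 h11
  have hw : (weight d τ θ : ℂ) = ((√(weight d τ θ) : ℝ) : ℂ) * ((√(weight d τ θ) : ℝ) : ℂ) := by
    rw [← Complex.ofReal_mul, Real.mul_self_sqrt (weight_nonneg _ _ _)]
  have h12 : invSqrt (f θ + g θ)
      (star ((weight d τ θ : ℂ) • rowMul (bFun b θ) (f θ) - C θ))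
      = ((√(weight d τ θ) : ℝ) : ℂ) • (hm.kap (hm.funcVec b) - q : CircL2) θ := by
    refine invSqrt_eq_of_opSqrt h4 ?_
    rw [h9, Pi.sub_apply, h6, h7, h8, smul_sub, map_sub, map_smul, map_smul,
      ← specRoot_apply (d := d) (τ := τ) θ (whitened d τ f g C θ), h1, specRoot_apply, map_smul,
      map_smul,
      opSqrt_whiten_opSqrt h2 h3 h4, star_sub, star_smul, star_rowMul h2, smul_smul, ← hw,
      Complex.star_def, Complex.conj_ofReal]
  rw [errNoise, sandwich, h12, h10, Pi.sub_apply, h11, map_smul, inner_smul_left, inner_smul_right,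
    Complex.conj_ofReal, ← mul_assoc ((√(weight d τ θ) : ℝ) : ℂ), ← hw, ← mul_assoc,
    ← Complex.ofReal_mul, inv_mul_cancel₀ h5.ne', Complex.ofReal_one, one_mul,
    whiten_right_apply h2 h3 h4]

end Target

/-! ### The normal equations -/

/-- The hypothesis that `P` is injective, in the whitened model. -/
theorem eq_zero_of_injective (hP : ∀ c : VecSeq2, IsPImage d τ f g c 0 → c = 0) {q : CircL2}
    (hA : MemLp (fun θ => specRoot d τ f g θ (q θ)) 2 circ) (hneg : q ∈ hm.isDualPair.negSpace)
    (hdual : ∀ k (n : ℤ), n < 0 → inner ℂ (hm.dualExp k n) q = 0) : q = 0 := by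
  obtain ⟨c', hc'⟩ := exists_negSeries_eq (U := hA.toLp _) fun k n hn => by
    have h1 := hm.isDualPair.mem_negSpace.mp hneg k n hn
    rw [hm.isDualPair.inner_col] at h1
    rw [inner_unitVec, ← h1]
    refine integral_congr_ae ?_
    filter_upwards [hA.coeFn_toLp] with θ h
    rw [h]
  set C : ℝ → Seq2 := fun θ => star (specRoot d τ f g θ (q θ)) with hCdef
  have hC : MemLp C 2 circ := hA.star
  have hser : IsSeriesSum (star c') C := by
    rw [isSeriesSum_iff hC, star_star, hc']
    congr 1
    ext1 θ
    exact star_star _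
  have hsqrt : ∀ θ, opSqrt (f θ + g θ) (((√(weight d τ θ) : ℝ) : ℂ) • q θ) = star (C θ) := by
    intro θ
    rw [hCdef, star_star, map_smul, specRoot_apply]
  have hq : q =ᵐ[circ] whitened d τ f g C := by
    filter_upwards [hm.ae_inj, hm.weight_pos] with θ h1 h2
    rw [whitened, invSqrt_eq_of_opSqrt h1 (hsqrt θ), smul_smul, ← Complex.ofReal_mul,
      inv_mul_cancel₀ (Real.sqrt_pos.mpr h2).ne', Complex.ofReal_one, one_smul]
  have hfin : FiniteForm d τ f g C := by
    refine ⟨Eventually.of_forall fun θ => ⟨_, hsqrt θ⟩, ?_⟩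
    simp only [← norm_whitened_sq]
    rw [lintegral_congr_ae (g := fun θ => ENNReal.ofReal (‖q θ‖ ^ 2))
      (hq.mono fun θ h => by simp only [h])]
    exact (integrable_norm_sq q).lintegral_lt_top
  have h0 : star c' = 0 := by
    refine hP _ ⟨C, hser, hfin, fun l k => ?_⟩
    rw [hm.formP_expVec_right hq, ← inner_conj_symm, hdual k _ (by omega), map_zero, mul_zero]
    rfl
  have h1 : hA.toLp _ = 0 := by
    rw [← hc', star_eq_zero.mp h0, negSeries, map_zero, smul_zero]
  ext1
  filter_upwards [hA.coeFn_toLp, hm.isDualPair.ae_injective, Lp.coeFn_zero Seq2 2 circ]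
    with θ h2 h3 h4
  rw [h1, h4] at h2
  rw [h4]
  exact h3 _ h2.symm

end IsMinimalPair

/-! ### The observations and their model -/

section Gram

variable {ι H E : Type*} [NormedAddCommGroup H] [InnerProductSpace ℂ H]
  [NormedAddCommGroup E] [InnerProductSpace ℂ E] {Z : ι → H} {u : ι → E} {s : ℝ}

theorem inner_combination {V : H} {V' : E} (h : ∀ p, inner ℂ (Z p) V = s * inner ℂ V' (u p))
    (α : ι →₀ ℂ) : inner ℂ (α.sum fun p z => z • Z p) V
      = s * inner ℂ V' (α.sum fun p z => conj z • u p) := by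
  rw [Finsupp.sum, Finsupp.sum, sum_inner, inner_sum, Finset.mul_sum]
  refine Finset.sum_congr rfl fun p _ => ?_
  rw [inner_smul_left, inner_smul_right, h]
  ring

/-- An element of the closed span of `Z p`, `p ∈ S`, and its counterpart under an antilinear
correspondence of `Z p` to `u p` that preserves inner products up to a factor. -/
theorem exists_tendsto_of_mem_closure_span [CompleteSpace E] (hs : 0 < s)
    (hG : ∀ p q, inner ℂ (Z p) (Z q) = s * inner ℂ (u q) (u p)) (S : Set ι) {x : H}
    (hx : x ∈ (Submodule.span ℂ (Z '' S)).topologicalClosure) :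
    ∃ (α : ℕ → ι →₀ ℂ) (y : E), (∀ m, α m ∈ Finsupp.supported ℂ ℂ S) ∧
      Tendsto (fun m => (α m).sum fun p z => z • Z p) atTop (𝓝 x) ∧
      Tendsto (fun m => (α m).sum fun p z => conj z • u p) atTop (𝓝 y) := by
  obtain ⟨w, hw, hwx⟩ := mem_closure_iff_seq_limit.mp
    (show x ∈ closure ((Submodule.span ℂ (Z '' S) : Submodule ℂ H) : Set H) from hx)
  have hw' : ∀ m, ∃ α ∈ Finsupp.supported ℂ ℂ S, Finsupp.linearCombination ℂ Z α = w m :=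
    fun m => (Finsupp.mem_span_image_iff_linearCombination ℂ).mp (hw m)
  choose α hα hαw using hw'
  have hαw' : ∀ m, ((α m).sum fun p z => z • Z p) = w m := fun m => hαw m
  have hnorm : ∀ β : ι →₀ ℂ, ‖β.sum fun p z => z • Z p‖ ^ 2
      = s * ‖β.sum fun p z => conj z • u p‖ ^ 2 := by
    intro β
    refine Complex.ofReal_injective ?_
    rw [Complex.ofReal_mul, ← inner_self_eq_ofReal, ← inner_self_eq_ofReal]
    refine inner_combination (fun p => ?_) β
    rw [← inner_conj_symm, inner_combination (fun q => hG q p) β, map_mul, inner_conj_symm,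
      Complex.conj_ofReal]
  have hsub : ∀ β γ : ι →₀ ℂ, ((β - γ).sum fun p z => z • Z p)
      = (β.sum fun p z => z • Z p) - γ.sum fun p z => z • Z p := fun β γ =>
    Finsupp.sum_sub_index fun p z z' => sub_smul _ _ _
  have hsub' : ∀ β γ : ι →₀ ℂ, ((β - γ).sum fun p z => conj z • u p)
      = (β.sum fun p z => conj z • u p) - γ.sum fun p z => conj z • u p := fun β γ =>
    Finsupp.sum_sub_index fun p z z' => by rw [map_sub, sub_smul]
  have hcauchy : CauchySeq fun m => (α m).sum fun p z => conj z • u p := by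
    rw [Metric.cauchySeq_iff']
    intro ε hε
    obtain ⟨N, hN⟩ := Metric.cauchySeq_iff'.mp hwx.cauchySeq (√s * ε) (by positivity)
    refine ⟨N, fun n hn => ?_⟩
    have h1 := hN n hn
    rw [dist_eq_norm, ← hαw', ← hαw', ← hsub] at h1
    rw [dist_eq_norm, ← hsub']
    have h2 := hnorm (α n - α N)
    rw [← Real.sq_sqrt hs.le, ← mul_pow] at h2
    have h3 := (sq_eq_sq₀ (norm_nonneg _) (by positivity)).mp h2
    rw [h3] at h1
    exact lt_of_mul_lt_mul_left h1 (Real.sqrt_nonneg _)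
  obtain ⟨y, hy⟩ := cauchySeq_tendsto_of_complete hcauchy
  exact ⟨α, y, hα, by simpa only [hαw'] using hwx, hy⟩

end Gram

section Observations

variable {Ω : Type*} [MeasurableSpace Ω] {P : Measure Ω}

theorem moment_eq_inner (U V : Lp ℂ 2 P) : moment U V = inner ℂ V U := by
  rw [moment, L2.inner_def]
  rfl

theorem pastSpace_eq (x : ℕ → ℤ → Lp ℂ 2 P) : pastSpace x
    = (Submodule.span ℂ ((fun p : ℕ × ℤ => x p.1 p.2) '' {p | p.2 ≤ 0})).topologicalClosure := by
  rw [pastSpace]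
  congr 2
  ext X
  constructor
  · rintro ⟨k, j, hj, rfl⟩
    exact ⟨(k, j), hj, rfl⟩
  · rintro ⟨p, hp, rfl⟩
    exact ⟨p.1, p.2, hp, rfl⟩

/-- The orthogonal projection is the only optimal estimate. -/
theorem isOptimalEstimate_iff {K : Submodule ℂ (Lp ℂ 2 P)} {X Xhat : Lp ℂ 2 P} (hmem : Xhat ∈ K)
    (horth : ∀ Z ∈ K, inner ℂ Z (X - Xhat) = 0) (Y : Lp ℂ 2 P) :
    IsOptimalEstimate K X Y ↔ Y = Xhat := by
  have hpyth : ∀ Z ∈ K, ‖X - Z‖ * ‖X - Z‖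
      = ‖Xhat - Z‖ * ‖Xhat - Z‖ + ‖X - Xhat‖ * ‖X - Xhat‖ := by
    intro Z hZ
    rw [← norm_add_sq_eq_norm_sq_add_norm_sq_of_inner_eq_zero _ _ (horth _ (K.sub_mem hmem hZ))]
    congr 2 <;> abel
  constructor
  · rintro ⟨hY, hopt⟩
    have h1 := hopt Xhat hmem
    have h2 := hpyth Y hY
    have h3 : ‖X - Y‖ * ‖X - Y‖ ≤ ‖X - Xhat‖ * ‖X - Xhat‖ :=
      mul_self_le_mul_self (norm_nonneg _) h1
    have h4 : ‖Xhat - Y‖ * ‖Xhat - Y‖ = 0 :=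
      le_antisymm (by linarith) (mul_self_nonneg _)
    exact (sub_eq_zero.mp (norm_eq_zero.mp (mul_self_eq_zero.mp h4))).symm
  · rintro rfl
    refine ⟨hmem, fun Z hZ => ?_⟩
    refine le_of_sq_le_sq ?_ (norm_nonneg _)
    rw [sq, sq, hpyth Z hZ]
    linarith [mul_self_nonneg ‖Y - Z‖]

end Observations

namespace IsMinimalPair

variable {d τ : ℕ} {f g : ℝ → Seq2 →L[ℂ] Seq2} (hm : IsMinimalPair d τ f g)
  {Ω : Type*} [MeasurableSpace Ω] {P : Measure Ω} {X Y : ℕ → ℤ → Lp ℂ 2 P}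
  (hf : IsSpectralDensity d τ X f) (hg : IsSpectralDensity d τ Y g)
  (hXY : ∀ k l n j, moment (X k l) (Y n j) = 0)
include hm

/-- The functions `e^{inθ} D k`, `n < 0`, are orthogonal to the model of the past. -/
theorem inner_dualExp_colSum {α : ℕ × ℤ →₀ ℂ}
    (hα : α ∈ Finsupp.supported ℂ ℂ {p : ℕ × ℤ | p.2 ≤ 0}) (k : ℕ) {n : ℤ} (hn : n < 0) :
    inner ℂ (hm.dualExp k n) (hm.colSum α) = 0 := by
  rw [colSum, Finsupp.sum, inner_sum]
  refine Finset.sum_eq_zero fun p hp => ?_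
  have hp' : p.2 ≤ 0 := (Finsupp.mem_supported _ _).mp hα hp
  rw [inner_smul_right, ← inner_conj_symm, colExp, dualExp, hm.isDualPair.inner_col_dual _ _
    (by omega), map_zero, mul_zero]

include hf

/-- The signal in the whitened model: `X k l` is represented by `e^{-ilθ} A δ_k`, where
`A = (w (f + g))^{1/2}`, and inner products are taken with the weight `κ`. The correspondence is
antilinear, which exchanges the two sides. -/
theorem inner_signal (k n : ℕ) (l j : ℤ) : inner ℂ (X n j) (X k l)
    = ((1 / (2 * Real.pi) : ℝ) : ℂ) *
      inner ℂ (hm.kap (hm.colExp k (-l))) (hm.colExp n (-j)) := by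
  rw [← moment_eq_inner, hf.moments, hm.inner_kap, hm.inner_colExp_kap]
  push_cast
  rfl

theorem inner_functional_self {b : ℕ → Seq2} (hb : Summable fun j => ‖b j‖) {Bξ : Lp ℂ 2 P}
    (hB : HasSum (fun p : ℕ × ℕ => b p.1 p.2 • X p.2 (-(p.1 : ℤ))) Bξ) :
    inner ℂ Bξ Bξ = ((1 / (2 * Real.pi) : ℝ) : ℂ) *
      inner ℂ (hm.kap (hm.funcVec b)) (hm.funcVec b) := by
  have h1 : ∀ p : ℕ × ℕ, inner ℂ (X p.2 (-(p.1 : ℤ))) Bξ = ((1 / (2 * Real.pi) : ℝ) : ℂ) *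
      inner ℂ (hm.kap (hm.funcVec b)) (hm.colExp p.2 p.1) := by
    intro p
    have h1 := hB.mapL (innerSL ℂ (X p.2 (-(p.1 : ℤ))))
    refine h1.unique (((hm.hasSum_inner_kap_funcVec hb _).mul_left _).congr_fun fun p' => ?_)
    rw [map_smul, innerSL_apply_apply, hm.inner_signal hf, neg_neg, neg_neg, smul_eq_mul]
    ring
  have h2 := (hm.hasSum_funcVec hb).mapL (innerSL ℂ (hm.kap (hm.funcVec b)))
  refine (hasSum_inner_left hB Bξ).unique
    ((h2.mul_left ((1 / (2 * Real.pi) : ℝ) : ℂ)).congr_fun fun p => ?_)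
  rw [inner_smul_left, h1, map_smul, innerSL_apply_apply, smul_eq_mul]
  ring

include hXY

theorem inner_observed_signal (k n : ℕ) (l j : ℤ) : inner ℂ (X n j + Y n j) (X k l)
    = ((1 / (2 * Real.pi) : ℝ) : ℂ) *
      inner ℂ (hm.kap (hm.colExp k (-l))) (hm.colExp n (-j)) := by
  rw [inner_add_left, hm.inner_signal hf, ← moment_eq_inner (X k l) (Y n j), hXY, add_zero]

theorem inner_observed_functional {b : ℕ → Seq2} (hb : Summable fun j => ‖b j‖) {Bξ : Lp ℂ 2 P}
    (hB : HasSum (fun p : ℕ × ℕ => b p.1 p.2 • X p.2 (-(p.1 : ℤ))) Bξ) (n : ℕ) (j : ℤ) :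
    inner ℂ (X n j + Y n j) Bξ = ((1 / (2 * Real.pi) : ℝ) : ℂ) *
      inner ℂ (hm.kap (hm.funcVec b)) (hm.colExp n (-j)) := by
  have h1 := hB.mapL (innerSL ℂ (X n j + Y n j))
  refine h1.unique (((hm.hasSum_inner_kap_funcVec hb _).mul_left _).congr_fun fun p => ?_)
  rw [map_smul, innerSL_apply_apply, hm.inner_observed_signal hf hXY, neg_neg, smul_eq_mul]
  ring

include hg

/-- The observations in the whitened model: the weights `κ` and `1 - κ` of signal and noise
add up to `1`. -/
theorem inner_observed (k n : ℕ) (l j : ℤ) : inner ℂ (X n j + Y n j) (X k l + Y k l)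
    = ((1 / (2 * Real.pi) : ℝ) : ℂ) * inner ℂ (hm.colExp k (-l)) (hm.colExp n (-j)) := by
  have h1 : inner ℂ (X n j) (Y k l) = 0 := by
    rw [← inner_conj_symm, ← moment_eq_inner, hXY, map_zero]
  rw [inner_add_right, hm.inner_observed_signal hf hXY, inner_add_left, h1, zero_add,
    ← moment_eq_inner, hg.moments, hm.inner_colExp, hm.inner_kap, hm.inner_colExp_kap]
  rw [show ((1 / (2 * Real.pi) : ℝ) : ℂ) = (1 / (2 * Real.pi) : ℂ) by push_cast; rfl, ← mul_add,
    ← integral_add (integrable_circ_exp_mul (hf.integrable k n) _)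
    (integrable_circ_exp_mul (hg.integrable k n) _)]
  congr 2
  ext θ
  rw [_root_.add_apply, lp.coeFn_add, Pi.add_apply]
  ring

theorem norm_signal_le (k : ℕ) (l : ℤ) : ‖X k l‖ ≤ ‖hm.colExp k 0‖ := by
  have h1 : inner ℂ (X k l) (Y k l) = 0 := by
    rw [← inner_conj_symm, ← moment_eq_inner, hXY, map_zero]
  have h2 := norm_add_sq_eq_norm_sq_add_norm_sq_of_inner_eq_zero _ _ h1
  have h3 : ‖X k l + Y k l‖ ^ 2 = 1 / (2 * Real.pi) * ‖hm.colExp k (-l)‖ ^ 2 := by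
    refine Complex.ofReal_injective ?_
    rw [Complex.ofReal_mul, ← inner_self_eq_ofReal, ← inner_self_eq_ofReal,
      hm.inner_observed hf hg hXY]
  rw [hm.norm_colExp] at h3
  have h4 : 1 / (2 * Real.pi) ≤ 1 := by
    rw [div_le_one (by positivity)]
    linarith [Real.pi_gt_three]
  refine le_of_sq_le_sq ?_ (norm_nonneg _)
  nlinarith [mul_le_mul_of_nonneg_right h4 (sq_nonneg ‖hm.colExp k 0‖), norm_nonneg (Y k l)]

theorem hasSum_functional {b : ℕ → Seq2} (hb : Summable fun j => ‖b j‖) :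
    ∃ Bξ : Lp ℂ 2 P, HasSum (fun p : ℕ × ℕ => b p.1 p.2 • X p.2 (-(p.1 : ℤ))) Bξ := by
  refine (Summable.of_norm_bounded (summable_prod_norm_mul hb hm.summable_norm_colExp_sq
    fun n => norm_nonneg _) fun p => ?_)
  rw [norm_smul]
  exact mul_le_mul_of_nonneg_left (hm.norm_signal_le hf hg hXY _ _) (norm_nonneg _)

/-- The filtering problem for a pair of uncorrelated sequences with spectral densities `f`, `g`.

Let `n` be the whitened model of the projection of `Bξ`. Then `κB - q - n` is orthogonal to all
`e^{iλj} A δ_k`, `j ≥ 0`, and to all dual functions of negative frequency, so it vanishes. -/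
theorem exists_optimal_estimate (hP : ∀ c : VecSeq2, IsPImage d τ f g c 0 → c = 0)
    {b : ℕ → Seq2} (hb : Summable fun j => ‖b j‖) {r c : VecSeq2} (hr : IsRImage f g b r)
    (hc : IsPImage d τ f g c r) {C : ℝ → Seq2} (hC : IsSeriesSum c C) {Bξ : Lp ℂ 2 P}
    (hB : HasSum (fun p : ℕ × ℕ => b p.1 p.2 • X p.2 (-(p.1 : ℤ))) Bξ) :
    ∃ Xhat : Lp ℂ 2 P,
      (∀ V : Lp ℂ 2 P, IsOptimalEstimate (pastSpace fun k j => X k j + Y k j) Bξ V ↔ V = Xhat) ∧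
      IsSpectralIntegral d τ (fun θ => f θ + g θ) (fun k j => X k j + Y k j)
        (charNumerator d τ f (bFun b) C) Xhat ∧
      Integrable (errSignal d τ f g (bFun b) C) circ ∧
      Integrable (errNoise d τ f g (bFun b) C) circ ∧
      moment (Bξ - Xhat) (Bξ - Xhat)
        = (1 / (2 * Real.pi) : ℂ) * ∫ θ, errSignal d τ f g (bFun b) C θ ∂circ
          + (1 / (2 * Real.pi) : ℂ) * ∫ θ, errNoise d τ f g (bFun b) C θ ∂circ ∧
      ∃ (Q : ℕ → ℕ → ℂ) (s : ℂ), IsQImage d τ f g b Q ∧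
        HasSum (fun p : ℕ × ℕ => Q p.1 p.2 * star (b p.1 p.2)) s ∧
        moment (Bξ - Xhat) (Bξ - Xhat) = inner ℂ c r + s := by
  obtain ⟨C', hC', hfin', hform'⟩ := hc
  have hCC := hC'.ae_eq hC
  have hfin : FiniteForm d τ f g C := hfin'.congr hCC
  have hform : ∀ l k, r l k = formP d τ f g C (expVec l k) := by
    intro l k
    rw [hform', formP, formP]
    congr 1
    refine integral_congr_ae ?_
    filter_upwards [hCC] with θ h
    rw [h]
  set q : CircL2 := (hm.memLp_whitened hC.1.1 hfin).toLp _ with hqdef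
  have hq : q =ᵐ[circ] whitened d τ f g C := (hm.memLp_whitened hC.1.1 hfin).coeFn_toLp
  set κB := hm.kap (hm.funcVec b) with hκB
  have hle := hm.isDualPair.negSpace_le_dualSpan fun q h1 h2 h3 =>
    hm.eq_zero_of_injective hP h1 h2 h3
  -- `(w (f + g))^{1/2} q` is the Fourier series of `C̄`
  have hser := (isSeriesSum_iff hC.1).mp hC
  have hcq : ∀ᵐ θ ∂circ, negSeries (star c) θ = specRoot d τ f g θ (q θ) := by
    rw [← hser]
    filter_upwards [(memLp_star hC.1).coeFn_toLp, hq, hm.specRoot_whitened hfin.1] with θ h1 h2 h3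
    rw [h1, h2, h3]
  have hqneg : q ∈ hm.isDualPair.negSpace := by
    refine hm.isDualPair.mem_negSpace.mpr fun k n hn => ?_
    have h1 := inner_constVec_negSeries_of_nonneg hn (delta k) (star c)
    rw [← unitVec_eq, inner_unitVec] at h1
    rw [hm.isDualPair.inner_col, ← h1]
    refine integral_congr_ae ?_
    filter_upwards [hcq] with θ h
    rw [h]
  have hpi : (2 * Real.pi : ℂ) ≠ 0 := by
    simp [Real.pi_ne_zero]
  have hqr : ∀ (l k : ℕ), inner ℂ q (hm.dualExp k (-((l : ℤ) + 1))) = 2 * Real.pi * r l k := by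
    intro l k
    rw [hform, hm.formP_expVec_right hq, ← mul_assoc, mul_one_div_cancel hpi, one_mul]
  have hκr : ∀ (l k : ℕ), inner ℂ κB (hm.dualExp k (-((l : ℤ) + 1))) = 2 * Real.pi * r l k := by
    intro l k
    rw [hm.isRImage_eq hb hr, ← mul_assoc, mul_one_div_cancel hpi, one_mul]
  -- the projection of `Bξ` and its model
  set K := pastSpace fun k j => X k j + Y k j with hK
  have hKclosed : IsClosed (K : Set (Lp ℂ 2 P)) := Submodule.isClosed_topologicalClosure _
  have : CompleteSpace K := hKclosed.completeSpace_coe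
  set Xhat : Lp ℂ 2 P := K.starProjection Bξ with hXhat
  have hmem : Xhat ∈ K := K.starProjection_apply_mem Bξ
  have horth : ∀ Z ∈ K, inner ℂ Z (Bξ - Xhat) = 0 := fun Z hZ =>
    (K.mem_orthogonal _).mp (K.sub_starProjection_mem_orthogonal Bξ) Z hZ
  have hG : ∀ p p' : ℕ × ℤ, inner ℂ (X p.1 p.2 + Y p.1 p.2) (X p'.1 p'.2 + Y p'.1 p'.2)
      = ((1 / (2 * Real.pi) : ℝ) : ℂ) *
        inner ℂ (hm.colExp p'.1 (-p'.2)) (hm.colExp p.1 (-p.2)) := fun p p' =>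
    hm.inner_observed hf hg hXY _ _ _ _
  obtain ⟨α, n, hα, hαX, hαn⟩ := exists_tendsto_of_mem_closure_span
    (Z := fun p : ℕ × ℤ => X p.1 p.2 + Y p.1 p.2) (u := fun p : ℕ × ℤ => hm.colExp p.1 (-p.2))
    (s := 1 / (2 * Real.pi)) (by positivity) hG {p | p.2 ≤ 0}
    (x := Xhat) (by rw [← pastSpace_eq fun k j => X k j + Y k j]; exact hmem)
  have hZX : ∀ p : ℕ × ℤ, inner ℂ (X p.1 p.2 + Y p.1 p.2) Xhat
      = ((1 / (2 * Real.pi) : ℝ) : ℂ) * inner ℂ n (hm.colExp p.1 (-p.2)) := by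
    intro p
    have h1 : Tendsto (fun m => inner ℂ (X p.1 p.2 + Y p.1 p.2)
        ((α m).sum fun p z => z • (X p.1 p.2 + Y p.1 p.2))) atTop
        (𝓝 (inner ℂ (X p.1 p.2 + Y p.1 p.2) Xhat)) := tendsto_const_nhds.inner hαX
    have h2 : Tendsto (fun m => ((1 / (2 * Real.pi) : ℝ) : ℂ) * inner ℂ
        ((α m).sum fun p z => conj z • hm.colExp p.1 (-p.2)) (hm.colExp p.1 (-p.2))) atTop
        (𝓝 (((1 / (2 * Real.pi) : ℝ) : ℂ) * inner ℂ n (hm.colExp p.1 (-p.2)))) :=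
      (hαn.inner tendsto_const_nhds).const_mul _
    refine tendsto_nhds_unique h1 (h2.congr fun m => ?_)
    rw [← inner_conj_symm (X p.1 p.2 + Y p.1 p.2), inner_combination
      (Z := fun p : ℕ × ℤ => X p.1 p.2 + Y p.1 p.2) (u := fun p : ℕ × ℤ => hm.colExp p.1 (-p.2))
      (fun p' => hG p' p), map_mul, inner_conj_symm, Complex.conj_ofReal]
  -- the spectral characteristic: `κB - q` solves the normal equations
  have htarget : κB - q = n := by
    have h1 : κB - q - n ∈ hm.isDualPair.negSpace := by
      rw [sub_right_comm]
      refine Submodule.sub_mem _ (hm.isDualPair.mem_negSpace.mpr fun k j hj => ?_) hqneg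
      have h2 := horth _ (show X k (-j) + Y k (-j) ∈ K from
        Submodule.le_topologicalClosure _ (Submodule.subset_span ⟨k, -j, by omega, rfl⟩))
      rw [inner_sub_right, hm.inner_observed_functional hf hXY hb hB, hZX (k, -j), ← mul_sub,
        ← inner_sub_left, mul_eq_zero] at h2
      have h3 := h2.resolve_left (Complex.ofReal_ne_zero.mpr (by positivity))
      rw [neg_neg] at h3
      rw [← inner_conj_symm]
      exact (congrArg conj h3).trans (map_zero _)
    have h2 : ∀ k (j : ℤ), j < 0 → inner ℂ (κB - q - n) (hm.dualExp k j) = 0 := by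
      intro k j hj
      obtain ⟨l, rfl⟩ : ∃ l : ℕ, j = -((l : ℤ) + 1) := ⟨(-j - 1).toNat, by omega⟩
      have h3 : inner ℂ (hm.dualExp k (-((l : ℤ) + 1))) n = 0 := by
        refine tendsto_nhds_unique (tendsto_const_nhds.inner hαn) ?_
        refine (tendsto_const_nhds (x := (0 : ℂ))).congr fun m => ?_
        exact (hm.inner_dualExp_colSum (hα m) k hj).symm
      rw [inner_sub_left, inner_sub_left, hκr, hqr, ← inner_conj_symm n, h3, map_zero, sub_self,
        sub_self]
    have h3 := hm.isDualPair.dualSpan_le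
      (Z := (Submodule.span ℂ {κB - q - n})ᗮ) (Submodule.isClosed_orthogonal _) fun k j hj => by
        rw [mem_span_orthogonal_iff]
        rintro _ rfl
        exact h2 k j hj
    have h4 := mem_span_orthogonal_iff.mp (h3 (hle h1)) _ rfl
    exact sub_eq_zero.mp (inner_self_eq_zero.mp h4)
  -- orthogonality relations
  have hqt : inner ℂ q (κB - q) = 0 := by
    rw [htarget]
    refine tendsto_nhds_unique (tendsto_const_nhds.inner hαn) ?_
    refine (tendsto_const_nhds (x := (0 : ℂ))).congr fun m => ?_
    rw [Finsupp.sum, inner_sum]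
    refine (Finset.sum_eq_zero fun p hp => ?_).symm
    have hp' : p.2 ≤ 0 := (Finsupp.mem_supported _ _).mp (hα m) hp
    rw [inner_smul_right, ← inner_conj_symm, colExp,
      hm.isDualPair.mem_negSpace.mp hqneg _ _ (by omega), map_zero, mul_zero]
  have htq : inner ℂ (κB - q) q = 0 := by rw [← inner_conj_symm, hqt, map_zero]
  have hqq : inner ℂ q q = 2 * Real.pi * inner ℂ c r := by
    have h1 := hm.isDualPair.inner_self_eq_of_coefficients hle hcq hqneg
      (ρ := negSeries (star r)) fun k j hj => by
        obtain ⟨l, rfl⟩ : ∃ l : ℕ, j = -((l : ℤ) + 1) := ⟨(-j - 1).toNat, by omega⟩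
        have h2 := hqr l k
        rw [unitVec_eq, inner_constVec_negSeries_neg, inner_delta_left, ← inner_conj_symm]
        refine (congrArg conj h2).trans ?_
        rw [map_mul, map_mul, Complex.conj_ofReal, Complex.conj_ofNat]
        rfl
    rw [inner_negSeries] at h1
    have h2 : inner ℂ (star c) (star r) = conj (inner ℂ c r) := by
      rw [lp.inner_eq_tsum, lp.inner_eq_tsum, Complex.conj_tsum]
      refine tsum_congr fun l => ?_
      rw [lp.inner_eq_tsum, lp.inner_eq_tsum, Complex.conj_tsum]
      refine tsum_congr fun k => ?_
      simp
    rw [← inner_conj_symm, h1, h2, map_mul, map_mul, Complex.conj_conj, Complex.conj_ofReal,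
      Complex.conj_ofNat]
  have hXX : inner ℂ Xhat Xhat
      = ((1 / (2 * Real.pi) : ℝ) : ℂ) * inner ℂ (κB - q) (κB - q) := by
    have h1 : Tendsto (fun m => inner ℂ ((α m).sum fun p z => z • (X p.1 p.2 + Y p.1 p.2)) Xhat)
        atTop (𝓝 (inner ℂ Xhat Xhat)) := hαX.inner tendsto_const_nhds
    have h2 : Tendsto (fun m => ((1 / (2 * Real.pi) : ℝ) : ℂ) * inner ℂ n
        ((α m).sum fun p z => conj z • hm.colExp p.1 (-p.2))) atTop
        (𝓝 (((1 / (2 * Real.pi) : ℝ) : ℂ) * inner ℂ n n)) :=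
      ((tendsto_const_nhds (x := n)).inner hαn).const_mul _
    rw [htarget]
    refine tendsto_nhds_unique h1 (h2.congr fun m => ?_)
    exact (inner_combination (Z := fun p : ℕ × ℤ => X p.1 p.2 + Y p.1 p.2)
      (u := fun p : ℕ × ℤ => hm.colExp p.1 (-p.2)) hZX (α m)).symm
  have hΔ : moment (Bξ - Xhat) (Bξ - Xhat) = (1 / (2 * Real.pi) : ℂ) *
      (inner ℂ κB (hm.funcVec b) - inner ℂ (κB - q) (κB - q)) := by
    have h1 := horth _ hmem
    have h2 : inner ℂ (Bξ - Xhat) Xhat = 0 := by rw [← inner_conj_symm, h1, map_zero]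
    have h3 : inner ℂ Bξ Xhat = inner ℂ Xhat Xhat := by
      rw [← sub_eq_zero, ← inner_sub_left, h2]
    rw [moment_eq_inner, inner_sub_right _ Bξ, h2, sub_zero, inner_sub_left,
      hm.inner_functional_self hf hb hB, mul_sub, ← inner_conj_symm Xhat Bξ, h3, inner_conj_symm,
      hXX]
    push_cast
    rfl
  have hs1 := hm.errSignal_ae_eq hb hfin.1 hq
  have hs2 := hm.errNoise_ae_eq hb hfin.1 hq
  have hκt : inner ℂ κB (κB - q) = inner ℂ (κB - q) (κB - q) := by
    rw [inner_sub_left κB q, hqt, sub_zero]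
  have htκ : inner ℂ (κB - q) κB = inner ℂ (κB - q) (κB - q) := by
    rw [inner_sub_right _ κB q, htq, sub_zero]
  refine ⟨Xhat, isOptimalEstimate_iff hmem horth, ?_, ?_, ?_, ?_, _, _, hm.isQImage_funcVec hb,
    hm.hasSum_Q_pairing hb, ?_⟩
  · refine hm.isSpectralIntegral_of_tendsto hb hfin.1 hq (α := α) ?_ hαX
    rw [← hκB, htarget]
    exact hαn
  · exact (L2.integrable_inner _ _).congr hs1.symm
  · exact (L2.integrable_inner _ _).congr hs2.symm
  · rw [hΔ, integral_congr_ae hs1, integral_congr_ae hs2, ← L2.inner_def, ← L2.inner_def,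
      ← mul_add, ← hκB]
    congr 1
    rw [show hm.funcVec b - κB + q = hm.funcVec b - (κB - q) by abel]
    generalize κB - q = t at *
    have e1 : inner ℂ (hm.funcVec b) κB = inner ℂ κB (hm.funcVec b) := (hm.inner_kap _ _).symm
    have e2 : inner ℂ (hm.funcVec b) (hm.kap t) = inner ℂ κB t := (hm.inner_kap _ _).symm
    rw [map_sub, ← hκB, inner_sub_right, inner_sub_left, inner_sub_left, inner_sub_right t t, e1, e2,
      htκ, hκt]
    ring
  · rw [hΔ, ← hκB, inner_sub_right κB (hm.funcVec b) κB]
    have h5 : inner ℂ κB κB = inner ℂ (κB - q) (κB - q) + inner ℂ q q := by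
      rw [← htκ, inner_sub_left κB q κB]
      have : inner ℂ q κB = inner ℂ q q := by
        rw [← sub_eq_zero, ← inner_sub_right, hqt]
      rw [this]
      ring
    rw [h5, hqq]
    field_simp
    ring

end IsMinimalPair

/-! ### Abel summation by parts of order `d` -/

section Abel

variable {W : Type*} [NormedAddCommGroup W]

/-- The shift `(E Φ)_j = Φ_{j+τ}` of sequences. -/
def seqShift (W : Type*) [AddCommGroup W] [Module ℂ W] (τ : ℕ) : Module.End ℂ (ℕ → W) where
  toFun Φ j := Φ (j + τ)
  map_add' _ _ := rfl
  map_smul' _ _ := rfl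

variable [InnerProductSpace ℂ W] {τ : ℕ}

theorem seqShift_pow_apply (l : ℕ) (Φ : ℕ → W) (j : ℕ) :
    (seqShift W τ ^ l) Φ j = Φ (j + l * τ) := by
  induction l generalizing j with
  | zero => simp
  | succ l ih =>
    rw [pow_succ', Module.End.mul_apply]
    change (seqShift W τ ^ l) Φ (j + τ) = _
    rw [ih]
    congr 1
    ring

theorem one_sub_smul_seqShift_pow_apply (d : ℕ) (y : ℂ) (Φ : ℕ → W) (j : ℕ) :
    ((1 - y • seqShift W τ) ^ d) Φ j = ∑ l ∈ Finset.range (d + 1),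
      ((-1 : ℂ) ^ l * (d.choose l : ℂ) * y ^ l) • Φ (j + l * τ) := by
  rw [sub_eq_add_neg, add_comm, Commute.add_pow (Commute.one_right _), LinearMap.sum_apply,
    Finset.sum_apply]
  refine Finset.sum_congr rfl fun l _ => ?_
  rw [one_pow, mul_one, show -(y • seqShift W τ) = (-y) • seqShift W τ from (neg_smul _ _).symm,
    smul_pow, ← nsmul_eq_mul', LinearMap.smul_apply,
    LinearMap.smul_apply, Pi.smul_apply, Pi.smul_apply, seqShift_pow_apply, ← Nat.cast_smul_eq_nsmul ℂ,
    smul_smul, neg_pow]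
  congr 1
  ring

/-- A sequence with bounded differences of order `d` is `O(j^d)`. -/
theorem norm_le_of_bounded_differences (hτ : 0 < τ) (d : ℕ) {Φ : ℕ → W} {K : ℝ}
    (hK : ∀ j, ‖((1 - seqShift W τ) ^ d) Φ j‖ ≤ K) :
    ∃ M, 0 ≤ M ∧ ∀ j : ℕ, ‖Φ j‖ ≤ M * (1 + j) ^ d := by
  induction d generalizing Φ with
  | zero =>
    refine ⟨K, (norm_nonneg _).trans (hK 0), fun j => ?_⟩
    simpa using hK j
  | succ d ih =>
    obtain ⟨M, hM, hbd⟩ := ih (Φ := (1 - seqShift W τ) Φ) fun j => by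
      rw [← Module.End.mul_apply, ← pow_succ]
      exact hK j
    set M' := M + ∑ i ∈ Finset.range τ, ‖Φ i‖ with hM'
    have hMM : M ≤ M' := le_add_of_nonneg_right (Finset.sum_nonneg fun i _ => norm_nonneg _)
    refine ⟨M', hM.trans hMM, fun j => ?_⟩
    induction j using Nat.strong_induction_on with
    | _ j ihj =>
      by_cases hj : j < τ
      · have h1 : ‖Φ j‖ ≤ M' := by
          refine (Finset.single_le_sum (f := fun i => ‖Φ i‖) (fun i _ => norm_nonneg _)
            (Finset.mem_range.mpr hj)).trans (le_add_of_nonneg_left hM)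
        refine h1.trans (le_mul_of_one_le_right (hM.trans hMM) ?_)
        exact one_le_pow₀ (by linarith [Nat.cast_nonneg (α := ℝ) j])
      · obtain ⟨i, rfl⟩ : ∃ i, j = i + τ := ⟨j - τ, by omega⟩
        have h1 : Φ (i + τ) = Φ i - (1 - seqShift W τ) Φ i := by
          rw [LinearMap.sub_apply, Pi.sub_apply, Module.End.one_apply]
          change _ = Φ i - (Φ i - Φ (i + τ))
          abel
        have h2 : (1 : ℝ) ≤ τ := by exact_mod_cast hτ
        have h3 : (0 : ℝ) ≤ i := Nat.cast_nonneg i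
        calc ‖Φ (i + τ)‖ ≤ ‖Φ i‖ + ‖(1 - seqShift W τ) Φ i‖ := by
              rw [h1]
              exact norm_sub_le _ _
          _ ≤ M' * (1 + i) ^ (d + 1) + M' * (1 + i) ^ d :=
              add_le_add (ihj i (by omega))
                ((hbd i).trans (mul_le_mul_of_nonneg_right hMM (by positivity)))
          _ = M' * ((1 + i) ^ d * (1 + (i + 1))) := by ring
          _ ≤ M' * ((1 + (i + τ)) ^ d * (1 + (i + τ))) := by
              have := hM.trans hMM
              gcongr
              linarith
          _ = M' * (1 + ((i + τ : ℕ) : ℝ)) ^ (d + 1) := by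
              push_cast
              ring

/-- `x^j ((1 - x)(1 + j))^p` is bounded uniformly in `j` and `x ∈ [0, 1]`. -/
theorem pow_mul_pow_le {x : ℝ} (hx0 : 0 ≤ x) (hx1 : x ≤ 1) (j p : ℕ) :
    x ^ j * ((1 - x) * (1 + j)) ^ p ≤ p.factorial * Real.exp 1 := by
  have h1 : x ^ j ≤ Real.exp (j * (x - 1)) := by
    rw [Real.exp_nat_mul]
    refine pow_le_pow_left₀ hx0 ?_ j
    linarith [Real.add_one_le_exp (x - 1)]
  have hs : 0 ≤ (1 - x) * (1 + j) := mul_nonneg (by linarith) (by positivity)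
  have h2 : ((1 - x) * (1 + j)) ^ p ≤ p.factorial * Real.exp ((1 - x) * (1 + j)) := by
    have := Real.pow_div_factorial_le_exp _ hs p
    rwa [div_le_iff₀' (by positivity)] at this
  calc x ^ j * ((1 - x) * (1 + j)) ^ p
      ≤ Real.exp (j * (x - 1)) * (p.factorial * Real.exp ((1 - x) * (1 + j))) :=
        mul_le_mul h1 h2 (by positivity) (Real.exp_nonneg _)
    _ = p.factorial * Real.exp (1 - x) := by
        rw [mul_left_comm, ← Real.exp_add]
        congr 2
        ring
    _ ≤ p.factorial * Real.exp 1 := by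
        gcongr
        linarith

/-- The differences `(1 - x^τ E)^d Φ`, damped by `x^j`, are bounded uniformly in `x ∈ [0, 1]`:
expand `1 - y E = y (1 - E) + (1 - y)` and use the growth of the lower differences. -/
theorem norm_damped_difference_le (hτ : 0 < τ) (d : ℕ) {Φ : ℕ → W} {K : ℝ}
    (hK : ∀ j, ‖((1 - seqShift W τ) ^ d) Φ j‖ ≤ K) :
    ∃ M, ∀ (x : ℝ), 0 ≤ x → x ≤ 1 → ∀ j : ℕ,
      ‖((x : ℂ) ^ j) • ((1 - ((x : ℂ) ^ τ) • seqShift W τ) ^ d) Φ j‖ ≤ M := by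
  have hlow : ∀ i, i ≤ d → ∃ M, 0 ≤ M ∧
      ∀ j : ℕ, ‖((1 - seqShift W τ) ^ i) Φ j‖ ≤ M * (1 + j) ^ (d - i) := by
    intro i hi
    refine norm_le_of_bounded_differences hτ (d - i) (K := K) fun j => ?_
    rw [← Module.End.mul_apply, ← pow_add, Nat.sub_add_cancel hi]
    exact hK j
  choose! M hM0 hM using hlow
  refine ⟨∑ i ∈ Finset.range (d + 1), (d.choose i : ℝ) * (M i * (τ ^ (d - i) *
    ((d - i).factorial * Real.exp 1))), fun x hx0 hx1 j => ?_⟩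
  set y : ℝ := x ^ τ with hy
  have hy0 : 0 ≤ y := pow_nonneg hx0 _
  have hy1 : y ≤ 1 := pow_le_one₀ hx0 hx1
  have hyx : 1 - y ≤ τ * (1 - x) := by
    have := one_add_mul_le_pow (a := x - 1) (by linarith) τ
    rw [add_sub_cancel] at this
    linarith
  have hexp : ((1 - ((x : ℂ) ^ τ) • seqShift W τ) ^ d) Φ j
      = ∑ i ∈ Finset.range (d + 1), (((d.choose i : ℝ) * (y ^ i * (1 - y) ^ (d - i)) : ℝ) : ℂ) •
        ((1 - seqShift W τ) ^ i) Φ j := by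
    have e : 1 - ((x : ℂ) ^ τ) • seqShift W τ
        = (y : ℂ) • (1 - seqShift W τ) + ((1 - y : ℝ) : ℂ) • 1 := by
      refine LinearMap.ext fun Ψ => funext fun i => ?_
      simp only [LinearMap.sub_apply, LinearMap.add_apply, LinearMap.smul_apply, Pi.sub_apply,
        Pi.add_apply, Pi.smul_apply, Module.End.one_apply, hy]
      push_cast
      module
    have hcomm : Commute ((y : ℂ) • (1 - seqShift W τ))
        (((1 - y : ℝ) : ℂ) • (1 : Module.End ℂ (ℕ → W))) :=
      ((Commute.one_right _).smul_left _).smul_right _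
    rw [e, hcomm.add_pow, LinearMap.sum_apply, Finset.sum_apply]
    refine Finset.sum_congr rfl fun i _ => ?_
    rw [smul_pow, smul_pow, one_pow, ← nsmul_eq_mul', LinearMap.smul_apply,
      Pi.smul_apply, smul_mul_smul_comm, mul_one, LinearMap.smul_apply, Pi.smul_apply,
      ← Nat.cast_smul_eq_nsmul ℂ, smul_smul]
    congr 1
    push_cast
    ring
  rw [hexp, Finset.smul_sum]
  refine (norm_sum_le _ _).trans (Finset.sum_le_sum fun i hi => ?_)
  have hid : i ≤ d := Nat.lt_succ_iff.mp (Finset.mem_range.mp hi)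
  rw [smul_smul, norm_smul, ← Complex.ofReal_pow, ← Complex.ofReal_mul, Complex.norm_real,
    Real.norm_of_nonneg (by
      have : 0 ≤ 1 - y := by linarith
      positivity)]
  calc x ^ j * ((d.choose i : ℝ) * (y ^ i * (1 - y) ^ (d - i))) * ‖((1 - seqShift W τ) ^ i) Φ j‖
      ≤ x ^ j * ((d.choose i : ℝ) * (1 * (τ * (1 - x)) ^ (d - i))) * (M i * (1 + j) ^ (d - i)) := by
        have h1 : 0 ≤ 1 - y := by linarith
        have h2 : y ^ i ≤ 1 := pow_le_one₀ hy0 hy1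
        have h3 := hM i hid j
        gcongr
    _ = (d.choose i : ℝ) * (M i * (τ ^ (d - i) * (x ^ j * ((1 - x) * (1 + j)) ^ (d - i)))) := by
        rw [mul_pow, mul_pow]
        ring
    _ ≤ _ := by
        have h1 := pow_mul_pow_le hx0 hx1 j (d - i)
        have h2 := hM0 i hid
        gcongr

/-- Let `A = (1 - X^τ)^d B` be a sequence obtained from a summable one by taking differences of
order `d`, and let the differences of order `d` of `Φ` be bounded. If `∑ ⟨A_m, Φ_m⟩` converges,
its sum is obtained by moving the differences to `Φ`. Since the boundary terms of a summation by
parts need not vanish, the sum is computed as the Abel limit of `∑ x^m ⟨A_m, Φ_m⟩`. -/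
theorem eq_tsum_of_tendsto_sum_inner (hτ : 0 < τ) (d : ℕ) {A B Φ : ℕ → W} {K : ℝ} {L : ℂ}
    (hA : ∀ m, A m = ∑ l ∈ Finset.range (d + 1), if l * τ ≤ m then
      ((-1 : ℂ) ^ l * (d.choose l : ℂ)) • B (m - l * τ) else 0)
    (hB : Summable fun j => ‖B j‖)
    (hK : ∀ j, ‖((1 - seqShift W τ) ^ d) Φ j‖ ≤ K)
    (hL : Tendsto (fun N => ∑ m ∈ Finset.range N, inner ℂ (A m) (Φ m)) atTop (𝓝 L)) :
    L = ∑' j, inner ℂ (B j) (((1 - seqShift W τ) ^ d) Φ j) := by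
  obtain ⟨M, hM⟩ := norm_damped_difference_le hτ d hK
  obtain ⟨G, hG0, hG⟩ := norm_le_of_bounded_differences hτ d hK
  -- the Abel sums
  have habel : ∀ x : ℝ, 0 < x → x < 1 → ∑' m, inner ℂ (A m) (Φ m) * (x : ℂ) ^ m
      = ∑' j, inner ℂ (B j) (((x : ℂ) ^ j) •
        ((1 - ((x : ℂ) ^ τ) • seqShift W τ) ^ d) Φ j) := by
    intro x hx0 hx1
    have hsum : ∀ l : ℕ, Summable fun j => inner ℂ (B j) (Φ (j + l * τ)) * (x : ℂ) ^ (j + l * τ) := by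
      intro l
      refine Summable.of_norm_bounded
        (hB.mul_right (G * ((d.factorial * Real.exp 1) / (1 - x) ^ d))) fun j => ?_
      rw [norm_mul, norm_pow, Complex.norm_real, Real.norm_of_nonneg hx0.le]
      have h1 := pow_mul_pow_le hx0.le hx1.le (j + l * τ) d
      have h2 : 0 < (1 - x) ^ d := pow_pos (by linarith) d
      rw [mul_pow, mul_left_comm, ← le_div_iff₀' h2] at h1
      calc ‖inner ℂ (B j) (Φ (j + l * τ))‖ * x ^ (j + l * τ)
          ≤ (‖B j‖ * (G * (1 + ((j + l * τ : ℕ) : ℝ)) ^ d)) * x ^ (j + l * τ) := by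
            gcongr
            exact (norm_inner_le_norm _ _).trans (by gcongr; exact hG _)
        _ = ‖B j‖ * (G * (x ^ (j + l * τ) * (1 + ((j + l * τ : ℕ) : ℝ)) ^ d)) := by ring
        _ ≤ _ := by gcongr
    have h1 : ∀ l : ℕ, HasSum (fun m => if l * τ ≤ m then
        inner ℂ (B (m - l * τ)) (Φ m) * (x : ℂ) ^ m else 0)
        (∑' j, inner ℂ (B j) (Φ (j + l * τ)) * (x : ℂ) ^ (j + l * τ)) := by
      intro l
      have hinj : Function.Injective fun j : ℕ => j + l * τ := add_left_injective _
      refine (hinj.hasSum_iff fun m hm => ?_).mp ((hsum l).hasSum.congr_fun fun j => ?_)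
      · rw [if_neg]
        intro h
        exact hm ⟨m - l * τ, Nat.sub_add_cancel h⟩
      · simp only [Function.comp_apply]
        rw [if_pos (Nat.le_add_left _ _), Nat.add_sub_cancel]
    have h2 : HasSum (fun m => inner ℂ (A m) (Φ m) * (x : ℂ) ^ m)
        (∑ l ∈ Finset.range (d + 1), ((-1 : ℂ) ^ l * (d.choose l : ℂ)) *
          ∑' j, inner ℂ (B j) (Φ (j + l * τ)) * (x : ℂ) ^ (j + l * τ)) := by
      refine (hasSum_sum fun l _ => (h1 l).mul_left ((-1 : ℂ) ^ l * (d.choose l : ℂ))).congr_fun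
        fun m => ?_
      rw [hA, sum_inner, Finset.sum_mul]
      refine Finset.sum_congr rfl fun l _ => ?_
      split_ifs
      · rw [inner_smul_left]
        simp
        ring
      · simp
    have h3 : HasSum (fun j => inner ℂ (B j) (((x : ℂ) ^ j) •
        ((1 - ((x : ℂ) ^ τ) • seqShift W τ) ^ d) Φ j))
        (∑ l ∈ Finset.range (d + 1), ((-1 : ℂ) ^ l * (d.choose l : ℂ)) *
          ∑' j, inner ℂ (B j) (Φ (j + l * τ)) * (x : ℂ) ^ (j + l * τ)) := by
      refine (hasSum_sum fun l _ => (hsum l).hasSum.mul_left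
        ((-1 : ℂ) ^ l * (d.choose l : ℂ))).congr_fun fun j => ?_
      rw [one_sub_smul_seqShift_pow_apply, Finset.smul_sum, inner_sum]
      refine Finset.sum_congr rfl fun l _ => ?_
      rw [inner_smul_right, inner_smul_right, ← pow_mul, pow_add, mul_comm τ l]
      ring
    rw [h2.tsum_eq, h3.tsum_eq]
  have hlim1 : Tendsto (fun x : ℝ => ∑' m, inner ℂ (A m) (Φ m) * (x : ℂ) ^ m) (𝓝[<] 1) (𝓝 L) :=
    tendsto_map'_iff.mp (Complex.tendsto_tsum_powerSeries_nhdsWithin_lt hL)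
  have hmem : ∀ᶠ x : ℝ in 𝓝[<] 1, 0 < x ∧ x < 1 := by
    filter_upwards [Ioo_mem_nhdsLT (show (0 : ℝ) < 1 by norm_num)] with x hx using hx
  have hlim2 : Tendsto (fun x : ℝ => ∑' j, inner ℂ (B j) (((x : ℂ) ^ j) •
      ((1 - ((x : ℂ) ^ τ) • seqShift W τ) ^ d) Φ j)) (𝓝[<] 1)
      (𝓝 (∑' j, inner ℂ (B j) (((1 - seqShift W τ) ^ d) Φ j))) := by
    refine tendsto_tsum_of_dominated_convergence (hB.mul_right M) (fun j => ?_) ?_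
    · have hcont : Continuous fun x : ℝ => inner ℂ (B j) (((x : ℂ) ^ j) •
          ((1 - ((x : ℂ) ^ τ) • seqShift W τ) ^ d) Φ j) := by
        simp only [one_sub_smul_seqShift_pow_apply]
        fun_prop
      have := (hcont.tendsto 1).mono_left (nhdsWithin_le_nhds (s := Set.Iio 1))
      simpa using this
    · filter_upwards [hmem] with x hx j
      exact (norm_inner_le_norm _ _).trans
        (mul_le_mul_of_nonneg_left (hM x hx.1.le hx.2.le j) (norm_nonneg _))
  refine tendsto_nhds_unique hlim1 (hlim2.congr' ?_)
  filter_upwards [hmem] with x hx using (habel x hx.1 hx.2).symm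

end Abel

/-- The difference operator of order `d` with step `τ` inverts `D^τ`. -/
theorem aVec_eq_sum_bVec {τ : ℕ} (hτ : 0 < τ) (d : ℕ) (T : ℝ) (a : ℝ → ℂ) (m : ℕ) :
    aVec T a m = ∑ l ∈ Finset.range (d + 1), if l * τ ≤ m then
      ((-1 : ℂ) ^ l * (d.choose l : ℂ)) • bVec d τ T a (m - l * τ) else 0 := by
  set G : PowerSeries ℂ := PowerSeries.mk fun n => if τ ∣ n then (1 : ℂ) else 0 with hGdef
  have hG : (1 - PowerSeries.X ^ τ) * G = 1 := by
    ext n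
    rw [sub_mul, one_mul, map_sub, PowerSeries.coeff_X_pow_mul', hGdef, PowerSeries.coeff_mk,
      PowerSeries.coeff_one]
    by_cases hn : n = 0
    · subst hn
      simp [hτ.ne']
    · rw [if_neg hn]
      by_cases hτn : τ ≤ n
      · have h : τ ∣ n - τ ↔ τ ∣ n := Nat.dvd_sub_iff_left hτn dvd_rfl
        simp only [if_pos hτn, PowerSeries.coeff_mk, h, sub_self]
      · rw [if_neg hτn, if_neg fun h => hτn (Nat.le_of_dvd (by omega) h), sub_zero]
  ext k
  set α : PowerSeries ℂ := PowerSeries.mk fun m => aVec T a m k with hα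
  have hb : ∀ j, bVec d τ T a j k = PowerSeries.coeff j (G ^ d * α) := by
    intro j
    rw [PowerSeries.coeff_mul, Finset.Nat.sum_antidiagonal_eq_sum_range_succ_mk, bVec,
      lp.coeFn_sum, Finset.sum_apply, ← Finset.sum_range_reflect]
    refine Finset.sum_congr rfl fun i hi => ?_
    have hi' : i ≤ j := Nat.lt_succ_iff.mp (Finset.mem_range.mp hi)
    rw [show j + 1 - 1 - i = j - i by omega, show j - (j - i) = i by omega, hα,
      PowerSeries.coeff_mk]
    rfl
  have h1 : α = ∑ l ∈ Finset.range (d + 1), PowerSeries.C ((-1 : ℂ) ^ l * (d.choose l : ℂ)) *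
      (PowerSeries.X ^ (l * τ) * (G ^ d * α)) := by
    have h2 : (1 - PowerSeries.X ^ τ : PowerSeries ℂ) ^ d
        = ∑ l ∈ Finset.range (d + 1), PowerSeries.C ((-1 : ℂ) ^ l * (d.choose l : ℂ)) *
          PowerSeries.X ^ (l * τ) := by
      rw [sub_eq_add_neg, add_comm, add_pow]
      refine Finset.sum_congr rfl fun l _ => ?_
      rw [one_pow, mul_one, neg_pow, ← pow_mul, mul_comm τ l]
      simp
      ring
    simp only [← mul_assoc _ (PowerSeries.X ^ (_ * τ)) _]
    rw [← Finset.sum_mul, ← h2, ← mul_assoc, ← mul_pow, hG, one_pow, one_mul]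
  have h3 := congrArg (PowerSeries.coeff m) h1
  rw [map_sum, hα, PowerSeries.coeff_mk, ← hα] at h3
  rw [h3, lp.coeFn_sum, Finset.sum_apply]
  refine Finset.sum_congr rfl fun l _ => ?_
  rw [PowerSeries.coeff_C_mul, PowerSeries.coeff_X_pow_mul']
  split_ifs
  · rw [← hb]
    rfl
  · rw [mul_zero]
    rfl

/-! ### Fourier coefficients over a period -/

theorem freq_even (m : ℕ) : freq (2 * m) = -(m : ℤ) := by
  rw [freq, show (2 * m + 1) / 2 = m by omega, pow_succ, pow_mul]
  simp

theorem freq_odd (m : ℕ) : freq (2 * m + 1) = (m : ℤ) + 1 := by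
  rw [freq, show (2 * m + 1 + 1) / 2 = m + 1 by omega, show 2 * m + 1 + 1 = 2 * (m + 1) by ring,
    pow_mul]
  simp

theorem freq_injective : Function.Injective freq := by
  intro k n h
  obtain ⟨k', rfl | rfl⟩ := Nat.even_or_odd' k <;> obtain ⟨n', rfl | rfl⟩ := Nat.even_or_odd' n <;>
    simp only [freq_even, freq_odd] at h <;> omega

theorem freq_surjective : Function.Surjective freq := by
  intro n
  obtain h | h := le_or_gt n 0
  · exact ⟨2 * n.natAbs, by rw [freq_even]; omega⟩
  · exact ⟨2 * (n.natAbs - 1) + 1, by rw [freq_odd]; omega⟩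

/-- Lebesgue measure on `(0, T]`. -/
noncomputable def periodMeasure (T : ℝ) : Measure ℝ := volume.restrict (Set.Ioc 0 T)

instance (T : ℝ) : IsFiniteMeasure (periodMeasure T) := by unfold periodMeasure; infer_instance

/-- The function `T^{-1/2} exp(2 π i s_k u / T)`. -/
noncomputable def expFun (T : ℝ) (k : ℕ) (u : ℝ) : ℂ :=
  ((1 / Real.sqrt T : ℝ) : ℂ) * Complex.exp (2 * Real.pi * Complex.I * (freq k : ℂ) * u / T)

theorem conj_expFun (T : ℝ) (k : ℕ) (u : ℝ) : conj (expFun T k u)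
    = ((1 / Real.sqrt T : ℝ) : ℂ)
      * Complex.exp (-(2 * Real.pi * Complex.I * (freq k : ℂ) * u / T)) := by
  rw [expFun, map_mul, Complex.conj_ofReal, ← Complex.exp_conj]
  congr 2
  simp [Complex.conj_ofNat, neg_div]

theorem memLp_expFun (T : ℝ) (k : ℕ) : MemLp (expFun T k) 2 (periodMeasure T) := by
  refine MemLp.of_bound (Continuous.aestronglyMeasurable (by unfold expFun; fun_prop))
    ‖((1 / Real.sqrt T : ℝ) : ℂ)‖ (Eventually.of_forall fun u => ?_)
  rw [expFun, norm_mul, show 2 * Real.pi * Complex.I * (freq k : ℂ) * u / T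
    = ((2 * Real.pi * freq k * u / T : ℝ) : ℂ) * Complex.I by push_cast; ring,
    Complex.norm_exp_ofReal_mul_I, mul_one]

theorem inner_toLp {μ : Measure ℝ} {x y : ℝ → ℂ} (hx : MemLp x 2 μ) (hy : MemLp y 2 μ) :
    inner ℂ (hx.toLp x) (hy.toLp y) = ∫ u, conj (x u) * y u ∂μ := by
  rw [L2.inner_def]
  refine integral_congr_ae ?_
  filter_upwards [hx.coeFn_toLp, hy.coeFn_toLp] with u h1 h2
  rw [h1, h2, RCLike.inner_apply, mul_comm]

theorem orthonormal_expFun {T : ℝ} (hT : 0 < T) :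
    Orthonormal ℂ fun k => (memLp_expFun T k).toLp (expFun T k) := by
  have hTc : (T : ℂ) ≠ 0 := Complex.ofReal_ne_zero.mpr hT.ne'
  have hpi : (2 * Real.pi : ℂ) ≠ 0 := by simp [Real.pi_ne_zero]
  rw [orthonormal_iff_ite]
  intro k n
  have h1 : ∀ u : ℝ, conj (expFun T k u) * expFun T n u = (1 / T : ℂ) *
      Complex.exp ((2 * Real.pi * Complex.I * ((freq n - freq k : ℤ) : ℂ) / T) * u) := by
    intro u
    have h2 : ((1 / Real.sqrt T : ℝ) : ℂ) * ((1 / Real.sqrt T : ℝ) : ℂ) = 1 / T := by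
      rw [← Complex.ofReal_mul, div_mul_div_comm, Real.mul_self_sqrt hT.le]
      push_cast
      ring
    rw [conj_expFun, expFun, mul_mul_mul_comm, h2, ← Complex.exp_add]
    congr 2
    push_cast
    ring
  rw [inner_toLp, periodMeasure, ← intervalIntegral.integral_of_le hT.le]
  simp only [h1]
  rw [intervalIntegral.integral_const_mul]
  split_ifs with h
  · subst h
    simp [hTc]
  · have hz : ((freq n - freq k : ℤ) : ℂ) ≠ 0 := by
      rw [Int.cast_ne_zero, sub_ne_zero]
      exact fun h' => h (freq_injective h'.symm)
    rw [integral_exp_mul_complex (div_ne_zero (mul_ne_zero (mul_ne_zero hpi Complex.I_ne_zero) hz) hTc)]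
    have h3 : 2 * Real.pi * Complex.I * ((freq n - freq k : ℤ) : ℂ) / T * T
        = ((freq n - freq k : ℤ) : ℂ) * (2 * Real.pi * Complex.I) := by
      field_simp
    rw [h3, Complex.exp_int_mul_two_pi_mul_I]
    simp

/-- The trigonometric system as a Hilbert basis of `L²(0, T]`, in the order of `freq`. -/
noncomputable def expBasis {T : ℝ} (hT : 0 < T) : HilbertBasis ℕ ℂ (Lp ℂ 2 (periodMeasure T)) :=
  HilbertBasis.mkOfOrthogonalEqBot (orthonormal_expFun hT) <| by
    rw [Submodule.eq_bot_iff]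
    intro v hv
    have h1 : ∀ k, inner ℂ ((memLp_expFun T k).toLp (expFun T k)) v = 0 := fun k =>
      mem_span_orthogonal_iff.mp hv _ ⟨k, rfl⟩
    have hint : IntegrableOn v (Set.Ioc 0 (0 + T)) := by
      rw [zero_add]
      exact (Lp.memLp v).integrable (by norm_num)
    have h2 := ae_eq_zero_of_integral_exp_mul_eq_zero hT hint fun n => ?_
    · ext1
      rw [zero_add] at h2
      filter_upwards [h2, Lp.coeFn_zero ℂ 2 (periodMeasure T)] with u hu hu0
      rw [hu, hu0]
      rfl
    · obtain ⟨k, hk⟩ := freq_surjective (-n)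
      have h3 := h1 k
      rw [L2.inner_def, integral_congr_ae (g := fun u : ℝ => ((1 / Real.sqrt T : ℝ) : ℂ) *
        (Complex.exp (2 * Real.pi * Complex.I * n * u / T) * v u)), integral_const_mul,
        mul_eq_zero] at h3
      · rw [zero_add]
        exact h3.resolve_left (Complex.ofReal_ne_zero.mpr (by positivity))
      · filter_upwards [(memLp_expFun T k).coeFn_toLp] with u hu
        rw [hu, RCLike.inner_apply, mul_comm, conj_expFun, hk, mul_assoc]
        congr 3
        push_cast
        ring

theorem expBasis_repr {T : ℝ} (hT : 0 < T) {x : ℝ → ℂ} (hx : MemLp x 2 (periodMeasure T)) (k : ℕ) :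
    (expBasis hT).repr (hx.toLp x) k = ∫ u, conj (expFun T k u) * x u ∂periodMeasure T := by
  rw [HilbertBasis.repr_apply_apply, expBasis, HilbertBasis.coe_mkOfOrthogonalEqBot, inner_toLp]

theorem toSeq2_coe (v : Seq2) : toSeq2 v = v := by
  rw [toSeq2, dif_pos (lp.memℓp v)]

theorem aVec_eq {T : ℝ} (hT : 0 < T) {a : ℝ → ℂ} {j : ℕ}
    (ha : MemLp (fun u => conj (a (u + j * T))) 2 (periodMeasure T)) :
    star (aVec T a j) = (expBasis hT).repr (ha.toLp _) := by
  rw [← star_star ((expBasis hT).repr (ha.toLp _)), ← toSeq2_coe (star ((expBasis hT).repr _)), aVec]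
  congr 2
  ext k
  rw [lp.star_apply, expBasis_repr hT ha,
    intervalIntegral.integral_of_le hT.le, RCLike.star_def, ← integral_conj, periodMeasure,
    ← integral_const_mul]
  refine integral_congr_ae (Eventually.of_forall fun u => ?_)
  simp only [map_mul, Complex.conj_conj]
  rw [expFun]
  ring

/-! ### The generated sequences and the functional of the process -/

section GeneratedSequence

variable {Ω : Type*} [MeasurableSpace Ω] {P : Measure Ω}

theorem inner_intervalIntegral_eq_zero {H : Type*} [NormedAddCommGroup H] [InnerProductSpace ℂ H]
    [CompleteSpace H] {φ : ℝ → H} {v : H} (h : ∀ u, inner ℂ v (φ u) = 0) (a b : ℝ) :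
    inner ℂ v (∫ u in a..b, φ u) = 0 := by
  by_cases hφ : IntervalIntegrable φ volume a b
  · have := (innerSL ℂ v).intervalIntegral_comp_comm hφ
    simp only [innerSL_apply_apply, h] at this
    rw [← this, intervalIntegral.integral_zero]
  · rw [intervalIntegral.integral_undef hφ, inner_zero_right]

theorem moment_genSeq_eq_zero {d τ : ℕ} {T : ℝ} {ξ η : ℝ → Lp ℂ 2 P}
    (hξ0 : ∀ t : ℝ, expect (increment d ξ t (τ * T)) = 0)
    (huncorr : UncorrelatedIncrements d τ T ξ η) (k : ℕ) (l : ℤ) (n : ℕ) (j : ℤ) :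
    moment (genSeq d τ T ξ k l) (genSeq d τ T η n j) = 0 := by
  have h0 : ∀ t s, inner ℂ (increment d η s (τ * T)) (increment d ξ t (τ * T)) = 0 := fun t s => by
    rw [← moment_eq_inner, huncorr, hξ0, zero_mul]
  rw [moment_eq_inner, genSeq, genSeq, inner_smul_left, inner_smul_right]
  refine mul_eq_zero_of_right _ (mul_eq_zero_of_right _
    (inner_intervalIntegral_eq_zero (fun t => ?_) _ _))
  rw [inner_smul_right, ← inner_conj_symm]
  refine mul_eq_zero_of_right _ ((congrArg conj
    (inner_intervalIntegral_eq_zero (fun s => ?_) _ _)).trans (map_zero _))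
  rw [inner_smul_right, ← inner_conj_symm, h0, map_zero, mul_zero]

variable {ξ : ℝ → Lp ℂ 2 P}

theorem LocallySquareIntegrable.memLp_comp_sub (hξ : LocallySquareIntegrable ξ) (c T : ℝ) :
    MemLp (fun u => ξ (c - u)) 2 (periodMeasure T) := by
  have h1 := (hξ (|c| + |T|)).comp_measurePreserving
    ((Measure.measurePreserving_sub_left volume c).restrict_preimage measurableSet_Icc)
  refine h1.mono_measure (Measure.restrict_mono_set _ fun u hu => ?_)
  rw [Set.mem_preimage, Set.mem_Icc]
  have h2 := neg_abs_le c
  have h3 := le_abs_self c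
  have h4 := le_abs_self T
  have h5 := abs_nonneg T
  constructor <;> linarith [hu.1, hu.2]

/-- The vector of the Fourier coefficients of `u ↦ ⟨Z, ξ(-(u + m T))⟩`, `u ∈ (0, T]`. -/
noncomputable def testVec {T : ℝ} (hT : 0 < T) (hξ : LocallySquareIntegrable ξ) (Z : Lp ℂ 2 P)
    (m : ℕ) : Seq2 :=
  (expBasis hT).repr (((hξ.memLp_comp_sub (-(m * T)) T).const_inner (𝕜 := ℂ) Z).toLp _)

variable {T : ℝ} (hT : 0 < T) (hξ : LocallySquareIntegrable ξ)
include hT hξ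

theorem intervalIntegrable_exp_smul (k : ℕ) (c : ℝ) : IntervalIntegrable (fun u : ℝ =>
    Complex.exp (-(2 * Real.pi * Complex.I * (freq k : ℂ) * u / T)) • ξ (c - u)) volume 0 T := by
  rw [intervalIntegrable_iff_integrableOn_Ioc_of_le hT.le]
  have h1 : Integrable (fun u => ξ (c - u)) (volume.restrict (Set.Ioc 0 T)) :=
    (hξ.memLp_comp_sub c T).integrable (by norm_num)
  refine Integrable.bdd_smul (φ := fun u : ℝ =>
    Complex.exp (-(2 * Real.pi * Complex.I * (freq k : ℂ) * u / T))) h1 1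
    (Continuous.aestronglyMeasurable (by fun_prop)) (Eventually.of_forall fun u => ?_)
  rw [show -(2 * Real.pi * Complex.I * (freq k : ℂ) * u / T)
    = ((-(2 * Real.pi * freq k * u / T) : ℝ) : ℂ) * Complex.I by push_cast; ring,
    Complex.norm_exp_ofReal_mul_I]

theorem testVec_apply (Z : Lp ℂ 2 P) (m k : ℕ) : testVec hT hξ Z m k
    = inner ℂ Z (((1 / Real.sqrt T : ℝ) : ℂ) • ∫ u in (0 : ℝ)..T,
      Complex.exp (-(2 * Real.pi * Complex.I * (freq k : ℂ) * u / T)) • ξ (-(m * T) - u)) := by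
  have h1 := (innerSL ℂ Z).intervalIntegral_comp_comm
    (intervalIntegrable_exp_smul hT hξ k (-(m * T)))
  simp only [innerSL_apply_apply] at h1
  rw [testVec, expBasis_repr, inner_smul_right, ← h1, intervalIntegral.integral_of_le hT.le,
    periodMeasure, ← integral_const_mul]
  refine integral_congr_ae (Eventually.of_forall fun u => ?_)
  simp only
  rw [conj_expFun, inner_smul_right, mul_assoc]

/-- The differences of the test vectors are the coordinates of the generated sequence. -/
theorem inner_genSeq (d τ : ℕ) (Z : Lp ℂ 2 P) (k j : ℕ) :
    inner ℂ Z (genSeq d τ T ξ k (-(j : ℤ)))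
      = ((1 - seqShift Seq2 τ) ^ d) (testVec hT hξ Z) j k := by
  have h0 := one_sub_smul_seqShift_pow_apply (τ := τ) d 1 (testVec hT hξ Z) j
  rw [one_smul] at h0
  rw [h0, lp.coeFn_sum, Finset.sum_apply]
  have h1 : genSeq d τ T ξ k (-(j : ℤ)) = ∑ l ∈ Finset.range (d + 1),
      ((-1 : ℂ) ^ l * (d.choose l : ℂ)) • (((1 / Real.sqrt T : ℝ) : ℂ) • ∫ u in (0 : ℝ)..T,
      Complex.exp (-(2 * Real.pi * Complex.I * (freq k : ℂ) * u / T)) •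
        ξ (-((j + l * τ : ℕ) * T) - u)) := by
    rw [genSeq]
    simp_rw [smul_comm (N := ℂ) (_ : ℂ) (((1 / Real.sqrt T : ℝ) : ℂ)), ← Finset.smul_sum]
    congr 1
    simp_rw [← intervalIntegral.integral_smul]
    rw [← intervalIntegral.integral_finsetSum]
    · refine intervalIntegral.integral_congr fun u _ => ?_
      simp only [increment, Finset.smul_sum]
      refine Finset.sum_congr rfl fun l _ => ?_
      rw [smul_comm]
      congr 3
      push_cast
      ring
    · intro l _
      exact (intervalIntegrable_exp_smul hT hξ k (-((j + l * τ : ℕ) * T))).smul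
        ((-1 : ℂ) ^ l * (d.choose l : ℂ))
  rw [h1, inner_sum]
  refine Finset.sum_congr rfl fun l _ => ?_
  rw [inner_smul_right, ← testVec_apply hT hξ, one_pow, mul_one]
  rfl

theorem sum_inner_aVec_testVec {a : ℝ → ℂ} (ha : ∀ M : ℝ, MemLp a 2 (volume.restrict (Set.Icc 0 M)))
    (Z : Lp ℂ 2 P) (N : ℕ) :
    ∑ m ∈ Finset.range N, inner ℂ (star (aVec T a m)) (testVec hT hξ Z m)
      = inner ℂ Z (∫ t in (0 : ℝ)..(N * T), a t • ξ (-t)) := by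
  have hmul : ∀ M : ℝ, 0 ≤ M → IntervalIntegrable (fun t => a t • ξ (-t)) volume 0 M := by
    intro M hM
    rw [intervalIntegrable_iff_integrableOn_Ioc_of_le hM]
    have h1 := hξ.memLp_comp_sub 0 M
    simp only [zero_sub] at h1
    exact memLp_one_iff_integrable.mp
      (h1.smul ((ha M).mono_measure (Measure.restrict_mono_set _ Set.Ioc_subset_Icc_self)))
  have hpart : ∀ m : ℕ, inner ℂ (star (aVec T a m)) (testVec hT hξ Z m)
      = inner ℂ Z (∫ t in (m * T)..((m + 1 : ℕ) * T), a t • ξ (-t)) := by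
    intro m
    have hmT : (0 : ℝ) ≤ m * T := by positivity
    have ha' : MemLp (fun u => a (u + m * T)) 2 (periodMeasure T) := by
      have h1 := (ha (m * T + T)).comp_measurePreserving
        ((measurePreserving_add_right volume ((m : ℝ) * T)).restrict_preimage measurableSet_Icc)
      refine h1.mono_measure (Measure.restrict_mono_set _ fun u hu => ?_)
      rw [Set.mem_preimage, Set.mem_Icc]
      constructor <;> linarith [hu.1, hu.2]
    have hint : IntervalIntegrable (fun t => a t • ξ (-t)) volume (m * T) ((m + 1 : ℕ) * T) :=
      (hmul _ hmT).symm.trans (hmul _ (by positivity))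
    have h2 := (innerSL ℂ Z).intervalIntegral_comp_comm hint
    simp only [innerSL_apply_apply, inner_smul_right] at h2
    rw [aVec_eq hT ha'.star, testVec, LinearIsometryEquiv.inner_map_map, inner_toLp, ← h2,
      periodMeasure, ← intervalIntegral.integral_of_le hT.le]
    have h3 := intervalIntegral.integral_comp_add_right
      (f := fun t => a t * inner ℂ Z (ξ (-t))) (a := 0) (b := T) (m * T)
    rw [zero_add, show T + m * T = (m + 1 : ℕ) * T by push_cast; ring] at h3
    rw [← h3]
    refine intervalIntegral.integral_congr fun u _ => ?_
    simp only [Complex.conj_conj]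
    rw [neg_add_rev, ← sub_eq_add_neg]
  rw [Finset.sum_congr rfl fun m _ => hpart m, ← inner_sum,
    intervalIntegral.sum_integral_adjacent_intervals (a := fun m : ℕ => (m : ℝ) * T)]
  · simp
  · intro m _
    exact (hmul _ (by positivity)).symm.trans (hmul _ (by positivity))

/-- The functional of the process equals the functional of the generated sequence. Tested with `Z`,
it becomes a statement on the numerical function `t ↦ ⟨Z, ξ(-t)⟩`, to which Parseval's identity on
each period and summation by parts apply. -/
theorem functional_eq {d τ : ℕ} (hτ : 0 < τ) {a : ℝ → ℂ}
    (ha : ∀ M : ℝ, MemLp a 2 (volume.restrict (Set.Icc 0 M)))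
    (hb : Summable fun j : ℕ => ‖bVec d τ T a j‖) {s : ℕ → ℝ} (hs : Summable fun k => s k ^ 2)
    (hX : ∀ k j, ‖genSeq d τ T ξ k j‖ ≤ s k) {Aξ Bξ : Lp ℂ 2 P}
    (hB : HasSum (fun p : ℕ × ℕ => bVec d τ T a p.1 p.2 • genSeq d τ T ξ p.2 (-(p.1 : ℤ))) Bξ)
    (hA : Tendsto (fun M : ℝ => ∫ t in (0 : ℝ)..M, a t • ξ (-t)) atTop (𝓝 Aξ)) : Aξ = Bξ := by
  refine ext_inner_left ℂ fun Z => ?_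
  set Φ := testVec hT hξ Z with hΦ
  have hL : Tendsto (fun N => ∑ m ∈ Finset.range N, inner ℂ (star (aVec T a m)) (Φ m)) atTop
      (𝓝 (inner ℂ Z Aξ)) := by
    simp only [hΦ, sum_inner_aVec_testVec hT hξ ha]
    refine tendsto_const_nhds.inner (hA.comp ?_)
    exact tendsto_natCast_atTop_atTop.atTop_mul_const hT
  have hK : ∀ j, ‖((1 - seqShift Seq2 τ) ^ d) Φ j‖ ≤ ‖Z‖ * √(∑' k, s k ^ 2) := by
    intro j
    have h1 := lp.hasSum_norm (p := 2) (by norm_num) (((1 - seqShift Seq2 τ) ^ d) Φ j)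
    refine le_of_sq_le_sq ?_ (by positivity)
    rw [mul_pow, Real.sq_sqrt (tsum_nonneg fun k => sq_nonneg _), ← tsum_mul_left]
    norm_num at h1
    refine hasSum_le (fun k => ?_) h1 (hs.mul_left _).hasSum
    rw [← inner_genSeq hT hξ, ← mul_pow]
    have h2 := hX k (-(j : ℤ))
    refine pow_le_pow_left₀ (norm_nonneg _) ((norm_inner_le_norm _ _).trans ?_) 2
    gcongr
  rw [eq_tsum_of_tendsto_sum_inner hτ d (B := fun j => star (bVec d τ T a j)) (fun m => ?_)
    (by simpa only [norm_star] using hb) hK hL]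
  · have h1 := hB.mapL (innerSL ℂ Z)
    have h2 := h1.prod_fiberwise (g := fun j => inner ℂ (star (bVec d τ T a j))
      (((1 - seqShift Seq2 τ) ^ d) Φ j)) fun j => by
        refine (lp.hasSum_inner _ _).congr_fun fun k => ?_
        rw [map_smul, innerSL_apply_apply, inner_genSeq hT hξ, lp.star_apply, RCLike.inner_apply,
          RCLike.star_def, RCLike.conj_conj, smul_eq_mul, mul_comm]
    exact h2.tsum_eq
  · rw [aVec_eq_sum_bVec hτ d T a m, star_sum]
    refine Finset.sum_congr rfl fun l _ => ?_
    split_ifs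
    · rw [star_smul]
      simp
    · exact star_zero _

end GeneratedSequence

end PCFilter

theorem theorem3 {Ω : Type*} [MeasurableSpace Ω] (P : Measure Ω) [IsProbabilityMeasure P]
    (d τ : ℕ) (hτ : 0 < τ) (T : ℝ) (hT : 0 < T)
    -- signal and noise
    (ξ η : ℝ → Lp ℂ 2 P)
    (hξloc : PCFilter.LocallySquareIntegrable ξ) (hηloc : PCFilter.LocallySquareIntegrable η)
    (hξ : PCFilter.HasPCIncrements d τ T ξ) (hη : PCFilter.HasPCIncrements d τ T η)
    (hξ0 : ∀ t : ℝ, PCFilter.expect (PCFilter.increment d ξ t (τ * T)) = 0)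
    (hη0 : ∀ t : ℝ, PCFilter.expect (PCFilter.increment d η t (τ * T)) = 0)
    (huncorr : PCFilter.UncorrelatedIncrements d τ T ξ η)
    -- spectral densities of the generated sequences, minimality condition
    (f g : ℝ → PCFilter.Seq2 →L[ℂ] PCFilter.Seq2)
    (hf : PCFilter.IsSpectralDensity d τ (PCFilter.genSeq d τ T ξ) f)
    (hg : PCFilter.IsSpectralDensity d τ (PCFilter.genSeq d τ T η) g)
    (hmin : PCFilter.Minimality d τ (fun θ => f θ + g θ))
    -- the weight function and the conditions on its coefficients
    (a : ℝ → ℂ) (ha : ∀ M : ℝ, MemLp a 2 (volume.restrict (Set.Icc 0 M)))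
    (hb : Summable fun j : ℕ => ‖PCFilter.bVec d τ T a j‖)
    (hb' : Summable fun j : ℕ => ((j : ℝ) + 1) * ‖PCFilter.bVec d τ T a j‖)
    -- `P⁻¹` exists, and `r = R D a`, `c = P⁻¹ R D a` are defined in `ℓ²`
    (hP : ∀ c : PCFilter.VecSeq2, PCFilter.IsPImage d τ f g c 0 → c = 0)
    (r c : PCFilter.VecSeq2)
    (hr : PCFilter.IsRImage f g (PCFilter.bVec d τ T a) r)
    (hc : PCFilter.IsPImage d τ f g c r)
    (C : ℝ → PCFilter.Seq2) (hC : PCFilter.IsSeriesSum c C) :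
    ∃ Bξ Xhat : Lp ℂ 2 P,
      -- the functional and its representation through the generated sequence
      HasSum (fun p : ℕ × ℕ =>
        PCFilter.bVec d τ T a p.1 p.2 • PCFilter.genSeq d τ T ξ p.2 (-(p.1 : ℤ))) Bξ ∧
      (∀ Aξ : Lp ℂ 2 P,
        Tendsto (fun M : ℝ => ∫ t in (0 : ℝ)..M, a t • ξ (-t)) atTop (𝓝 Aξ) → Aξ = Bξ) ∧
      -- the optimal estimate
      (∀ X : Lp ℂ 2 P,
        PCFilter.IsOptimalEstimate (PCFilter.pastSpace fun k j =>
          PCFilter.genSeq d τ T ξ k j + PCFilter.genSeq d τ T η k j) Bξ X ↔ X = Xhat) ∧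
      -- its spectral characteristic
      PCFilter.IsSpectralIntegral d τ (fun θ => f θ + g θ)
        (fun k j => PCFilter.genSeq d τ T ξ k j + PCFilter.genSeq d τ T η k j)
        (PCFilter.charNumerator d τ f (PCFilter.bFun (PCFilter.bVec d τ T a)) C) Xhat ∧
      -- the mean square error, as an integral
      Integrable
        (PCFilter.errSignal d τ f g (PCFilter.bFun (PCFilter.bVec d τ T a)) C) PCFilter.circ ∧
      Integrable
        (PCFilter.errNoise d τ f g (PCFilter.bFun (PCFilter.bVec d τ T a)) C) PCFilter.circ ∧
      PCFilter.moment (Bξ - Xhat) (Bξ - Xhat)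
        = (1 / (2 * Real.pi) : ℂ) *
            ∫ θ, PCFilter.errSignal d τ f g (PCFilter.bFun (PCFilter.bVec d τ T a)) C θ
              ∂PCFilter.circ
          + (1 / (2 * Real.pi) : ℂ) *
            ∫ θ, PCFilter.errNoise d τ f g (PCFilter.bFun (PCFilter.bVec d τ T a)) C θ
              ∂PCFilter.circ ∧
      -- the mean square error, through the operators: `⟨R D a, P⁻¹ R D a⟩ + ⟨Q D a, D a⟩`
      ∃ (q : ℕ → ℕ → ℂ) (s : ℂ),
        PCFilter.IsQImage d τ f g (PCFilter.bVec d τ T a) q ∧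
        HasSum (fun p : ℕ × ℕ => q p.1 p.2 * star (PCFilter.bVec d τ T a p.1 p.2)) s ∧
        PCFilter.moment (Bξ - Xhat) (Bξ - Xhat) = inner ℂ c r + s := by
  have hm := PCFilter.isMinimalPair hτ hf hg hmin
  have hXY := PCFilter.moment_genSeq_eq_zero (d := d) (τ := τ) (T := T) hξ0 huncorr
  obtain ⟨Bξ, hB⟩ := hm.hasSum_functional hf hg hXY hb
  obtain ⟨Xhat, h1, h2, h3, h4, h5, h6⟩ :=
    hm.exists_optimal_estimate hf hg hXY hP hb hr hc hC hB
  refine ⟨Bξ, Xhat, hB, fun Aξ hA => ?_, h1, h2, h3, h4, h5, h6⟩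
  exact PCFilter.functional_eq hT hξloc hτ ha hb hm.summable_norm_colExp_sq
    (fun k j => hm.norm_signal_le hf hg hXY k j) hB hA
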